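/- Let $\Gamma=(\mathbb Z/2)^n$ with the standard scalar product $\langle x,y\rangle=\sum_i x_iy_i\in\mathbb Z/2$; call $\gamma\in\Gamma$ even or odd according to $\langle\gamma,\gamma\rangle=0$ or $1$. Let $K$ be a field of characteristic $0$ and $A=\bigoplus_{\gamma\in\Gamma}A^\gamma$ an associative unital $\Gamma$-graded $K$-algebra with $ab=(-1)^{\langle |a|,|b|\rangle}ba$ for homogeneous $a,b$. Graded left $A$-modules are also right modules by $ma=(-1)^{\langle |a|,|m|\rangle}am$. Let $\pi\in\Gamma$ be odd, and let $M$ be a graded $A$-module with a basis of $r=r'+r''$ homogeneous elements, of prescribed degrees $\gamma_1,\dots,\gamma_r$, of which $\gamma_1,\dots,\gamma_{r'}$ are even and $\gamma_{r'+1},\dots,\gamma_r$ are odd. Below, "basis" means a basis $e=(e_1,\dots,e_r)$ of $M$ with $e_i\in M^{\gamma_i}$. **Graded Berezinian.** Let $GL^0$ be the group of invertible matrices $T=(t_{ij})_{i,j\le r}$ with $t_{ij}\in A^{\gamma_i+\gamma_j}$. Write $T=\begin{pmatrix}T_{00}&T_{01}\\T_{10}&T_{11}\end{pmatrix}$ according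 to the parity of the $\gamma_i$, and put $$\mathrm{gber}(T)=\mathrm{gdet}\big(T_{00}-T_{01}T_{11}^{-1}T_{10}\big)\cdot\mathrm{gdet}(T_{11})^{-1},$$ where for an $m\times m$ matrix $X$ with $|x_{ij}|=g_i+g_j$, the $g_i\in\Gamma$ being all even or all odd, $$\mathrm{gdet}(X)=\sum_{s\in S_m}\mathrm{sign}(s)\prod_{i<k}(-1)^{\langle g_{s(i)}+g_i,\,g_{s(k)}\rangle}\prod_{i<k,\ s(k)<s(i)}(-1)^{\langle g_{s(i)},\,g_{s(i)}+g_{s(k)}\rangle}\;x_{s(1)1}x_{s(2)2}\cdots x_{s(m)m}.$$ The module $\mathrm{GBer}(M)$ is the $A$-module generated by symbols $\mathrm B(e)$, of degree $\sum_i\gamma_i$, one for each basis $e$, with the relations $\mathrm B(e')=\mathrm B(e)\,\mathrm{gber}(T)$ whenever $e'_i=\sum_j e_jt_{ji}$. **Koszul complex.** Let $\Pi M$ be $M$ with the shifted grading $(\Pi M)^\alpha=M^{\alpha+\pi}$ and $\Pi(am)=(-1)^{\langle\pi,|a|\rangle}a\,\Pi m$. Let $M^*$ be the graded dual, i.e.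 the maps $\ell:M\to A$ with $\ell(ma)=\ell(m)a$, and for a basis $e$ let $\varepsilon^i\in M^*$ be the dual basis. Let $\mathcal K=S_A(\Pi M\oplus M^*)$ be the graded symmetric algebra, let $d$ be left multiplication by $\sum_i\Pi e_i\,\varepsilon^i$, and $H(\mathcal K)=\ker d/\operatorname{im}d$. Put $x_i=\varepsilon^i$, $\xi_i=\Pi e_i$ for $i\le r'$ and $x_i=\Pi e_i$, $\xi_i=-(-1)^{\langle\gamma_i,\pi\rangle}\varepsilon^i$ for $i>r'$, and let $\mathcal K^k\subset\mathcal K$ consist of the polynomials over $A$ in the $x_i,\xi_i$ of degree $k$ in the $\xi_i$. **Theorem.** 1. $T\mapsto\mathrm{gber}(T)$ is a group homomorphism $GL^0\to(A^0)^\times$. If $T$ is block-diagonal for the partition of the indices by the degrees $\gamma_i$, with diagonal blocks $T_\gamma$ (matrices over the commutative ring $A^0$), then $\mathrm{gber}(T)=\prod_{\gamma\ \mathrm{even}}\det T_\gamma\cdot\prod_{\gamma\ \mathrm{odd}}(\det T_\gamma)^{-1}$. If $T$ is block-unitriangular with respect to some linear ordering of the degrees, then $\mathrm{gber}(T)=1$.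 2. $\mathrm{GBer}(M)$ is a graded $A$-module, free of rank $1$ with basis $\mathrm B(e)$, for every basis $e$. 3. The element $d=\sum_i\Pi e_i\,\varepsilon^i$ does not depend on the basis $e$, and $d^2=0$. For every basis, $\mathcal K=\bigoplus_k\mathcal K^k$ and $d(\mathcal K^k)\subset\mathcal K^{k+1}$. The degree in $\Gamma$ makes $H(\mathcal K)$ a graded $A$-module. 4. For every basis $e$ the product $\xi_1\cdots\xi_r$ is a cocycle, and there is a unique isomorphism $\chi:\mathrm{GBer}(M)\to H(\mathcal K)$ of graded $A$-modules of degree $r'\pi$, that is, a bijective $K$-linear map with $\chi(am)=(-1)^{\langle r'\pi,|a|\rangle}a\,\chi(m)$ that maps $\mathrm{GBer}(M)^\gamma$ onto $H(\mathcal K)^{\gamma+r'\pi}$ for all $\gamma$, such that $\chi(\mathrm B(e))=[\xi_1\cdots\xi_r]$ for every basis $e$. -/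

import Mathlib

namespace GradedBerezinian

/-! ### The grading group `(ℤ/2)^n`, the sign rule, graded-commutative algebras -/

/-- The grading group `(ℤ/2)^n`. -/
abbrev Grp (n : ℕ) : Type := Fin n → ZMod 2

/-- The sign `(-1)^⟨α, β⟩`, where `⟨α, β⟩ = ∑ α_i β_i` is the standard scalar product. -/
def ksign {n : ℕ} (α β : Grp n) : ℤˣ := (-1 : ℤˣ) ^ (α ⬝ᵥ β)

theorem ksign_add_left {n : ℕ} (α β γ : Grp n) :
    ksign (α + β) γ = ksign α γ * ksign β γ := by
  simp only [ksign, add_dotProduct, uzpow_add]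

theorem ksign_add_right {n : ℕ} (α β γ : Grp n) :
    ksign α (β + γ) = ksign α β * ksign α γ := by
  simp only [ksign, dotProduct_add, uzpow_add]

theorem ksign_comm {n : ℕ} (α β : Grp n) : ksign α β = ksign β α := by
  simp only [ksign, dotProduct_comm]

theorem ksign_mul_self {n : ℕ} (α β : Grp n) : ksign α β * ksign α β = 1 :=
  Int.units_mul_self _

theorem ksign_zero_right {n : ℕ} (α : Grp n) : ksign α 0 = 1 := by
  simp [ksign]

theorem grp_add_self {n : ℕ} (α : Grp n) : α + α = 0 := by
  funext i
  exact CharTwo.add_self_eq_zero _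

/-- The rule `a b = (-1)^⟨|a|, |b|⟩ b a` for homogeneous elements of a graded algebra. -/
class IsGradedComm {K A : Type*} {n : ℕ} [Field K] [Ring A] [Algebra K A]
    (𝒜 : Grp n → Submodule K A) : Prop where
  comm : ∀ {α β : Grp n} {a b : A}, a ∈ 𝒜 α → b ∈ 𝒜 β → a * b = ksign α β • (b * a)

section Algebra

variable {K A : Type*} {n : ℕ} [Field K] [Ring A] [Algebra K A]

/-- The degree-zero part of a graded-commutative algebra is a commutative ring. -/
instance zeroCommRing (𝒜 : Grp n → Submodule K A) [GradedAlgebra 𝒜] [IsGradedComm 𝒜] :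
    CommRing (𝒜 0) :=
  { (inferInstance : Ring (𝒜 0)) with
    mul_comm := fun a b => by
      apply Subtype.ext
      have h := IsGradedComm.comm (𝒜 := 𝒜) a.2 b.2
      rw [ksign_zero_right, one_smul] at h
      exact h }

/-- The additive map `a ↦ (-1)^⟨γ, |a|⟩ a`. -/
def signFun (𝒜 : Grp n → Submodule K A) [GradedAlgebra 𝒜] (γ : Grp n) : A →+ A where
  toFun a := ∑ α : Grp n, ksign γ α • (DirectSum.decompose 𝒜 a α : A)
  map_zero' := by simp
  map_add' a b := by
    simp [DirectSum.decompose_add, Finset.sum_add_distrib]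

theorem signFun_of_mem (𝒜 : Grp n → Submodule K A) [GradedAlgebra 𝒜] (γ : Grp n)
    {α : Grp n} {a : A} (ha : a ∈ 𝒜 α) : signFun 𝒜 γ a = ksign γ α • a := by
  change (∑ β : Grp n, ksign γ β • (DirectSum.decompose 𝒜 a β : A)) = _
  rw [Finset.sum_eq_single α]
  · rw [DirectSum.decompose_of_mem_same 𝒜 ha]
  · intro β _ hβ
    rw [DirectSum.decompose_of_mem_ne 𝒜 ha (Ne.symm hβ), smul_zero]
  · intro h
    exact absurd (Finset.mem_univ _) h

/-- The algebra automorphism `τ_γ` of `A` given by `a ↦ (-1)^⟨γ, |a|⟩ a`. -/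
def signAut (𝒜 : Grp n → Submodule K A) [GradedAlgebra 𝒜] (γ : Grp n) : A →+* A :=
  { signFun 𝒜 γ with
    map_one' := by
      change signFun 𝒜 γ 1 = 1
      rw [signFun_of_mem 𝒜 γ SetLike.GradedOne.one_mem, ksign_zero_right, one_smul]
    map_mul' := fun a b => by
      change signFun 𝒜 γ (a * b) = signFun 𝒜 γ a * signFun 𝒜 γ b
      induction a using DirectSum.Decomposition.inductionOn 𝒜 with
      | zero => simp
      | add x y hx hy => rw [add_mul, map_add, hx, hy, map_add, add_mul]
      | homogeneous x =>
        induction b using DirectSum.Decomposition.inductionOn 𝒜 with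
        | zero => simp
        | add y z hy hz => rw [mul_add, map_add, hy, hz, map_add, mul_add]
        | homogeneous y =>
          rw [signFun_of_mem 𝒜 γ (SetLike.GradedMul.mul_mem x.2 y.2),
            signFun_of_mem 𝒜 γ x.2, signFun_of_mem 𝒜 γ y.2, ksign_add_right,
            smul_mul_smul_comm] }

theorem signAut_of_mem (𝒜 : Grp n → Submodule K A) [GradedAlgebra 𝒜] (γ : Grp n)
    {α : Grp n} {a : A} (ha : a ∈ 𝒜 α) : signAut 𝒜 γ a = ksign γ α • a :=
  signFun_of_mem 𝒜 γ ha

theorem signAut_smul (𝒜 : Grp n → Submodule K A) [GradedAlgebra 𝒜] (γ : Grp n)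
    (k : K) (a : A) : signAut 𝒜 γ (k • a) = k • signAut 𝒜 γ a := by
  rw [Algebra.smul_def, map_mul,
    signAut_of_mem 𝒜 γ (SetLike.algebraMap_mem_graded 𝒜 k), ksign_zero_right, one_smul,
    ← Algebra.smul_def]

theorem signAut_signAut (𝒜 : Grp n → Submodule K A) [GradedAlgebra 𝒜] (γ : Grp n) (a : A) :
    signAut 𝒜 γ (signAut 𝒜 γ a) = a := by
  induction a using DirectSum.Decomposition.inductionOn 𝒜 with
  | zero => simp
  | add x y hx hy => rw [map_add, map_add, hx, hy]
  | homogeneous x =>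
    rw [signAut_of_mem 𝒜 γ x.2, Units.smul_def, map_zsmul, signAut_of_mem 𝒜 γ x.2,
      ← Units.smul_def, smul_smul, ksign_mul_self, one_smul]

theorem signAut_add (𝒜 : Grp n → Submodule K A) [GradedAlgebra 𝒜] (γ δ : Grp n) (a : A) :
    signAut 𝒜 (γ + δ) a = signAut 𝒜 γ (signAut 𝒜 δ a) := by
  induction a using DirectSum.Decomposition.inductionOn 𝒜 with
  | zero => simp
  | add x y hx hy => rw [map_add, map_add, map_add, hx, hy]
  | homogeneous x =>
    rw [signAut_of_mem 𝒜 δ x.2, Units.smul_def, map_zsmul, signAut_of_mem 𝒜 γ x.2,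
      ← Units.smul_def, smul_smul, signAut_of_mem 𝒜 _ x.2, ksign_add_left, mul_comm]

end Algebra

/-! ### Parity shift and dual of a graded module -/

section Modules

variable {K A : Type*} {n : ℕ} [Field K] [Ring A] [Algebra K A]
  (𝒜 : Grp n → Submodule K A)

/-- The module `Π M` obtained from `M` by shifting degrees by `π`: the same group, with
`(Π M)^α = M^(α + π)` and `Π (a m) = (-1)^⟨π, |a|⟩ a (Π m)`. -/
@[nolint unusedArguments]
def Shift (_ : Grp n → Submodule K A) (_ : Grp n) (M : Type*) : Type _ := M

section
variable (π : Grp n) (M : Type*) [AddCommGroup M] [Module K M]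

instance : AddCommGroup (Shift 𝒜 π M) := inferInstanceAs (AddCommGroup M)

instance : Module K (Shift 𝒜 π M) := inferInstanceAs (Module K M)

instance [Module A M] [GradedAlgebra 𝒜] : Module A (Shift 𝒜 π M) :=
  Module.compHom M (signAut 𝒜 π)

/-- The map `m ↦ Π m`. -/
def toShift : M ≃ₗ[K] Shift 𝒜 π M := LinearEquiv.refl K M

theorem smul_toShift [Module A M] [GradedAlgebra 𝒜] (a : A) (m : M) :
    a • toShift 𝒜 π M m = toShift 𝒜 π M (signAut 𝒜 π a • m) := rfl

variable {M}

/-- The grading of `Π M`. -/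
def shiftGrading (ℳ : Grp n → Submodule K M) (α : Grp n) : Submodule K (Shift 𝒜 π M) :=
  (ℳ (α + π)).map (toShift 𝒜 π M).toLinearMap

end

variable {M : Type*} [AddCommGroup M] [Module K M] [Module A M] (ℳ : Grp n → Submodule K M)

/-- The dual `M^*`, the module of all graded morphisms `M → A`, that is of all (sums of
homogeneous) maps with `ℓ (m a) = ℓ (m) a`, where `m a = (-1)^⟨|a|, |m|⟩ a m`.  The left module
structure is `(a ℓ) (m) = a ℓ (m)`. -/
def Dual : Submodule A (M →ₗ[K] A) where
  carrier := {ℓ | ∀ (α β : Grp n) (a : A) (m : M), a ∈ 𝒜 α → m ∈ ℳ β →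
    ℓ (ksign α β • (a • m)) = ℓ m * a}
  zero_mem' := by intro α β a m _ _; simp
  add_mem' := by
    intro f g hf hg α β a m ha hm
    rw [LinearMap.add_apply, LinearMap.add_apply, hf α β a m ha hm, hg α β a m ha hm, add_mul]
  smul_mem' := by
    intro c f hf α β a m ha hm
    rw [LinearMap.smul_apply, LinearMap.smul_apply, hf α β a m ha hm, smul_eq_mul, smul_eq_mul,
      mul_assoc]

/-- The grading of `M^*`: a map has degree `γ` if it sends `M^α` to `A^(α + γ)`. -/
def dualGrading (γ : Grp n) : Submodule K (Dual 𝒜 ℳ) where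
  carrier := {ℓ | ∀ (α : Grp n) (m : M), m ∈ ℳ α → (ℓ : M →ₗ[K] A) m ∈ 𝒜 (α + γ)}
  zero_mem' := by intro α m _; simp
  add_mem' := by
    intro f g hf hg α m hm
    simpa using add_mem (hf α m hm) (hg α m hm)
  smul_mem' := by
    intro c f hf α m hm
    simpa using Submodule.smul_mem _ c (hf α m hm)

end Modules

/-! ### The graded symmetric algebra of a graded module -/

section SymmetricAlgebra

variable {K A : Type*} {n : ℕ} [Field K] [Ring A] [Algebra K A]
  (𝒜 : Grp n → Submodule K A)
  {N : Type*} [AddCommGroup N] [Module K N] [Module A N] (𝒩 : Grp n → Submodule K N)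

/-- The relations of the graded symmetric algebra.  The first six say that `A` maps to it by an
algebra homomorphism and `N` by a homomorphism of `A`-bimodules, where the right action on `N` is
`x a = (-1)^⟨|a|, |x|⟩ a x` (they present the tensor algebra of the bimodule `N` over `A`); the
last one is graded commutativity. -/
inductive SymRel : FreeAlgebra K (A ⊕ N) → FreeAlgebra K (A ⊕ N) → Prop
  | add_alg (a b : A) : SymRel (FreeAlgebra.ι K (Sum.inl (a + b)))
      (FreeAlgebra.ι K (Sum.inl a) + FreeAlgebra.ι K (Sum.inl b))
  | mul_alg (a b : A) : SymRel (FreeAlgebra.ι K (Sum.inl (a * b)))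
      (FreeAlgebra.ι K (Sum.inl a) * FreeAlgebra.ι K (Sum.inl b))
  | scalar (k : K) : SymRel (FreeAlgebra.ι K (Sum.inl (algebraMap K A k)))
      (algebraMap K (FreeAlgebra K (A ⊕ N)) k)
  | add_mod (x y : N) : SymRel (FreeAlgebra.ι K (Sum.inr (x + y)))
      (FreeAlgebra.ι K (Sum.inr x) + FreeAlgebra.ι K (Sum.inr y))
  | smul_left (a : A) (x : N) : SymRel (FreeAlgebra.ι K (Sum.inr (a • x)))
      (FreeAlgebra.ι K (Sum.inl a) * FreeAlgebra.ι K (Sum.inr x))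
  | smul_right {α β : Grp n} {a : A} {x : N} (ha : a ∈ 𝒜 α) (hx : x ∈ 𝒩 β) :
      SymRel (FreeAlgebra.ι K (Sum.inr (ksign α β • (a • x))))
        (FreeAlgebra.ι K (Sum.inr x) * FreeAlgebra.ι K (Sum.inl a))
  | comm {α β : Grp n} {x y : N} (hx : x ∈ 𝒩 α) (hy : y ∈ 𝒩 β) :
      SymRel (FreeAlgebra.ι K (Sum.inr x) * FreeAlgebra.ι K (Sum.inr y))
        (ksign α β • (FreeAlgebra.ι K (Sum.inr y) * FreeAlgebra.ι K (Sum.inr x)))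

/-- The graded symmetric algebra `S_A(N)` of a graded module `N`: the quotient of the tensor
algebra of `N` over `A` by the graded commutativity relations. -/
def GSym : Type _ := RingQuot (SymRel 𝒜 𝒩)

namespace GSym

instance : Ring (GSym 𝒜 𝒩) := inferInstanceAs (Ring (RingQuot (SymRel 𝒜 𝒩)))

instance : Algebra K (GSym 𝒜 𝒩) := inferInstanceAs (Algebra K (RingQuot (SymRel 𝒜 𝒩)))

/-- The quotient map from the free algebra. -/
def mk : FreeAlgebra K (A ⊕ N) →ₐ[K] GSym 𝒜 𝒩 := RingQuot.mkAlgHom K (SymRel 𝒜 𝒩)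

variable {𝒜 𝒩} in
theorem mk_rel {x y : FreeAlgebra K (A ⊕ N)} (h : SymRel 𝒜 𝒩 x y) :
    mk 𝒜 𝒩 x = mk 𝒜 𝒩 y := RingQuot.mkAlgHom_rel K h

/-- The structure map `A → S_A(N)`. -/
def ofAlg : A →+* GSym 𝒜 𝒩 where
  toFun a := mk 𝒜 𝒩 (FreeAlgebra.ι K (Sum.inl a))
  map_one' := by
    rw [← map_one (algebraMap K A), mk_rel (SymRel.scalar 1), map_one, map_one]
  map_mul' a b := by rw [mk_rel (SymRel.mul_alg a b), map_mul]
  map_zero' := by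
    rw [← map_zero (algebraMap K A), mk_rel (SymRel.scalar 0), map_zero, map_zero]
  map_add' a b := by rw [mk_rel (SymRel.add_alg a b), map_add]

/-- The inclusion `N → S_A(N)`. -/
def ofMod (x : N) : GSym 𝒜 𝒩 := mk 𝒜 𝒩 (FreeAlgebra.ι K (Sum.inr x))

theorem ofAlg_algebraMap (k : K) :
    ofAlg 𝒜 𝒩 (algebraMap K A k) = algebraMap K (GSym 𝒜 𝒩) k := by
  change mk 𝒜 𝒩 _ = _
  rw [mk_rel (SymRel.scalar k), AlgHom.commutes]

theorem ofMod_smul (a : A) (x : N) :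
    ofMod 𝒜 𝒩 (a • x) = ofAlg 𝒜 𝒩 a * ofMod 𝒜 𝒩 x := by
  change mk 𝒜 𝒩 _ = mk 𝒜 𝒩 _ * mk 𝒜 𝒩 _
  rw [mk_rel (SymRel.smul_left a x), map_mul]

/-- `S_A(N)` as a left `A`-module. -/
instance : Module A (GSym 𝒜 𝒩) := Module.compHom (GSym 𝒜 𝒩) (ofAlg 𝒜 𝒩)

theorem smul_eq (a : A) (s : GSym 𝒜 𝒩) : a • s = ofAlg 𝒜 𝒩 a * s := rfl

instance : IsScalarTower K A (GSym 𝒜 𝒩) where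
  smul_assoc k a s := by
    rw [smul_eq, smul_eq, Algebra.smul_def, map_mul, ofAlg_algebraMap, mul_assoc,
      ← Algebra.smul_def]

theorem ofMod_mul_ofAlg [GradedAlgebra 𝒜] {β : Grp n} {x : N} (hx : x ∈ 𝒩 β) (a : A) :
    ofMod 𝒜 𝒩 x * ofAlg 𝒜 𝒩 a = ofAlg 𝒜 𝒩 (signAut 𝒜 β a) * ofMod 𝒜 𝒩 x := by
  induction a using DirectSum.Decomposition.inductionOn 𝒜 with
  | zero => simp
  | add a b ha hb => simp only [map_add, mul_add, add_mul, ha, hb]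
  | @homogeneous α a =>
    have h : mk 𝒜 𝒩 _ = mk 𝒜 𝒩 _ := mk_rel (SymRel.smul_right a.2 hx)
    rw [map_mul] at h
    change mk 𝒜 𝒩 _ * mk 𝒜 𝒩 _ = _
    rw [← h]
    change ofMod 𝒜 𝒩 _ = _
    rw [signAut_of_mem 𝒜 β a.2, ← ofMod_smul, ksign_comm α β]
    rcases Int.units_eq_one_or (ksign β α) with hs | hs <;> simp [hs]

/-- Products of homogeneous elements of `A` and of `N`, with their total degrees. -/
inductive IsMonomial : Grp n → GSym 𝒜 𝒩 → Prop
  | alg {α : Grp n} {a : A} (ha : a ∈ 𝒜 α) : IsMonomial α (ofAlg 𝒜 𝒩 a)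
  | mod {α : Grp n} {x : N} (hx : x ∈ 𝒩 α) : IsMonomial α (ofMod 𝒜 𝒩 x)
  | mul {α β : Grp n} {s t : GSym 𝒜 𝒩} (hs : IsMonomial α s) (ht : IsMonomial β t) :
      IsMonomial (α + β) (s * t)

/-- The `(ℤ/2)^n`-grading of `S_A(N)`. -/
def grading (γ : Grp n) : Submodule K (GSym 𝒜 𝒩) :=
  Submodule.span K {s | IsMonomial 𝒜 𝒩 γ s}

end GSym

end SymmetricAlgebra

/-! ### Homogeneous bases and their duals -/

section Bases

variable {K A : Type*} {n : ℕ} [Field K] [Ring A] [Algebra K A]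
  (𝒜 : Grp n → Submodule K A)
  {M : Type*} [AddCommGroup M] [Module K M] [Module A M]
  {ℳ : Grp n → Submodule K M} {ι : Type*} {deg : ι → Grp n}

/-- Bases of `M` by homogeneous elements `e i` of the prescribed degrees `deg i`. -/
def HomBasis (A : Type*) [Ring A] {M : Type*} [AddCommGroup M] [Module K M] [Module A M]
    (ℳ : Grp n → Submodule K M) {ι : Type*} (deg : ι → Grp n) : Type _ :=
  {e : Module.Basis ι A M // ∀ i, e i ∈ ℳ (deg i)}

theorem decompose_smul_apply [GradedAlgebra 𝒜] [DirectSum.Decomposition ℳ]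
    [SetLike.GradedSMul 𝒜 ℳ] (a : A) {x : M} {δ : Grp n} (hx : x ∈ ℳ δ) (β : Grp n) :
    (DirectSum.decompose ℳ (a • x) β : M) = (DirectSum.decompose 𝒜 a (β + δ) : A) • x := by
  induction a using DirectSum.Decomposition.inductionOn 𝒜 with
  | zero => simp
  | add a b ha hb =>
    simp only [add_smul, DirectSum.decompose_add, DirectSum.add_apply, Submodule.coe_add, ha, hb]
  | @homogeneous α a =>
    have h : (a : A) • x ∈ ℳ (α + δ) := SetLike.GradedSMul.smul_mem a.2 hx
    by_cases hβ : β = α + δ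
    · subst hβ
      have h2 : α + δ + δ = α := by rw [add_assoc, grp_add_self, add_zero]
      rw [DirectSum.decompose_of_mem_same ℳ h, h2, DirectSum.decompose_of_mem_same 𝒜 a.2]
    · have h2 : α ≠ β + δ := by
        intro h3
        apply hβ
        rw [h3, add_assoc, grp_add_self, add_zero]
      rw [DirectSum.decompose_of_mem_ne ℳ h (Ne.symm hβ),
        DirectSum.decompose_of_mem_ne 𝒜 a.2 h2, zero_smul]

theorem repr_mem [GradedAlgebra 𝒜] [DirectSum.Decomposition ℳ] [SetLike.GradedSMul 𝒜 ℳ]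
    [Fintype ι] (e : HomBasis A ℳ deg) {β : Grp n} {m : M} (hm : m ∈ ℳ β) (i : ι) :
    e.1.repr m i ∈ 𝒜 (β + deg i) := by
  have h : ∑ j, (DirectSum.decompose 𝒜 (e.1.repr m j) (β + deg j) : A) • e.1 j = m := by
    conv_rhs => rw [← DirectSum.decompose_of_mem_same ℳ hm, ← e.1.sum_repr m]
    rw [DirectSum.decompose_sum, DirectSum.sum_apply, Submodule.coe_sum]
    exact Finset.sum_congr rfl fun j _ => (decompose_smul_apply 𝒜 _ (e.2 j) β).symm
  have h2 := e.1.repr_sum_self fun j => (DirectSum.decompose 𝒜 (e.1.repr m j) (β + deg j) : A)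
  rw [h] at h2
  rw [congrFun h2 i]
  exact SetLike.coe_mem _

/-- The dual basis: `ε^i` is the homogeneous element of `M^*` with `ε^i (e_j) = δ^i_j`.  It
returns the `i`-th right coordinate, `m = ∑ e_i ε^i(m)`, which is `a ↦ (-1)^⟨|a|, |e_i|⟩ a` applied
to the `i`-th left coordinate. -/
noncomputable def dualBasis [GradedAlgebra 𝒜] [IsGradedComm 𝒜] [IsScalarTower K A M]
    [DirectSum.Decomposition ℳ] [SetLike.GradedSMul 𝒜 ℳ] [Fintype ι]
    (e : HomBasis A ℳ deg) (i : ι) : Dual 𝒜 ℳ where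
  val :=
    { toFun := fun m => signAut 𝒜 (deg i) (e.1.repr m i)
      map_add' := fun x y => by rw [map_add, Finsupp.add_apply, map_add]
      map_smul' := fun k x => by
        rw [← algebraMap_smul A k x, map_smul, Finsupp.smul_apply, algebraMap_smul,
          signAut_smul, RingHom.id_apply] }
  property := by
    intro α β a m ha hm
    have hc : signAut 𝒜 (deg i) (e.1.repr m i) ∈ 𝒜 (β + deg i) := by
      rw [signAut_of_mem 𝒜 _ (repr_mem 𝒜 e hm i), Units.smul_def]
      exact zsmul_mem (repr_mem 𝒜 e hm i) _
    have h1 : signAut 𝒜 (deg i) (e.1.repr (a • m) i) =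
        ksign α β • (signAut 𝒜 (deg i) (e.1.repr m i) * a) := by
      rw [map_smul, Finsupp.smul_apply, smul_eq_mul, map_mul, signAut_of_mem 𝒜 _ ha,
        smul_mul_assoc, IsGradedComm.comm ha hc, smul_smul, ksign_add_right, ksign_comm (deg i) α,
        mul_comm (ksign α β), ← mul_assoc, ksign_mul_self, one_mul]
    change signAut 𝒜 (deg i) (e.1.repr (ksign α β • (a • m)) i) =
      signAut 𝒜 (deg i) (e.1.repr m i) * a
    rcases Int.units_eq_one_or (ksign α β) with hs | hs
    · rw [hs, one_smul] at h1
      rw [hs, one_smul, h1]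
    · rw [hs, Units.neg_smul, one_smul] at h1
      rw [hs, Units.neg_smul, one_smul, map_neg, Finsupp.neg_apply, map_neg, h1, neg_neg]

theorem dualBasis_apply_self [GradedAlgebra 𝒜] [IsGradedComm 𝒜] [IsScalarTower K A M]
    [DirectSum.Decomposition ℳ] [SetLike.GradedSMul 𝒜 ℳ] [Fintype ι] [DecidableEq ι]
    (e : HomBasis A ℳ deg) (i j : ι) :
    (dualBasis 𝒜 e i : M →ₗ[K] A) (e.1 j) = if i = j then 1 else 0 := by
  change signAut 𝒜 (deg i) (e.1.repr (e.1 j) i) = _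
  rw [Module.Basis.repr_self, Finsupp.single_apply]
  simp only [eq_comm (a := j)]
  split_ifs <;> simp

theorem dualBasis_mem [GradedAlgebra 𝒜] [IsGradedComm 𝒜] [IsScalarTower K A M]
    [DirectSum.Decomposition ℳ] [SetLike.GradedSMul 𝒜 ℳ] [Fintype ι]
    (e : HomBasis A ℳ deg) (i : ι) : dualBasis 𝒜 e i ∈ dualGrading 𝒜 ℳ (deg i) := by
  intro α m hm
  change signAut 𝒜 (deg i) (e.1.repr m i) ∈ _
  rw [signAut_of_mem 𝒜 _ (repr_mem 𝒜 e hm i), Units.smul_def]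
  exact zsmul_mem (repr_mem 𝒜 e hm i) _

end Bases

/-! ### The graded Berezinian of an invertible matrix of degree zero -/

section Berezinian

variable {K A : Type*} {n : ℕ} [Field K] [Ring A] [Algebra K A]

/-- The graded determinant of a matrix `X` whose entries have degrees `|X i j| = g i + g j`, where
the `g i` are all even or all odd:
`∑_s ± X_(s 1) 1 ⋯ X_(s m) m`, where the sign is the one with which
`∏_i ξ_(s i) X_(s i) i` (in this order) is equal to `ξ_1 ⋯ ξ_m ∏_i X_(s i) i` for graded
commuting symbols `ξ_i` that are all odd, of degree `g i` if the `g i` are odd and of degree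
`g i + π` for some odd `π` (the choice of which does not matter) if the `g i` are even.
If the `g i` are all equal, then the sign is that of `s`, and this is the determinant. -/
def gdet {m : ℕ} (g : Fin m → Grp n) (X : Matrix (Fin m) (Fin m) A) : A :=
  ∑ s : Equiv.Perm (Fin m),
    (Equiv.Perm.sign s *
      (∏ x : Fin m × Fin m with x.1 < x.2, ksign (g (s x.1) + g x.1) (g (s x.2))) *
      (∏ x : Fin m × Fin m with x.1 < x.2 ∧ s x.2 < s x.1,
        ksign (g (s x.1)) (g (s x.1) + g (s x.2)))) •
    (List.ofFn fun i => X (s i) i).prod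

/-- The graded Berezinian of a block matrix `T`, with first the rows and columns of even degree and
then those of odd degree:
`gdet (T₀₀ - T₀₁ T₁₁⁻¹ T₁₀) * gdet (T₁₁)⁻¹`. -/
noncomputable def gber {p q : ℕ} (deg : Fin p ⊕ Fin q → Grp n)
    (T : Matrix (Fin p ⊕ Fin q) (Fin p ⊕ Fin q) A) : A :=
  gdet (fun i => deg (Sum.inl i))
      (T.toBlocks₁₁ - T.toBlocks₁₂ * Ring.inverse T.toBlocks₂₂ * T.toBlocks₂₁) *
    Ring.inverse (gdet (fun j => deg (Sum.inr j)) T.toBlocks₂₂)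

variable (𝒜 : Grp n → Submodule K A) {ι : Type*} [Fintype ι] [DecidableEq ι] (deg : ι → Grp n)

/-- A matrix has degree zero if `|T i j| = deg i + deg j`. -/
def IsDegZero (T : Matrix ι ι A) : Prop := ∀ i j, T i j ∈ 𝒜 (deg i + deg j)

/-- The group `GL⁰` of invertible matrices of degree zero. -/
def GL0 [GradedAlgebra 𝒜] : Subgroup (Matrix ι ι A)ˣ where
  carrier := {T | IsDegZero 𝒜 deg (T : Matrix ι ι A) ∧
    IsDegZero 𝒜 deg ((T⁻¹ : (Matrix ι ι A)ˣ) : Matrix ι ι A)}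
  one_mem' := by
    have h : IsDegZero 𝒜 deg (1 : Matrix ι ι A) := by
      intro i j
      rw [Matrix.one_apply]
      split_ifs with hij
      · rw [hij, grp_add_self]
        exact SetLike.GradedOne.one_mem
      · exact zero_mem _
    exact ⟨h, by rw [inv_one]; exact h⟩
  mul_mem' := by
    have h : ∀ S T : Matrix ι ι A, IsDegZero 𝒜 deg S → IsDegZero 𝒜 deg T →
        IsDegZero 𝒜 deg (S * T) := by
      intro S T hS hT i j
      rw [Matrix.mul_apply]
      refine sum_mem fun k _ => ?_
      have h2 := SetLike.GradedMul.mul_mem (hS i k) (hT k j)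
      rwa [add_assoc, ← add_assoc (deg k), grp_add_self, zero_add] at h2
    intro S T hS hT
    exact ⟨h _ _ hS.1 hT.1, by rw [mul_inv_rev]; exact h _ _ hT.2 hS.2⟩
  inv_mem' := by
    intro T hT
    exact ⟨hT.2, by rw [inv_inv]; exact hT.1⟩

variable {𝒜 deg} in
/-- The diagonal block of `T` at the degree `γ`, a matrix over the commutative ring `A⁰`. -/
def diagBlock {T : Matrix ι ι A} (hT : IsDegZero 𝒜 deg T) (γ : Grp n) :
    Matrix {i // deg i = γ} {i // deg i = γ} (𝒜 0) :=
  Matrix.of fun i j => ⟨T i j, by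
    have h := hT i j
    rwa [i.2, j.2, grp_add_self] at h⟩

end Berezinian

section Module

variable {K A : Type*} {n : ℕ} [Field K] [Ring A] [Algebra K A]
  (𝒜 : Grp n → Submodule K A) [GradedAlgebra 𝒜] [IsGradedComm 𝒜]
  {M : Type*} [AddCommGroup M] [Module K M] [Module A M] [IsScalarTower K A M]
  (ℳ : Grp n → Submodule K M) [DirectSum.Decomposition ℳ] [SetLike.GradedSMul 𝒜 ℳ]
  {p q : ℕ} {deg : Fin p ⊕ Fin q → Grp n}

/-! ### The graded Berezinian module -/

variable {ℳ} in
/-- The transition matrix `T` from `e` to `e'`, given by `e'_i = ∑_j e_j T_(j i)`. -/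
noncomputable def transition (e e' : HomBasis A ℳ deg) :
    Matrix (Fin p ⊕ Fin q) (Fin p ⊕ Fin q) A :=
  Matrix.of fun j i => (dualBasis 𝒜 e j : M →ₗ[K] A) (e'.1 i)

variable (deg) in
/-- The relations `B(e') = B(e) gber(T)`, where `T` is the transition matrix from `e` to `e'`
(since `gber(T)` has degree zero, it may be written on the left). -/
noncomputable def gberRel : Submodule A (HomBasis A ℳ deg →₀ A) :=
  Submodule.span A {x | ∃ e e' : HomBasis A ℳ deg,
    x = Finsupp.single e' 1 - Finsupp.single e (gber deg (transition 𝒜 e e'))}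

variable (deg) in
/-- The graded Berezinian module: the `A`-module on the symbols `B(e)`, for the homogeneous bases
`e` of `M`, with the relations `B(e') = B(e) gber(T)`. -/
abbrev GBer : Type _ := (HomBasis A ℳ deg →₀ A) ⧸ gberRel 𝒜 ℳ deg

variable {ℳ} in
/-- The symbol `B(e)`. -/
noncomputable def bsym (e : HomBasis A ℳ deg) : GBer 𝒜 ℳ deg :=
  Submodule.Quotient.mk (Finsupp.single e 1)

variable (deg) in
/-- The grading of the graded Berezinian module: `B(e)` has degree `∑ |e_i|`. -/
noncomputable def gberGrading (γ : Grp n) : Submodule K (GBer 𝒜 ℳ deg) :=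
  Submodule.span K {x | ∃ (e : HomBasis A ℳ deg) (α : Grp n) (a : A),
    a ∈ 𝒜 α ∧ α + ∑ i, deg i = γ ∧ x = a • bsym 𝒜 e}

/-! ### The Koszul complex and its cohomology -/

variable (π : Grp n)

/-- The grading of `Π M ⊕ M^*`. -/
def koszulModGrading (γ : Grp n) : Submodule K (Shift 𝒜 π M × Dual 𝒜 ℳ) :=
  (shiftGrading 𝒜 π ℳ γ).prod (dualGrading 𝒜 ℳ γ)

/-- The graded symmetric algebra `S_A(Π M ⊕ M^*)`. -/
abbrev Koszul : Type _ :=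
  GSym (N := Shift 𝒜 π M × Dual 𝒜 ℳ) 𝒜 (koszulModGrading 𝒜 ℳ π)

/-- An element `Π m` in `S_A(Π M ⊕ M^*)`. -/
def kShift (m : M) : Koszul 𝒜 ℳ π := GSym.ofMod 𝒜 _ (toShift 𝒜 π M m, 0)

variable {ℳ}

/-- An element of `M^*` in `S_A(Π M ⊕ M^*)`. -/
def kDual (ℓ : Dual 𝒜 ℳ) : Koszul 𝒜 ℳ π := GSym.ofMod 𝒜 _ (0, ℓ)

/-- The element `d = ∑ Π e_i ε^i`; the differential is the left multiplication by it. -/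
noncomputable def kd (e : HomBasis A ℳ deg) : Koszul 𝒜 ℳ π :=
  ∑ i, kShift 𝒜 ℳ π (e.1 i) * kDual 𝒜 π (dualBasis 𝒜 e i)

/-- The even variables: `ε^i` if `e_i` is even, `Π e_i` if `e_i` is odd. -/
noncomputable def xvar (e : HomBasis A ℳ deg) : Fin p ⊕ Fin q → Koszul 𝒜 ℳ π
  | Sum.inl i => kDual 𝒜 π (dualBasis 𝒜 e (Sum.inl i))
  | Sum.inr j => kShift 𝒜 ℳ π (e.1 (Sum.inr j))

/-- The odd variables: `Π e_i` if `e_i` is even, `-(-1)^⟨|e_i|, π⟩ ε^i` if `e_i` is odd. -/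
noncomputable def xivar (e : HomBasis A ℳ deg) : Fin p ⊕ Fin q → Koszul 𝒜 ℳ π
  | Sum.inl i => kShift 𝒜 ℳ π (e.1 (Sum.inl i))
  | Sum.inr j => -(ksign (deg (Sum.inr j)) π • kDual 𝒜 π (dualBasis 𝒜 e (Sum.inr j)))

/-- The product `ξ_1 ⋯ ξ_r`, with first the variables for the even `e_i`. -/
noncomputable def xiTop (e : HomBasis A ℳ deg) : Koszul 𝒜 ℳ π :=
  (List.ofFn fun i => xivar 𝒜 π e (Sum.inl i)).prod *
    (List.ofFn fun j => xivar 𝒜 π e (Sum.inr j)).prod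

/-- The `k`-th level `K^k` of the complex: the polynomials of degree `k` in the `ξ_i`. -/
noncomputable def level (e : HomBasis A ℳ deg) (k : ℕ) : Submodule A (Koszul 𝒜 ℳ π) :=
  Submodule.span A {s | ∃ l : List ((Fin p ⊕ Fin q) ⊕ (Fin p ⊕ Fin q)),
    l.countP Sum.isRight = k ∧ s = (l.map (Sum.elim (xvar 𝒜 π e) (xivar 𝒜 π e))).prod}

theorem kd_mul_ofAlg (e : HomBasis A ℳ deg) (a : A) :
    kd 𝒜 π e * GSym.ofAlg 𝒜 _ a = GSym.ofAlg 𝒜 _ (signAut 𝒜 π a) * kd 𝒜 π e := by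
  rw [kd, Finset.sum_mul, Finset.mul_sum]
  refine Finset.sum_congr rfl fun i _ => ?_
  have h1 : ((0, dualBasis 𝒜 e i) : Shift 𝒜 π M × Dual 𝒜 ℳ) ∈
      koszulModGrading 𝒜 ℳ π (deg i) := ⟨zero_mem _, dualBasis_mem 𝒜 e i⟩
  have h2 : ((toShift 𝒜 π M (e.1 i), 0) : Shift 𝒜 π M × Dual 𝒜 ℳ) ∈
      koszulModGrading 𝒜 ℳ π (deg i + π) := by
    refine ⟨⟨e.1 i, ?_, rfl⟩, zero_mem _⟩
    rw [add_assoc, grp_add_self, add_zero]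
    exact e.2 i
  rw [mul_assoc, kDual, GSym.ofMod_mul_ofAlg 𝒜 _ h1, ← mul_assoc, kShift,
    GSym.ofMod_mul_ofAlg 𝒜 _ h2, mul_assoc, add_comm (deg i) π, signAut_add, signAut_signAut]

/-- The cocycles, i.e. the kernel of `d`. -/
def cocycles (e : HomBasis A ℳ deg) : Submodule A (Koszul 𝒜 ℳ π) where
  carrier := {s | kd 𝒜 π e * s = 0}
  zero_mem' := mul_zero _
  add_mem' := by
    intro s t (hs : _ = _) (ht : _ = _)
    change kd 𝒜 π e * (s + t) = 0
    rw [mul_add, hs, ht, add_zero]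
  smul_mem' := by
    intro a s (hs : _ = _)
    change kd 𝒜 π e * (a • s) = 0
    rw [GSym.smul_eq, ← mul_assoc, kd_mul_ofAlg, mul_assoc, hs, mul_zero]

/-- The coboundaries, i.e. the image of `d`. -/
def coboundaries (e : HomBasis A ℳ deg) : Submodule A (Koszul 𝒜 ℳ π) where
  carrier := {s | ∃ t, s = kd 𝒜 π e * t}
  zero_mem' := ⟨0, (mul_zero _).symm⟩
  add_mem' := by
    rintro _ _ ⟨s, rfl⟩ ⟨t, rfl⟩
    exact ⟨s + t, (mul_add _ _ _).symm⟩
  smul_mem' := by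
    rintro a _ ⟨s, rfl⟩
    refine ⟨signAut 𝒜 π a • s, ?_⟩
    rw [GSym.smul_eq, GSym.smul_eq, ← mul_assoc, ← mul_assoc, kd_mul_ofAlg, signAut_signAut]

/-- The cohomology `H = ker d / im d` of the complex. -/
abbrev Cohomology (e : HomBasis A ℳ deg) : Type _ :=
  cocycles 𝒜 π e ⧸ (coboundaries 𝒜 π e).submoduleOf (cocycles 𝒜 π e)

/-- The grading of the cohomology: the classes of the homogeneous cocycles. -/
noncomputable def cohomologyGrading (e : HomBasis A ℳ deg) (γ : Grp n) :
    Submodule K (Cohomology 𝒜 π e) :=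
  ((GSym.grading (N := Shift 𝒜 π M × Dual 𝒜 ℳ) 𝒜 (koszulModGrading 𝒜 ℳ π) γ).comap
    ((cocycles 𝒜 π e).subtype.restrictScalars K)).map
    (((coboundaries 𝒜 π e).submoduleOf (cocycles 𝒜 π e)).mkQ.restrictScalars K)

end Module

end GradedBerezinian

set_option linter.unusedSectionVars false

/-! The cohomology of the Koszul complex is computed by a homotopy. The properties of the graded
Berezinian, its multiplicativity included, are then read off from the way the generator of the
cohomology depends on the basis.

Cohomology. For each `i` exactly one of `Π e_i`, `ε^i` is odd, the variable `ξ_i`, and the other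
one, `x_i`, is even; up to signs `d` is multiplication by `∑ x_i ξ_i`. Let `h` be, up to signs, the
sum of the operators `∂/∂x_i ∂/∂ξ_i`. Summands of `d` and `h` with different indices anticommute,
and `d h + h d` multiplies a monomial by the sum over `i` of the exponent of `x_i`, plus one if
`ξ_i` is absent. This integer vanishes only for `ξ_1 ⋯ ξ_r`, so in characteristic zero the
cohomology is free of rank one on the class of that monomial (`homotopy`,
`exists_sub_smul_xiTop_mem`, `eq_zero_of_smul_xiTop_mem`). Coordinates come from an action of
`S_A(N)` on the free module on multisets of basis elements (`act`, `ofModel_toModel`).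

Change of basis. If all `x_i` act by zero, so does `d`, and the coefficient relating the products
`ξ_1 ⋯ ξ_r` of two bases can be computed from the odd variables alone. For the transition matrix `T`
it is `topCoeff T = gdet (T₀₀) * gdet ((T⁻¹)₁₁)`, where the indices `0`, `1` stand for the even and
odd blocks (`oddAct_xiTop`, `xiTop_sub_mem`). Since the class is a free generator, `topCoeff` is
multiplicative without any matrix computation (`topCoeff_mul`). Factoring `T` into an upper
unitriangular, a block-diagonal and a lower unitriangular matrix, with the Schur complement in the
middle, gives `gber = topCoeff` (`gber_eq_topCoeff`). Thus the symbols `B(e)` and the classes of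
`ξ_1 ⋯ ξ_r` obey the same transformation law, which is the isomorphism `χ`.

Determinants. The signs are removed by a twist. There is a bilinear form whose symmetrization is
`⟨α, β⟩ + ⟨α, α⟩⟨β, β⟩`; multiplying homogeneous operators by suitable degree operators turns the
sign rule of `(ℤ/2)^n` into that of superalgebra. Twisted even elements then form a commutative
ring, twisted odd variables anticommute, and `gdet` becomes an ordinary determinant
(`coe_det_hatMat`). Multiplicativity, block formulas, and the behaviour of products of odd variables
under linear substitution all follow from this (`gdet_mul`, `prod_sum_left`, `prod_sum_right`). -/

namespace GradedBerezinian

/-! ### A bilinear form that turns the sign rule into the rule of signs of superalgebra -/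

section Signs

variable {n : ℕ}

/-- The linear map of `(ℤ/2)^n` such that `⟨upSum α, β⟩ + ⟨upSum β, α⟩ = ⟨α, β⟩ + ⟨α, α⟩⟨β, β⟩`. -/
def upSum (α : Grp n) : Grp n := fun i => ∑ j, if i < j then α j else 0

theorem upSum_add (α β : Grp n) : upSum (α + β) = upSum α + upSum β := by
  funext i
  simp only [upSum, Pi.add_apply, ← Finset.sum_add_distrib]
  refine Finset.sum_congr rfl fun j _ => ?_
  split_ifs <;> simp

theorem upSum_zero : upSum (0 : Grp n) = 0 := by
  funext i
  simp [upSum]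

/-- As `x * x = x` in `ℤ/2`, the parity of an element is the sum of its coordinates, and a product
of parities is the sum of `α i * β j` over all pairs. The diagonal is the scalar product and cancels
in characteristic two; the two triangles are the terms on the left. -/
theorem upSum_dotProduct_add (α β : Grp n) :
    upSum α ⬝ᵥ β + upSum β ⬝ᵥ α = α ⬝ᵥ β + (α ⬝ᵥ α) * (β ⬝ᵥ β) := by
  have hsq : ∀ x : ZMod 2, x * x = x := by decide
  have h1 : ∀ α : Grp n, α ⬝ᵥ α = ∑ i, α i := fun α => by simp [dotProduct, hsq]
  rw [h1 α, h1 β, Finset.sum_mul_sum]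
  have h2 : upSum β ⬝ᵥ α = ∑ i, ∑ j, if i < j then α i * β j else 0 := by
    simp only [dotProduct, upSum, Finset.sum_mul]
    refine Finset.sum_congr rfl fun i _ => Finset.sum_congr rfl fun j _ => ?_
    split_ifs <;> ring
  have h3 : upSum α ⬝ᵥ β = ∑ i, ∑ j, if j < i then α i * β j else 0 := by
    simp only [dotProduct, upSum, Finset.sum_mul]
    rw [Finset.sum_comm]
    refine Finset.sum_congr rfl fun i _ => Finset.sum_congr rfl fun j _ => ?_
    split_ifs <;> ring
  have h4 : α ⬝ᵥ β = ∑ i, ∑ j, if i = j then α i * β j else 0 := by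
    simp [dotProduct]
  rw [h2, h3, h4]
  simp only [← Finset.sum_add_distrib]
  refine Finset.sum_congr rfl fun i _ => Finset.sum_congr rfl fun j _ => ?_
  rcases lt_trichotomy i j with h | h | h
  · simp [h, h.ne, h.not_gt]
  · subst h
    simp [CharTwo.add_self_eq_zero]
  · simp [h, h.ne', h.not_gt]

theorem ksign_zero_left (α : Grp n) : ksign 0 α = 1 := by
  rw [ksign_comm, ksign_zero_right]

theorem ksign_self (α : Grp n) : ksign α α = (-1) ^ (α ⬝ᵥ α) := rfl

theorem ksign_self_of_even {α : Grp n} (h : α ⬝ᵥ α = 0) : ksign α α = 1 := by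
  rw [ksign_self, h, uzpow_zero]

theorem ksign_self_of_odd {α : Grp n} (h : α ⬝ᵥ α = 1) : ksign α α = -1 := by
  rw [ksign_self, h, uzpow_one]

theorem dotProduct_add_self (α β : Grp n) : (α + β) ⬝ᵥ (α + β) = α ⬝ᵥ α + β ⬝ᵥ β := by
  rw [add_dotProduct, dotProduct_add, dotProduct_add, dotProduct_comm β α]
  linear_combination (CharTwo.add_self_eq_zero (α ⬝ᵥ β))

theorem even_add_of_eq {α β : Grp n} (h : α ⬝ᵥ α = β ⬝ᵥ β) : (α + β) ⬝ᵥ (α + β) = 0 := by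
  rw [dotProduct_add_self, h, CharTwo.add_self_eq_zero]

/-- The bimultiplicative sign `(-1)^⟨upSum α, β⟩`. -/
def tw (α β : Grp n) : ℤˣ := ksign (upSum α) β

theorem tw_add_left (α β γ : Grp n) : tw (α + β) γ = tw α γ * tw β γ := by
  rw [tw, upSum_add, ksign_add_left]; rfl

theorem tw_add_right (α β γ : Grp n) : tw α (β + γ) = tw α β * tw α γ :=
  ksign_add_right _ _ _

theorem tw_mul_self (α β : Grp n) : tw α β * tw α β = 1 := Int.units_mul_self _

theorem tw_zero_right (α : Grp n) : tw α 0 = 1 := ksign_zero_right _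

theorem tw_sum_right {ι : Type*} (s : Finset ι) (α : Grp n) (f : ι → Grp n) :
    tw α (∑ i ∈ s, f i) = ∏ i ∈ s, tw α (f i) := by
  classical
  induction s using Finset.induction_on with
  | empty => simp [tw_zero_right]
  | insert i s hi ih => rw [Finset.sum_insert hi, Finset.prod_insert hi, tw_add_right, ih]

/-- A product twisted by `tw` can therefore be reordered at the cost of a sign that depends only on
the two parities. -/
theorem tw_mul_swap (α β : Grp n) :
    tw α β * tw β α = ksign α β * (-1) ^ ((α ⬝ᵥ α) * (β ⬝ᵥ β)) := by
  rw [tw, tw, ksign, ksign, ksign, ← uzpow_add, ← uzpow_add, upSum_dotProduct_add]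

theorem tw_mul_swap_of_eq {α β : Grp n} (h : α ⬝ᵥ α = β ⬝ᵥ β) :
    tw α β * tw β α = ksign α (α + β) := by
  have hsq : ∀ x : ZMod 2, x * x = x := by decide
  rw [tw_mul_swap, ← h, hsq, ksign_add_right, ksign_self, mul_comm]

end Signs

/-! ### Products over pairs of indices, and the sign in the graded determinant -/

section PairProducts

variable {C : Type*} [CommMonoid C]

theorem prod_filter_pairs {m : ℕ} (P : Fin m → Fin m → Prop) [∀ i k, Decidable (P i k)]
    (f : Fin m → Fin m → C) :
    (∏ x : Fin m × Fin m with P x.1 x.2, f x.1 x.2) = ∏ i, ∏ k, if P i k then f i k else 1 := by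
  rw [Finset.prod_filter, Fintype.prod_prod_type]

theorem prod_prod_eq_prod_lt {m : ℕ} (f : Fin m → Fin m → C) :
    ∏ i, ∏ k, f i k = (∏ i, f i i) * ∏ i, ∏ k, if i < k then f i k * f k i else 1 := by
  have h1 : ∀ i k, f i k = (if i < k then f i k else 1) * (if i = k then f i k else 1) *
      (if k < i then f i k else 1) := by
    intro i k
    rcases lt_trichotomy i k with h | h | h
    · simp [h, h.ne, h.not_gt]
    · subst h
      simp
    · simp [h, h.ne', h.not_gt]
  have h2 : ∏ i, ∏ k, (if k < i then f i k else 1) = ∏ i, ∏ k, if i < k then f k i else 1 :=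
    Finset.prod_comm
  have h3 : ∀ i k, (if i < k then f i k * f k i else 1) =
      (if i < k then f i k else 1) * (if i < k then f k i else 1) := by
    intro i k
    split_ifs <;> simp
  rw [Finset.prod_congr rfl fun i _ => Finset.prod_congr rfl fun k _ => h1 i k]
  simp only [h3, Finset.prod_mul_distrib, h2]
  have h4 : ∏ i, ∏ k, (if i = k then f i k else 1) = ∏ i, f i i := by simp
  rw [h4, mul_comm (∏ i, ∏ k, if i < k then f i k else 1), mul_assoc]

/-- A product over pairs, reindexed by a permutation. -/
theorem prod_lt_comp_perm {m : ℕ} (s : Equiv.Perm (Fin m)) (f : Fin m → Fin m → C) :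
    (∏ i, ∏ k, if i < k then f i k else 1) =
      ∏ i, ∏ k, if i < k then (if s i < s k then f (s i) (s k) else f (s k) (s i)) else 1 := by
  have h1 : (∏ i, ∏ k, if i < k then f i k else 1) =
      ∏ i, ∏ k, if s i < s k then f (s i) (s k) else 1 := by
    rw [← Equiv.prod_comp s]
    refine Finset.prod_congr rfl fun i _ => ?_
    rw [← Equiv.prod_comp s]
  rw [h1, prod_prod_eq_prod_lt]
  simp only [lt_irrefl, if_false, Finset.prod_const_one, one_mul]
  refine Finset.prod_congr rfl fun i _ => Finset.prod_congr rfl fun k _ => ?_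
  by_cases h : i < k
  · rw [if_pos h, if_pos h]
    rcases lt_trichotomy (s i) (s k) with h' | h' | h'
    · simp [h', h'.not_gt]
    · exact absurd (s.injective h') h.ne
    · simp [h', h'.not_gt]
  · rw [if_neg h, if_neg h]

end PairProducts

/-- The right-hand side is the sign that arises when a product of twisted matrix entries is
collected into one twisted product. The identity is what makes `gdet` an ordinary determinant in
disguise. -/
theorem gdet_sign_eq {n m : ℕ} (g : Fin m → Grp n) (κ : Grp n)
    (hg : ∀ i j, g i ⬝ᵥ g i = g j ⬝ᵥ g j) (s : Equiv.Perm (Fin m)) :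
    (∏ x : Fin m × Fin m with x.1 < x.2, ksign (g (s x.1) + g x.1) (g (s x.2))) *
      (∏ x : Fin m × Fin m with x.1 < x.2 ∧ s x.2 < s x.1,
        ksign (g (s x.1)) (g (s x.1) + g (s x.2))) =
    (∏ i, tw (g (s i) + κ) (g (s i) + g i)) *
      ∏ i, ∏ k, if i < k then tw (g (s i) + g i) (g (s k) + g k) else 1 := by
  rw [prod_filter_pairs (fun i k => i < k) fun i k => ksign (g (s i) + g i) (g (s k)),
    prod_filter_pairs (fun i k => i < k ∧ s k < s i)
      fun i k => ksign (g (s i)) (g (s i) + g (s k))]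
  have hsum : ∑ i, (g (s i) + g i) = 0 := by
    rw [Finset.sum_add_distrib, Equiv.sum_comp s g, grp_add_self]
  -- After reindexing the first product by `s`, a pair that is not inverted contributes the square
  -- of a sign, and an inverted pair contributes `tw` in both orders, which is its factor on the
  -- left.
  have hinv : (∏ i, ∏ k, if i < k ∧ s k < s i then ksign (g (s i)) (g (s i) + g (s k)) else 1) =
      (∏ i, ∏ k, if i < k then tw (g i) (g k) else 1) *
        ∏ i, ∏ k, if i < k then tw (g (s i)) (g (s k)) else 1 := by
    rw [prod_lt_comp_perm s]
    simp only [← Finset.prod_mul_distrib]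
    refine Finset.prod_congr rfl fun i _ => Finset.prod_congr rfl fun k _ => ?_
    by_cases h : i < k
    · rcases lt_trichotomy (s i) (s k) with h' | h' | h'
      · simp [h, h', h'.not_gt]
      · exact absurd (s.injective h') h.ne
      · simp only [h, h', h'.not_gt, true_and, if_true, if_false]
        rw [mul_comm, tw_mul_swap_of_eq (hg _ _)]
    · simp [h]
  -- The degrees of the entries add up to zero, so the shift `κ` is invisible.
  have hκ : ∏ i, tw (g (s i) + κ) (g (s i) + g i) = ∏ i, tw (g (s i)) (g (s i) + g i) := by
    simp only [tw_add_left _ κ, Finset.prod_mul_distrib, ← tw_sum_right, hsum, tw_zero_right,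
      mul_one]
  -- For fixed `i` the second arguments sum to zero, so the product over all ordered pairs is
  -- trivial. This trades the diagonal factors for factors over `i < k`, and the claim can be
  -- checked one pair at a time.
  have hall : (∏ i, tw (g (s i)) (g (s i) + g i)) * (∏ i, ∏ k, if i < k then
      tw (g (s i)) (g (s k) + g k) * tw (g (s k)) (g (s i) + g i) else 1) = 1 := by
    rw [← prod_prod_eq_prod_lt fun i k => tw (g (s i)) (g (s k) + g k)]
    simp only [← tw_sum_right, hsum, tw_zero_right, Finset.prod_const_one]
  rw [hκ, hinv]
  have hcancel : ∀ a b c d : ℤˣ, a * c = 1 → b * c = d → d = a * b := by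
    intro a b c d h h'
    rw [← h', mul_eq_one_iff_eq_inv.mp h, Int.units_inv_eq_self, mul_comm]
  apply hcancel _ _ _ _ hall
  simp only [← Finset.prod_mul_distrib]
  refine Finset.prod_congr rfl fun i _ => Finset.prod_congr rfl fun k _ => ?_
  by_cases h : i < k
  · simp only [h, if_true]
    have h1 := tw_mul_swap_of_eq (hg (s i) (s k))
    have h2 := tw_mul_swap_of_eq (hg (s k) i)
    have h3 : ksign (g (s i) + g i) (g (s k)) =
        ksign (g (s i)) (g (s i) + g (s k)) * ksign (g (s k)) (g (s k) + g i) := by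
      simp only [ksign_add_left, ksign_add_right]
      rw [ksign_self, ksign_self, hg (s k) (s i), ksign_comm (g i), mul_mul_mul_comm,
        mul_comm (ksign (g (s i)) (g (s k))), ← mul_assoc, Int.units_mul_self,
        one_mul]
    rw [h3, ← h1, ← h2]
    simp only [tw_add_left, tw_add_right]
    -- What remains is an identity between monomials in six signs.
    generalize tw (g (s i)) (g (s k)) = a
    generalize tw (g (s k)) (g (s i)) = b
    generalize tw (g (s i)) (g k) = c
    generalize tw (g i) (g (s k)) = d
    generalize tw (g i) (g k) = e
    generalize tw (g (s k)) (g i) = f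
    rcases Int.units_eq_one_or a with rfl | rfl <;> rcases Int.units_eq_one_or b with rfl | rfl <;>
    rcases Int.units_eq_one_or c with rfl | rfl <;> rcases Int.units_eq_one_or d with rfl | rfl <;>
    rcases Int.units_eq_one_or e with rfl | rfl <;> rcases Int.units_eq_one_or f with rfl | rfl <;>
    rfl
  · simp [h]

/-! ### Rings with degree operators -/

section DegreeOps

variable {K A : Type*} {n : ℕ} [Field K] [Ring A] [Algebra K A]

/-- A ring under `A` with operators that act on elements of degree `β` by commuting with them up
to the sign `(-1)^⟨α, β⟩`. -/
structure DegreeOps (𝒜 : Grp n → Submodule K A) (E : Type*) [Ring E] where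
  /-- The structure map. -/
  L : A →+* E
  /-- The degree operators. -/
  op : Grp n → E
  op_zero : op 0 = 1
  op_add : ∀ α β, op (α + β) = op α * op β
  op_mul : ∀ (α : Grp n) {β : Grp n} {a : A}, a ∈ 𝒜 β → op α * L a = ksign α β • (L a * op α)

namespace DegreeOps

variable {𝒜 : Grp n → Submodule K A} {E : Type*} [Ring E] (D : DegreeOps 𝒜 E)

/-- An element of `E` of degree `β`. -/
def HasDegree (β : Grp n) (P : E) : Prop := ∀ γ, D.op γ * P = ksign γ β • (P * D.op γ)

theorem hasDegree_L {β : Grp n} {a : A} (ha : a ∈ 𝒜 β) : D.HasDegree β (D.L a) :=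
  fun γ => D.op_mul γ ha

variable {D} in
theorem HasDegree.mul {β γ : Grp n} {P Q : E} (hP : D.HasDegree β P) (hQ : D.HasDegree γ Q) :
    D.HasDegree (β + γ) (P * Q) := by
  intro δ
  rw [← mul_assoc, hP, smul_mul_assoc, mul_assoc, hQ, mul_smul_comm, smul_smul, ksign_add_right,
    mul_assoc]

theorem hasDegree_sum {ι : Type*} (s : Finset ι) {β : Grp n} {P : ι → E}
    (hP : ∀ i ∈ s, D.HasDegree β (P i)) : D.HasDegree β (∑ i ∈ s, P i) := by
  intro δ
  rw [Finset.mul_sum, Finset.sum_mul, Finset.smul_sum]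
  exact Finset.sum_congr rfl fun i hi => hP i hi δ

theorem hasDegree_one : D.HasDegree 0 1 := by
  intro δ
  rw [ksign_zero_right, one_smul, one_mul, mul_one]

theorem hasDegree_prod {m : ℕ} {α : Fin m → Grp n} {P : Fin m → E}
    (hP : ∀ i, D.HasDegree (α i) (P i)) : D.HasDegree (∑ i, α i) (List.ofFn P).prod := by
  induction m with
  | zero => simpa using D.hasDegree_one
  | succ m ih =>
    rw [List.ofFn_succ, List.prod_cons, Fin.sum_univ_succ]
    exact (hP 0).mul (ih fun i => hP i.succ)

/-- The element of degree `β` obtained from `P` by twisting with a degree operator. -/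
def hat (β : Grp n) (P : E) : E := P * D.op (upSum β)

theorem hat_zero_left (P : E) : D.hat 0 P = P := by
  rw [hat, upSum_zero, D.op_zero, mul_one]

theorem hat_smul (β : Grp n) (u : ℤˣ) (P : E) : D.hat β (u • P) = u • D.hat β P :=
  smul_mul_assoc _ _ _

theorem hat_sum {ι : Type*} (s : Finset ι) (β : Grp n) (P : ι → E) :
    D.hat β (∑ i ∈ s, P i) = ∑ i ∈ s, D.hat β (P i) :=
  Finset.sum_mul _ _ _

theorem hat_injective (β : Grp n) : Function.Injective (D.hat β) := by
  intro P Q h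
  have h1 : ∀ P : E, D.hat β P * D.op (upSum β) = P := fun P => by
    rw [hat, mul_assoc, ← D.op_add, grp_add_self, D.op_zero, mul_one]
  rw [← h1 P, h, h1]

/-- Moving the degree operator of `P` past `Q` produces `ksign (upSum β) γ`, which is `tw β γ`. -/
theorem hat_mul_hat {β γ : Grp n} {P Q : E} (hQ : D.HasDegree γ Q) :
    D.hat β P * D.hat γ Q = tw β γ • D.hat (β + γ) (P * Q) := by
  rw [hat, hat, mul_assoc, ← mul_assoc (D.op _), hQ, smul_mul_assoc, mul_smul_comm, hat,
    upSum_add, D.op_add, mul_assoc, mul_assoc]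
  rfl

theorem prod_hat {m : ℕ} {α : Fin m → Grp n} {P : Fin m → E}
    (hP : ∀ i, D.HasDegree (α i) (P i)) :
    (List.ofFn fun i => D.hat (α i) (P i)).prod =
      (∏ i, ∏ k, if i < k then tw (α i) (α k) else 1) •
        D.hat (∑ i, α i) (List.ofFn P).prod := by
  induction m with
  | zero => simp [hat_zero_left]
  | succ m ih =>
    rw [List.ofFn_succ, List.prod_cons, ih fun i => hP i.succ, mul_smul_comm,
      D.hat_mul_hat (D.hasDegree_prod fun i => hP i.succ), smul_smul, tw_sum_right,
      Fin.sum_univ_succ, List.ofFn_succ, List.prod_cons]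
    congr 1
    simp [Fin.prod_univ_succ, mul_comm]

/-- The twists of the two orders differ by `tw_mul_swap`, whose factor `ksign β γ` cancels the one
in the hypothesis; only the sign rule of superalgebra is left. -/
theorem hat_comm {β γ : Grp n} {P Q : E} (hP : D.HasDegree β P) (hQ : D.HasDegree γ Q)
    (h : P * Q = ksign β γ • (Q * P)) :
    D.hat β P * D.hat γ Q = (-1 : ℤˣ) ^ ((β ⬝ᵥ β) * (γ ⬝ᵥ γ)) • (D.hat γ Q * D.hat β P) := by
  rw [D.hat_mul_hat hQ, D.hat_mul_hat hP, h, hat_smul, smul_smul, smul_smul, add_comm γ β]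
  congr 1
  have h1 := tw_mul_swap β γ
  generalize (-1 : ℤˣ) ^ ((β ⬝ᵥ β) * (γ ⬝ᵥ γ)) = e at *
  generalize ksign β γ = d at *
  rw [eq_mul_inv_of_mul_eq h1, Int.units_inv_eq_self, mul_right_comm, mul_right_comm d,
    Int.units_mul_self, one_mul]

variable (𝒜) in
/-- The set of twisted even elements of `A`. -/
def evenSet : Set E := {x | ∃ (α : Grp n) (a : A), α ⬝ᵥ α = 0 ∧ a ∈ 𝒜 α ∧ x = D.hat α (D.L a)}

/-- The ring of twisted even elements. -/
def evenRing : Subring E := Subring.closure (D.evenSet 𝒜)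

theorem evenSet_comm [IsGradedComm 𝒜] : ∀ x ∈ D.evenSet 𝒜, ∀ y ∈ D.evenSet 𝒜, x * y = y * x := by
  rintro _ ⟨α, a, hα, ha, rfl⟩ _ ⟨β, b, hβ, hb, rfl⟩
  rw [D.hat_comm (D.hasDegree_L ha) (D.hasDegree_L hb), hα, zero_mul, uzpow_zero, one_smul]
  rw [← map_mul, IsGradedComm.comm ha hb, Units.smul_def, map_zsmul, map_mul, ← Units.smul_def]

open scoped IsMulCommutative

instance [IsGradedComm 𝒜] : IsMulCommutative D.evenRing :=
  Subring.isMulCommutative_closure D.evenSet_comm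

theorem hat_L_mem {α : Grp n} (hα : α ⬝ᵥ α = 0) {a : A} (ha : a ∈ 𝒜 α) :
    D.hat α (D.L a) ∈ D.evenRing :=
  Subring.subset_closure ⟨α, a, hα, ha, rfl⟩

theorem smul_mem_evenRing (u : ℤˣ) {x : E} (hx : x ∈ D.evenRing) : u • x ∈ D.evenRing := by
  rw [Units.smul_def]
  exact zsmul_mem hx _

/-- The sign in `hat_comm` is trivial once one factor is even, whatever the parity of `P`, and it
suffices to check the generators of `evenRing`. -/
theorem commute_of_hasDegree_odd [IsGradedComm 𝒜] {β : Grp n} {P : E} (hP : D.HasDegree β P)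
    (h : ∀ {α : Grp n} {a : A}, a ∈ 𝒜 α → P * D.L a = ksign β α • (D.L a * P))
    {x : E} (hx : x ∈ D.evenRing) : Commute x (D.hat β P) := by
  have hx' : x ∈ Subring.centralizer {D.hat β P} := by
    refine Subring.closure_le.mpr ?_ hx
    rintro _ ⟨α, a, hα, ha, rfl⟩
    rw [SetLike.mem_coe, Subring.mem_centralizer_iff]
    rintro _ rfl
    rw [D.hat_comm hP (D.hasDegree_L ha) (h ha), hα, mul_zero, uzpow_zero, one_smul]
  exact (Subring.mem_centralizer_iff.mp hx' _ rfl).symm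

/-- The matrix over the commutative ring of twisted even elements that corresponds to `X`. -/
def hatMat (κ : Grp n) {ι ι' : Type*} (g : ι → Grp n) (g' : ι' → Grp n)
    (hg : ∀ i j, g i ⬝ᵥ g i = g' j ⬝ᵥ g' j)
    (X : Matrix ι ι' A) (hX : ∀ i j, X i j ∈ 𝒜 (g i + g' j)) : Matrix ι ι' D.evenRing :=
  Matrix.of fun i j => ⟨tw (g i + κ) (g i + g' j) • D.hat (g i + g' j) (D.L (X i j)),
    D.smul_mem_evenRing _ (D.hat_L_mem (even_add_of_eq (hg i j)) (hX i j))⟩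

theorem coe_hatMat (κ : Grp n) {ι ι' : Type*} (g : ι → Grp n) (g' : ι' → Grp n)
    (hg : ∀ i j, g i ⬝ᵥ g i = g' j ⬝ᵥ g' j)
    (X : Matrix ι ι' A) (hX : ∀ i j, X i j ∈ 𝒜 (g i + g' j)) (i : ι) (j : ι') :
    (D.hatMat κ g g' hg X hX i j : E) =
      tw (g i + κ) (g i + g' j) • D.hat (g i + g' j) (D.L (X i j)) := rfl

theorem coe_prod_evenRing [IsGradedComm 𝒜] {m : ℕ} (f : Fin m → D.evenRing) :
    ((∏ i, f i : D.evenRing) : E) = (List.ofFn fun i => (f i : E)).prod := by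
  have h := map_list_prod D.evenRing.subtype (List.ofFn f)
  rw [List.prod_ofFn, List.map_ofFn] at h
  exact h

theorem coe_units_smul (u : ℤˣ) (x : D.evenRing) : ((u • x : D.evenRing) : E) = u • (x : E) := by
  rcases Int.units_eq_one_or u with rfl | rfl
  · simp
  · simp [Units.neg_smul]

theorem prod_units_smul {m : ℕ} (u : Fin m → ℤˣ) (f : Fin m → E) :
    (List.ofFn fun i => u i • f i).prod = (∏ i, u i) • (List.ofFn f).prod := by
  induction m with
  | zero => simp
  | succ m ih =>
    rw [List.ofFn_succ, List.prod_cons, ih, smul_mul_smul_comm, Fin.prod_univ_succ, List.ofFn_succ,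
      List.prod_cons]

/-- In the Leibniz formula for the twisted matrix, the twists of each product are collected by
`prod_hat`. The total degree is zero, so no degree operator survives, and the remaining sign is the
one of `gdet` by `gdet_sign_eq`. -/
theorem coe_det_hatMat [IsGradedComm 𝒜] (κ : Grp n) {m : ℕ} (g : Fin m → Grp n)
    (hg : ∀ i j, g i ⬝ᵥ g i = g j ⬝ᵥ g j)
    (X : Matrix (Fin m) (Fin m) A) (hX : ∀ i j, X i j ∈ 𝒜 (g i + g j)) :
    ((D.hatMat κ g g hg X hX).det : E) = D.L (gdet g X) := by
  rw [Matrix.det_apply, gdet, map_sum]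
  have h0 := map_sum D.evenRing.subtype (fun s : Equiv.Perm (Fin m) =>
    Equiv.Perm.sign s • ∏ i, D.hatMat κ g g hg X hX (s i) i) Finset.univ
  refine h0.trans (Finset.sum_congr rfl fun s _ => ?_)
  change ((Equiv.Perm.sign s • ∏ i, D.hatMat κ g g hg X hX (s i) i : D.evenRing) : E) = _
  rw [coe_units_smul, coe_prod_evenRing]
  simp only [coe_hatMat]
  rw [prod_units_smul, D.prod_hat fun i => D.hasDegree_L (hX (s i) i), smul_smul, smul_smul,
    mul_assoc (Equiv.Perm.sign s), mul_assoc (Equiv.Perm.sign s), gdet_sign_eq g κ hg s]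
  have hsum : ∑ i, (g (s i) + g i) = 0 := by
    rw [Finset.sum_add_distrib, Equiv.sum_comp s g, grp_add_self]
  rw [hsum, hat_zero_left, Units.smul_def, Units.smul_def, map_zsmul, map_list_prod, List.map_ofFn]
  rfl

/-- The prefactor in `hatMat` absorbs the sign of `hat_mul_hat`: by bimultiplicativity `tw (g i + κ)
(g i + g' j) * tw (g' j + κ) (g' j + g'' k) * tw (g i + g' j) (g' j + g'' k)` equals `tw (g i + κ)
(g i + g'' k)` and no longer depends on `j`. -/
theorem hatMat_mul [IsGradedComm 𝒜] (κ : Grp n) {ι ι' ι'' : Type*} [Fintype ι'] (g : ι → Grp n)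
    (g' : ι' → Grp n) (g'' : ι'' → Grp n) (hg : ∀ i j, g i ⬝ᵥ g i = g' j ⬝ᵥ g' j)
    (hg' : ∀ i j, g' i ⬝ᵥ g' i = g'' j ⬝ᵥ g'' j) (hg'' : ∀ i j, g i ⬝ᵥ g i = g'' j ⬝ᵥ g'' j)
    (X : Matrix ι ι' A) (Y : Matrix ι' ι'' A) (hX : ∀ i j, X i j ∈ 𝒜 (g i + g' j))
    (hY : ∀ i j, Y i j ∈ 𝒜 (g' i + g'' j)) (hXY : ∀ i j, (X * Y) i j ∈ 𝒜 (g i + g'' j)) :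
    D.hatMat κ g g'' hg'' (X * Y) hXY = D.hatMat κ g g' hg X hX * D.hatMat κ g' g'' hg' Y hY := by
  ext i k
  rw [Matrix.mul_apply]
  have h0 := map_sum D.evenRing.subtype (fun j =>
    D.hatMat κ g g' hg X hX i j * D.hatMat κ g' g'' hg' Y hY j k) Finset.univ
  refine Eq.trans ?_ h0.symm
  simp only [Subring.subtype_apply, Subring.coe_mul, coe_hatMat]
  rw [Matrix.mul_apply, map_sum, hat_sum, Finset.smul_sum]
  refine Finset.sum_congr rfl fun j _ => ?_
  rw [smul_mul_smul_comm, D.hat_mul_hat (D.hasDegree_L (hY j k)), smul_smul, map_mul]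
  have h1 : g i + g' j + (g' j + g'' k) = g i + g'' k := by
    rw [add_assoc, ← add_assoc (g' j), grp_add_self, zero_add]
  rw [h1]
  congr 1
  rw [mul_assoc, ← tw_add_left]
  have h2 : g' j + κ + (g i + g' j) = g i + κ := by
    rw [add_comm (g i), ← add_assoc, add_right_comm (g' j), grp_add_self, zero_add, add_comm]
  rw [h2, ← tw_add_right, h1]

end DegreeOps

end DegreeOps

/-! ### Products of linear combinations of anticommuting elements -/

section Alternating

variable {E : Type*} [Ring E]

theorem prod_ofFn_mul_of_commute {m : ℕ} (f g : Fin m → E) (h : ∀ i j, Commute (f i) (g j)) :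
    (List.ofFn fun i => f i * g i).prod = (List.ofFn f).prod * (List.ofFn g).prod := by
  induction m with
  | zero => simp
  | succ m ih =>
    simp only [List.ofFn_succ, List.prod_cons]
    rw [ih (fun i => f i.succ) (fun i => g i.succ) fun i j => h _ _]
    have h1 : Commute (g 0) (List.ofFn fun i : Fin m => f i.succ).prod := by
      refine Commute.list_prod_right _ _ ?_
      intro x hx
      obtain ⟨i, rfl⟩ := List.mem_ofFn.mp hx
      exact (h _ _).symm
    rw [mul_assoc, mul_assoc, ← mul_assoc (g 0), h1.eq, mul_assoc]

theorem prod_ofFn_sum {m : ℕ} (f : Fin m → Fin m → E) :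
    (List.ofFn fun i => ∑ j, f i j).prod =
      ∑ s : Fin m → Fin m, (List.ofFn fun i => f i (s i)).prod := by
  have h := MultilinearMap.map_sum (MultilinearMap.mkPiAlgebraFin ℤ m E) f
  simpa only [MultilinearMap.mkPiAlgebraFin_apply] using h

/-- The alternating map `v ↦ ∏_i ∑_j v_(i j) η_j` for anticommuting elements `η_j`. -/
theorem exists_alternating {m : ℕ} (η : Fin m → E) (hη : ∀ i j, η i * η j = -(η j * η i))
    (hsq : ∀ i, η i * η i = 0) :
    ∃ f : (Fin m → ℤ) [⋀^Fin m]→ₗ[ℤ] E,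
      ∀ s : Fin m → Fin m, f (fun i => Pi.single (s i) 1) = (List.ofFn fun i => η (s i)).prod := by
  let φ : (Fin m → ℤ) →ₗ[ℤ] E := Fintype.linearCombination ℤ η
  -- Off-diagonal terms cancel in pairs and diagonal ones vanish by `hsq`; the universal property of
  -- the exterior algebra over `ℤ` then provides the alternating map.
  have hφ : ∀ v, φ v * φ v = 0 := by
    intro v
    simp only [φ, Fintype.linearCombination_apply]
    rw [Finset.sum_mul_sum]
    have h1 : ∑ i, ∑ j, v i • η i * v j • η j = ∑ i, ∑ j, if i = j then (0 : E)
        else v i • η i * v j • η j := by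
      refine Finset.sum_congr rfl fun i _ => Finset.sum_congr rfl fun j _ => ?_
      split_ifs with h
      · subst h
        rw [smul_mul_smul_comm, hsq, smul_zero]
      · rfl
    rw [h1, ← Finset.sum_product']
    refine Finset.sum_involution (fun x _ => (x.2, x.1)) ?_ ?_ ?_ ?_
    · rintro ⟨i, j⟩ _
      by_cases h : i = j
      · simp [h]
      · simp only [h, Ne.symm h, if_false]
        rw [smul_mul_smul_comm, smul_mul_smul_comm, hη i j, mul_comm (v j), smul_neg,
          neg_add_cancel]
    · rintro ⟨i, j⟩ _ h h2
      simp only [Prod.mk.injEq] at h2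
      simp [h2.2] at h
    · simp
    · simp
  refine ⟨(ExteriorAlgebra.lift ℤ ⟨φ, hφ⟩).toLinearMap.compAlternatingMap
    (ExteriorAlgebra.ιMulti ℤ m), fun s => ?_⟩
  rw [LinearMap.compAlternatingMap_apply, ExteriorAlgebra.ιMulti_apply, AlgHom.toLinearMap_apply,
    map_list_prod, List.map_ofFn]
  congr 2
  funext i
  rw [Function.comp_apply, ExteriorAlgebra.lift_ι_apply]
  simp [φ, Fintype.linearCombination_apply, Pi.single_apply]

end Alternating

/-! ### Degrees of products and sign automorphisms -/

section Degrees

variable {K A : Type*} {n : ℕ} [Field K] [Ring A] [Algebra K A] {𝒜 : Grp n → Submodule K A}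

theorem add_add_add_cancel_grp (α β κ : Grp n) : α + κ + (α + β) = β + κ := by
  rw [add_comm α β, add_comm α κ, add_comm β α, add_assoc, ← add_assoc α, grp_add_self, zero_add,
    add_comm]

theorem units_smul_mem {u : ℤˣ} {α : Grp n} {a : A} (ha : a ∈ 𝒜 α) : u • a ∈ 𝒜 α := by
  rw [Units.smul_def]
  exact zsmul_mem ha _

theorem prod_ofFn_mem [GradedAlgebra 𝒜] {m : ℕ} {α : Fin m → Grp n} {a : Fin m → A}
    (ha : ∀ i, a i ∈ 𝒜 (α i)) : (List.ofFn a).prod ∈ 𝒜 (∑ i, α i) := by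
  induction m with
  | zero => simpa using SetLike.GradedOne.one_mem
  | succ m ih =>
    rw [List.ofFn_succ, List.prod_cons, Fin.sum_univ_succ]
    exact SetLike.GradedMul.mul_mem (ha 0) (ih fun i => ha i.succ)

theorem gdet_mem [GradedAlgebra 𝒜] {m : ℕ} {g : Fin m → Grp n} {X : Matrix (Fin m) (Fin m) A}
    (hX : ∀ i j, X i j ∈ 𝒜 (g i + g j)) : gdet g X ∈ 𝒜 0 := by
  refine sum_mem fun s _ => units_smul_mem ?_
  have h := prod_ofFn_mem fun i => hX (s i) i
  rwa [Finset.sum_add_distrib, Equiv.sum_comp s g, grp_add_self] at h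

end Degrees

section SignAut

variable {K A : Type*} {n : ℕ} [Field K] [Ring A] [Algebra K A]
  (𝒜 : Grp n → Submodule K A) [GradedAlgebra 𝒜]

/-- The automorphism `signAut` as a linear map. -/
def signLin (γ : Grp n) : A →ₗ[K] A where
  toFun := signAut 𝒜 γ
  map_add' := map_add _
  map_smul' k a := signAut_smul 𝒜 γ k a

theorem signAut_units_smul (γ : Grp n) (u : ℤˣ) (a : A) :
    signAut 𝒜 γ (u • a) = u • signAut 𝒜 γ a := by
  rw [Units.smul_def, map_zsmul, ← Units.smul_def]

theorem signAut_mem {γ α : Grp n} {a : A} (ha : a ∈ 𝒜 α) : signAut 𝒜 γ a ∈ 𝒜 α := by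
  rw [signAut_of_mem 𝒜 γ ha]
  exact units_smul_mem ha

theorem signAut_zero (a : A) : signAut 𝒜 0 a = a := by
  have h := signAut_signAut 𝒜 0 a
  rwa [← signAut_add, add_zero] at h

end SignAut

/-! ### The graded determinant as the effect of a linear substitution of odd variables -/

namespace DegreeOps

open scoped IsMulCommutative

variable {K A : Type*} {n : ℕ} [Field K] [Ring A] [Algebra K A]
  {𝒜 : Grp n → Submodule K A} {E : Type*} [Ring E] (D : DegreeOps 𝒜 E)

/-- The coefficients commute with the `η j` and with each other, so the product expands into a sum
over all maps `s` in which the `η`-part is alternating. Only permutations survive, and they give the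
Leibniz formula. -/
theorem prod_sum_mul_matrix [IsGradedComm 𝒜] {m : ℕ} (η : Fin m → E)
    (hη : ∀ i j, η i * η j = -(η j * η i)) (hsq : ∀ i, η i * η i = 0)
    (hc : ∀ x ∈ D.evenRing, ∀ i, Commute x (η i))
    (X : Matrix (Fin m) (Fin m) D.evenRing) :
    (List.ofFn fun i => ∑ j, η j * (X j i : E)).prod = (List.ofFn η).prod * (X.det : E) := by
  obtain ⟨f, hf⟩ := exists_alternating η hη hsq
  rw [prod_ofFn_sum]
  have h1 : ∀ s : Fin m → Fin m, (List.ofFn fun i => η (s i) * (X (s i) i : E)).prod =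
      f (fun i => Pi.single (s i) 1) * ((∏ i, X (s i) i : D.evenRing) : E) := by
    intro s
    rw [prod_ofFn_mul_of_commute _ _ fun i j => (hc _ (X _ _).2 _).symm, hf, D.coe_prod_evenRing]
  simp only [h1]
  have h2 : (X.det : E) = ∑ s : Equiv.Perm (Fin m),
      Equiv.Perm.sign s • ((∏ i, X (s i) i : D.evenRing) : E) := by
    rw [Matrix.det_apply]
    have h0 := map_sum D.evenRing.subtype (fun s : Equiv.Perm (Fin m) =>
      Equiv.Perm.sign s • ∏ i, X (s i) i) Finset.univ
    refine h0.trans (Finset.sum_congr rfl fun s _ => ?_)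
    exact D.coe_units_smul _ _
  have hid : (List.ofFn η).prod = f fun i => Pi.single i 1 := (hf id).symm
  rw [h2, Finset.mul_sum, hid]
  symm
  refine Finset.sum_of_injOn (fun s : Equiv.Perm (Fin m) => (s : Fin m → Fin m)) ?_ ?_ ?_ ?_
  · exact fun s _ t _ h => Equiv.coe_fn_injective h
  · exact fun _ _ => Finset.mem_coe.mpr (Finset.mem_univ _)
  · intro s _ hs
    have hs' : ¬ Function.Injective s := by
      intro hi
      exact hs ⟨Equiv.ofBijective s (Finite.injective_iff_bijective.mp hi), by simp, rfl⟩
    rw [f.map_eq_zero_of_not_injective, zero_mul]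
    intro hi
    exact hs' fun i j hij => hi (by simp only [hij])
  · intro s _
    have := f.map_perm (fun i => Pi.single i 1) s
    change f (fun i => Pi.single (s i) 1) = _ at this
    rw [this, smul_mul_assoc, mul_smul_comm]

/-- The data of graded commuting elements `ξ_i` of odd degrees `g_i + κ`. -/
structure OddFamily {m : ℕ} (g : Fin m → Grp n) (κ : Grp n) (ξ : Fin m → E) : Prop where
  parity : ∀ i j, g i ⬝ᵥ g i = g j ⬝ᵥ g j
  odd : ∀ i, (g i + κ) ⬝ᵥ (g i + κ) = 1
  hasDegree : ∀ i, D.HasDegree (g i + κ) (ξ i)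
  mul_L : ∀ i {α : Grp n} {a : A}, a ∈ 𝒜 α → ξ i * D.L a = ksign (g i + κ) α • (D.L a * ξ i)
  comm : ∀ i j, ξ i * ξ j = ksign (g i + κ) (g j + κ) • (ξ j * ξ i)
  sq : ∀ i, ξ i * ξ i = 0

namespace OddFamily

variable {D} {m : ℕ} {g : Fin m → Grp n} {κ : Grp n} {ξ : Fin m → E}

theorem prod_hat_sum [IsGradedComm 𝒜] (hξ : D.OddFamily g κ ξ) (w : Fin m → ℤˣ)
    (X : Matrix (Fin m) (Fin m) D.evenRing) :
    (List.ofFn fun i => ∑ j, w j • D.hat (g j + κ) (ξ j) * (X j i : E)).prod =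
      (List.ofFn fun i => w i • D.hat (g i + κ) (ξ i)).prod * (X.det : E) := by
  refine D.prod_sum_mul_matrix _ ?_ ?_ ?_ X
  · intro i j
    rw [smul_mul_smul_comm, smul_mul_smul_comm,
      D.hat_comm (hξ.hasDegree i) (hξ.hasDegree j) (hξ.comm i j), hξ.odd, hξ.odd, one_mul,
      uzpow_one, Units.neg_smul, one_smul, smul_neg, mul_comm]
  · intro i
    rw [smul_mul_smul_comm, D.hat_mul_hat (hξ.hasDegree i), hξ.sq]
    simp [hat]
  · intro x hx i
    have h := D.commute_of_hasDegree_odd (hξ.hasDegree i) (fun ha => hξ.mul_L i ha) hx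
    rcases Int.units_eq_one_or (w i) with hw | hw
    · rw [hw, one_smul]
      exact h
    · rw [hw, Units.neg_smul, one_smul]
      exact h.neg_right

/-- Old and new variables have the same degrees, so twisting and rescaling change both products by
the same sign and the same degree operator, which can be cancelled because `gdet g X` has degree
zero. -/
theorem prod_eq_of_hat [GradedAlgebra 𝒜] [IsGradedComm 𝒜] (hξ : D.OddFamily g κ ξ) (w : Fin m → ℤˣ)
    {ξ' : Fin m → E} (hd : ∀ i, D.HasDegree (g i + κ) (ξ' i))
    (X : Matrix (Fin m) (Fin m) A) (hX : ∀ i j, X i j ∈ 𝒜 (g i + g j))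
    (h : (List.ofFn fun i => w i • D.hat (g i + κ) (ξ' i)).prod =
      (List.ofFn fun i => w i • D.hat (g i + κ) (ξ i)).prod *
        ((D.hatMat κ g g hξ.parity X hX).det : E)) :
    (List.ofFn ξ').prod = (List.ofFn ξ).prod * D.L (gdet g X) := by
  rw [prod_units_smul, prod_units_smul, D.prod_hat hd, D.prod_hat hξ.hasDegree, smul_smul,
    smul_smul, smul_mul_assoc, coe_det_hatMat] at h
  have h1 := MulAction.injective _ h
  apply D.hat_injective (∑ i, (g i + κ))
  rw [h1, ← D.hat_zero_left (D.L (gdet g X)), D.hat_mul_hat (D.hasDegree_L (gdet_mem hX)),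
    hat_zero_left, tw_zero_right, add_zero, one_smul]

theorem hasDegree_sum_left (hξ : D.OddFamily g κ ξ) (X : Matrix (Fin m) (Fin m) A)
    (hX : ∀ i j, X i j ∈ 𝒜 (g i + g j)) (i : Fin m) :
    D.HasDegree (g i + κ) (∑ j, ξ j * D.L (X j i)) := by
  refine D.hasDegree_sum _ fun j _ => ?_
  have h := (hξ.hasDegree j).mul (D.hasDegree_L (hX j i))
  rwa [add_add_add_cancel_grp] at h

theorem hasDegree_sum_right (hξ : D.OddFamily g κ ξ) (X : Matrix (Fin m) (Fin m) A)
    (hX : ∀ i j, X i j ∈ 𝒜 (g i + g j)) (i : Fin m) :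
    D.HasDegree (g i + κ) (∑ j, D.L (X i j) * ξ j) := by
  refine D.hasDegree_sum _ fun j _ => ?_
  have h := (D.hasDegree_L (hX i j)).mul (hξ.hasDegree j)
  rwa [add_comm, add_comm (g i), add_add_add_cancel_grp] at h

/-- The prefactor in `hatMat` is the sign that splits the twist of `ξ j * L (X j i)` into a product
of twists, so the twisted variables transform exactly by the columns of the twisted matrix. -/
theorem prod_sum_left [GradedAlgebra 𝒜] [IsGradedComm 𝒜] (hξ : D.OddFamily g κ ξ) (X : Matrix (Fin m) (Fin m) A)
    (hX : ∀ i j, X i j ∈ 𝒜 (g i + g j)) :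
    (List.ofFn fun i => ∑ j, ξ j * D.L (X j i)).prod = (List.ofFn ξ).prod * D.L (gdet g X) := by
  refine hξ.prod_eq_of_hat (fun _ => 1) (hξ.hasDegree_sum_left X hX) X hX ?_
  rw [← hξ.prod_hat_sum (fun _ => 1)]
  congr 2
  funext i
  rw [hat_sum, Finset.smul_sum]
  refine Finset.sum_congr rfl fun j _ => ?_
  rw [one_smul, one_smul, coe_hatMat, mul_smul_comm, D.hat_mul_hat (D.hasDegree_L (hX j i)),
    smul_smul, tw_mul_self, one_smul, add_add_add_cancel_grp]

/-- With coefficients on the left the rows act instead of the columns. After a rescaling of the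
variables this is the substitution by the transposed twisted matrix, which has the same determinant.
-/
theorem prod_sum_right [GradedAlgebra 𝒜] [IsGradedComm 𝒜] (hξ : D.OddFamily g κ ξ) (X : Matrix (Fin m) (Fin m) A)
    (hX : ∀ i j, X i j ∈ 𝒜 (g i + g j)) :
    (List.ofFn fun i => ∑ j, D.L (X i j) * ξ j).prod = (List.ofFn ξ).prod * D.L (gdet g X) := by
  -- These signs solve `w i = w j * tw (g i + κ) (g i + g j) * tw (g i + g j) (g j + κ)`, the
  -- condition for the rescaled variables to transform by the transpose.
  refine hξ.prod_eq_of_hat (fun i => tw (g i) (g i) * (tw (g i) κ * tw κ (g i)))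
    (hξ.hasDegree_sum_right X hX) X hX ?_
  rw [← Matrix.det_transpose, ← hξ.prod_hat_sum]
  congr 2
  funext i
  rw [hat_sum, Finset.smul_sum]
  refine Finset.sum_congr rfl fun j _ => ?_
  rw [Matrix.transpose_apply, smul_mul_assoc, ← (D.commute_of_hasDegree_odd (hξ.hasDegree j)
    (fun ha => hξ.mul_L j ha) (Subtype.prop _)).eq, coe_hatMat, smul_mul_assoc,
    D.hat_mul_hat (hξ.hasDegree j), smul_smul, smul_smul, add_comm (g i) (g j), add_comm (g j + _),
    add_add_add_cancel_grp]
  congr 1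
  simp only [tw_add_left, tw_add_right]
  generalize tw (g i) (g i) = a1
  generalize tw (g j) (g j) = a2
  generalize tw (g i) (g j) = a3
  generalize tw κ (g j) = a5
  generalize tw κ (g i) = a6
  generalize tw (g j) κ = a7
  generalize tw (g i) κ = a8
  have h : ∀ a b : ℤˣ, a * (a * b) = b := fun a b => by rw [← mul_assoc, Int.units_mul_self, one_mul]
  have h' : ∀ a b c : ℤˣ, a * (b * c) = b * (a * c) := mul_left_comm
  simp only [mul_comm, h', h]

end OddFamily

end DegreeOps

/-! ### Properties of the graded determinant -/

/-- The entries generate a finitely generated ideal of nilpotent elements, hence a nilpotent ideal,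
and the entries of the `k`-th power of the matrix lie in the `k`-th power of that ideal. -/
theorem isNilpotent_matrix_of_entries {R : Type*} [CommRing R] {ι : Type*} [Fintype ι]
    [DecidableEq ι] (X : Matrix ι ι R) (h : ∀ i j, IsNilpotent (X i j)) : IsNilpotent X := by
  let I : Ideal R := Ideal.span (Set.range fun x : ι × ι => X x.1 x.2)
  have hI : IsNilpotent I := by
    have hfg : I.FG := Submodule.fg_span (Set.finite_range _)
    rw [hfg.isNilpotent_iff_le_nilradical, Ideal.span_le]
    rintro _ ⟨x, rfl⟩
    exact h _ _
  obtain ⟨k, hk⟩ := hI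
  have hpow : ∀ k i j, (X ^ k) i j ∈ I ^ k := by
    intro k
    induction k with
    | zero =>
      intro i j
      simp
    | succ k ih =>
      intro i j
      rw [pow_succ X, Matrix.mul_apply, pow_succ I]
      exact sum_mem fun l _ => Ideal.mul_mem_mul (ih i l) (Ideal.subset_span ⟨(l, j), rfl⟩)
  refine ⟨k, ?_⟩
  ext i j
  have h1 := hpow k i j
  rw [hk] at h1
  exact h1

section GDet

open scoped IsMulCommutative

variable {K A : Type*} {n : ℕ} [Field K] [Ring A] [Algebra K A]
  (𝒜 : Grp n → Submodule K A) [GradedAlgebra 𝒜]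

/-- The degree operators on `A` itself. -/
def selfOps : DegreeOps 𝒜 (Module.End K A) where
  L := (Algebra.lmul K A).toRingHom
  op γ := signLin 𝒜 γ
  op_zero := by
    ext a
    exact signAut_zero 𝒜 a
  op_add α β := by
    ext a
    exact signAut_add 𝒜 α β a
  op_mul α {β a} ha := by
    ext b
    have h : signAut 𝒜 α (a * b) = ksign α β • (a * signAut 𝒜 α b) := by
      rw [map_mul, signAut_of_mem 𝒜 α ha, smul_mul_assoc]
    exact h

theorem selfOps_injective : Function.Injective (selfOps 𝒜).L := by
  intro a b h
  have h2 := DFunLike.congr_fun h 1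
  change a * 1 = b * 1 at h2
  rwa [mul_one, mul_one] at h2

variable {𝒜}
variable {m : ℕ} {g : Fin m → Grp n}

theorem mul_matrix_mem {ι ι' ι'' : Type*} [Fintype ι'] {g : ι → Grp n} {g' : ι' → Grp n}
    {g'' : ι'' → Grp n} {X : Matrix ι ι' A} {Y : Matrix ι' ι'' A}
    (hX : ∀ i j, X i j ∈ 𝒜 (g i + g' j)) (hY : ∀ i j, Y i j ∈ 𝒜 (g' i + g'' j)) (i : ι) (j : ι'') :
    (X * Y) i j ∈ 𝒜 (g i + g'' j) := by
  rw [Matrix.mul_apply]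
  refine sum_mem fun k _ => ?_
  have h := SetLike.GradedMul.mul_mem (hX i k) (hY k j)
  rwa [add_assoc, ← add_assoc (g' k), grp_add_self, zero_add] at h

theorem one_matrix_mem {ι : Type*} [DecidableEq ι] (g : ι → Grp n) (i j : ι) :
    (1 : Matrix ι ι A) i j ∈ 𝒜 (g i + g j) := by
  rw [Matrix.one_apply]
  split_ifs with h
  · rw [h, grp_add_self]
    exact SetLike.GradedOne.one_mem
  · exact zero_mem _

/-- In the operators on `A` itself, where `L` is injective, this is multiplicativity of the ordinary
determinant. -/
theorem gdet_mul [IsGradedComm 𝒜] (hg : ∀ i j, g i ⬝ᵥ g i = g j ⬝ᵥ g j)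
    {X Y : Matrix (Fin m) (Fin m) A} (hX : ∀ i j, X i j ∈ 𝒜 (g i + g j))
    (hY : ∀ i j, Y i j ∈ 𝒜 (g i + g j)) : gdet g (X * Y) = gdet g X * gdet g Y := by
  apply selfOps_injective 𝒜
  rw [map_mul, ← DegreeOps.coe_det_hatMat _ 0 g hg X hX, ← DegreeOps.coe_det_hatMat _ 0 g hg Y hY,
    ← DegreeOps.coe_det_hatMat _ 0 g hg (X * Y) (mul_matrix_mem hX hY),
    DegreeOps.hatMat_mul _ 0 g g g hg hg hg X Y hX hY, Matrix.det_mul]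
  rfl

theorem hatMat_one [IsGradedComm 𝒜] {E : Type*} [Ring E] (D : DegreeOps 𝒜 E) {ι : Type*}
    [DecidableEq ι]
    {g : ι → Grp n} (hg : ∀ i j, g i ⬝ᵥ g i = g j ⬝ᵥ g j) {X : Matrix ι ι A}
    (hX : ∀ i j, X i j ∈ 𝒜 (g i + g j)) (h : X = 1) : D.hatMat 0 g g hg X hX = 1 := by
  subst h
  ext i j
  rw [DegreeOps.coe_hatMat]
  by_cases h : i = j
  · subst h
    rw [Matrix.one_apply_eq, Matrix.one_apply_eq, grp_add_self, D.hat_zero_left, tw_zero_right,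
      map_one, one_smul]
    rfl
  · rw [Matrix.one_apply_ne h, Matrix.one_apply_ne h, map_zero, DegreeOps.hat, zero_mul, smul_zero]
    rfl

theorem gdet_one [IsGradedComm 𝒜] (hg : ∀ i j, g i ⬝ᵥ g i = g j ⬝ᵥ g j) :
    gdet g (1 : Matrix (Fin m) (Fin m) A) = 1 := by
  apply selfOps_injective 𝒜
  rw [← DegreeOps.coe_det_hatMat _ 0 g hg 1 (one_matrix_mem g), hatMat_one _ hg _ rfl,
    Matrix.det_one, map_one]
  rfl

/-- Twisting keeps zero entries and does not change entries between equal degrees, so the twisted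
matrix is block triangular with identity blocks on the diagonal. -/
theorem gdet_eq_one_of_unitriangular [IsGradedComm 𝒜] (hg : ∀ i j, g i ⬝ᵥ g i = g j ⬝ᵥ g j)
    {X : Matrix (Fin m) (Fin m) A} (hX : ∀ i j, X i j ∈ 𝒜 (g i + g j)) (f : Grp n → ℕ)
    (hf : Function.Injective f) (h1 : ∀ i j, g i = g j → X i j = if i = j then 1 else 0)
    (h0 : ∀ i j, f (g i) < f (g j) → X i j = 0) : gdet g X = 1 := by
  apply selfOps_injective 𝒜
  rw [← DegreeOps.coe_det_hatMat _ 0 g hg X hX]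
  have htri : ((selfOps 𝒜).hatMat 0 g g hg X hX).BlockTriangular
      fun i => OrderDual.toDual (f (g i)) := by
    intro i j hij
    apply Subtype.ext
    rw [DegreeOps.coe_hatMat, h0 i j hij, map_zero, DegreeOps.hat, zero_mul, smul_zero]
    rfl
  rw [htri.det, Finset.prod_eq_one, map_one]
  · rfl
  · intro a _
    have h : ((selfOps 𝒜).hatMat 0 g g hg X hX).toSquareBlock
        (fun i => OrderDual.toDual (f (g i))) a = 1 := by
      refine Matrix.ext fun i j => Subtype.ext ?_
      have hij : g i = g j := hf (OrderDual.toDual.injective (i.2.trans j.2.symm))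
      change (((selfOps 𝒜).hatMat 0 g g hg X hX i j : (selfOps 𝒜).evenRing) :
        Module.End K A) = _
      rw [DegreeOps.coe_hatMat, h1 i j hij, hij, grp_add_self, tw_zero_right, one_smul,
        DegreeOps.hat_zero_left, Matrix.one_apply]
      simp only [Subtype.ext_iff]
      split_ifs
      · rw [map_one]; rfl
      · rw [map_zero]; rfl
    rw [h, Matrix.det_one]

/-- The diagonal block of `X` at `γ`. -/
def gblock {ι : Type*} {g : ι → Grp n} {X : Matrix ι ι A} (hX : ∀ i j, X i j ∈ 𝒜 (g i + g j))
    (γ : Grp n) : Matrix {i // g i = γ} {i // g i = γ} (𝒜 0) :=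
  Matrix.of fun i j => ⟨X i j, by
    have h := hX i j
    rwa [i.2, j.2, grp_add_self] at h⟩

/-- The inclusion of the degree-zero part into the ring of twisted even elements. -/
def zeroHom [IsGradedComm 𝒜] {E : Type*} [Ring E] (D : DegreeOps 𝒜 E) : 𝒜 0 →+* D.evenRing where
  toFun a := ⟨D.L a, by
    have h := D.hat_L_mem (α := 0) (by simp) a.2
    rwa [D.hat_zero_left] at h⟩
  map_one' := Subtype.ext (map_one D.L)
  map_mul' a b := Subtype.ext (map_mul D.L _ _)
  map_zero' := Subtype.ext (map_zero D.L)
  map_add' a b := Subtype.ext (map_add D.L _ _)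

/-- Entries inside a block have degree zero and are not affected by the twist. Hence the diagonal
blocks of the twisted matrix are the images of the blocks over `A⁰` under `zeroHom`. -/
theorem gdet_of_blockDiagonal [IsGradedComm 𝒜] (hg : ∀ i j, g i ⬝ᵥ g i = g j ⬝ᵥ g j)
    {X : Matrix (Fin m) (Fin m) A} (hX : ∀ i j, X i j ∈ 𝒜 (g i + g j))
    (h0 : ∀ i j, g i ≠ g j → X i j = 0) :
    gdet g X = ((∏ γ : Grp n, (gblock hX γ).det : 𝒜 0) : A) := by
  apply selfOps_injective 𝒜
  rw [← DegreeOps.coe_det_hatMat _ 0 g hg X hX]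
  change _ = ((zeroHom (selfOps 𝒜) (∏ γ : Grp n, (gblock hX γ).det) : (selfOps 𝒜).evenRing) :
    Module.End K A)
  congr 1
  have htri : ((selfOps 𝒜).hatMat 0 g g hg X hX).BlockTriangular
      fun i => Fintype.equivFin (Grp n) (g i) := by
    intro i j hij
    apply Subtype.ext
    rw [DegreeOps.coe_hatMat, h0 i j fun h => hij.ne (by simp only [h]), map_zero, DegreeOps.hat, zero_mul,
      smul_zero]
    rfl
  rw [htri.det_fintype, map_prod, ← Equiv.prod_comp (Fintype.equivFin (Grp n))]
  refine Finset.prod_congr rfl fun γ _ => ?_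
  rw [RingHom.map_det, ← Matrix.det_submatrix_equiv_self
    (Equiv.subtypeEquivRight fun i => ((Fintype.equivFin (Grp n)).apply_eq_iff_eq (x := g i)
      (y := γ)))
    ((zeroHom (selfOps 𝒜)).mapMatrix (gblock hX γ))]
  congr 1
  refine Matrix.ext fun i j => Subtype.ext ?_
  have hij : g i = g j := (Fintype.equivFin (Grp n)).injective (i.2.trans j.2.symm)
  change (((selfOps 𝒜).hatMat 0 g g hg X hX i j : (selfOps 𝒜).evenRing) :
    Module.End K A) = (selfOps 𝒜).L (X i j)
  rw [DegreeOps.coe_hatMat, hij, grp_add_self, tw_zero_right, one_smul, DegreeOps.hat_zero_left]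

theorem mul_self_eq_zero_of_odd [CharZero K] [IsGradedComm 𝒜] {α : Grp n} (hα : α ⬝ᵥ α = 1) {a : A}
    (ha : a ∈ 𝒜 α) : a * a = 0 := by
  have h := IsGradedComm.comm ha ha
  rw [ksign_self_of_odd hα, Units.neg_smul, one_smul] at h
  have h2 : (2 : K) • (a * a) = 0 := by
    rw [two_smul]
    nth_rewrite 1 [h]
    exact neg_add_cancel _
  exact (smul_eq_zero.mp h2).resolve_left two_ne_zero

/-- An odd `X i j` squares to zero, and so does each `X i j * Y j k`. After twisting, the entries of
the product are sums of commuting nilpotents in a commutative ring. -/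
theorem isNilpotent_mul_of_odd [CharZero K] [IsGradedComm 𝒜] {ι ι' : Type*} [Fintype ι]
    [DecidableEq ι] [Fintype ι'] {g : ι → Grp n} {g' : ι' → Grp n}
    (hg : ∀ i j, g i ⬝ᵥ g i = g j ⬝ᵥ g j)
    (hodd : ∀ i j, (g i + g' j) ⬝ᵥ (g i + g' j) = 1) {X : Matrix ι ι' A} {Y : Matrix ι' ι A}
    (hX : ∀ i j, X i j ∈ 𝒜 (g i + g' j)) (hY : ∀ i j, Y i j ∈ 𝒜 (g' i + g j)) :
    IsNilpotent (X * Y) := by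
  let D := selfOps 𝒜
  have hnil : IsNilpotent (D.hatMat 0 g g hg (X * Y) (mul_matrix_mem hX hY)) := by
    refine isNilpotent_matrix_of_entries _ fun i k => ?_
    let z : ι' → D.evenRing := fun j => tw (g i + 0) (g i + g k) •
      ⟨D.hat (g i + g k) (D.L (X i j * Y j k)), D.hat_L_mem (even_add_of_eq (hg i k)) (by
        have h := SetLike.GradedMul.mul_mem (hX i j) (hY j k)
        rwa [add_assoc, ← add_assoc (g' j), grp_add_self, zero_add] at h)⟩
    have hz : D.hatMat 0 g g hg (X * Y) (mul_matrix_mem hX hY) i k = ∑ j, z j := by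
      apply Subtype.ext
      have h0 := map_sum D.evenRing.subtype z Finset.univ
      refine Eq.trans ?_ h0.symm
      rw [DegreeOps.coe_hatMat, Matrix.mul_apply, map_sum, DegreeOps.hat_sum, Finset.smul_sum]
      refine Finset.sum_congr rfl fun j _ => ?_
      change _ = ((z j : D.evenRing) : Module.End K A)
      simp only [z]
      rw [D.coe_units_smul]
    rw [hz]
    refine isNilpotent_sum fun j _ => ⟨2, ?_⟩
    apply Subtype.ext
    rw [pow_two, Subring.coe_mul, D.coe_units_smul, smul_mul_smul_comm, Int.units_mul_self,
      one_smul, D.hat_mul_hat (D.hasDegree_L ?_), ← map_mul]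
    · have h : X i j * Y j k * (X i j * Y j k) = 0 := by
        rw [mul_assoc, ← mul_assoc (Y j k), IsGradedComm.comm (hY j k) (hX i j), smul_mul_assoc,
          mul_smul_comm, ← mul_assoc, ← mul_assoc, mul_self_eq_zero_of_odd (hodd i j) (hX i j),
          zero_mul, zero_mul, smul_zero]
      rw [h, map_zero, DegreeOps.hat, zero_mul, smul_zero]
      rfl
    · have h := SetLike.GradedMul.mul_mem (hX i j) (hY j k)
      rwa [add_assoc, ← add_assoc (g' j), grp_add_self, zero_add] at h
  obtain ⟨k, hk⟩ := hnil
  -- Twisting respects powers, so a vanishing power of the twisted matrix gives a vanishing power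
  -- over `A` by injectivity of `hat` and `L`.
  have hpow : ∀ k : ℕ, ∃ h : ∀ i j, ((X * Y) ^ k) i j ∈ 𝒜 (g i + g j),
      D.hatMat 0 g g hg ((X * Y) ^ k) h =
        D.hatMat 0 g g hg (X * Y) (mul_matrix_mem hX hY) ^ k := by
    intro k
    induction k with
    | zero =>
      refine ⟨?_, ?_⟩
      · rw [pow_zero]
        exact one_matrix_mem g
      · rw [hatMat_one D hg _ (pow_zero _), pow_zero]
    | succ k ih =>
      obtain ⟨h, h2⟩ := ih
      refine ⟨?_, ?_⟩
      · rw [pow_succ]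
        exact mul_matrix_mem h (mul_matrix_mem hX hY)
      · rw [pow_succ (D.hatMat 0 g g hg (X * Y) _), ← h2]
        rw [← D.hatMat_mul 0 g g g hg hg hg _ _ h (mul_matrix_mem hX hY)
          (mul_matrix_mem h (mul_matrix_mem hX hY))]
        congr 1
  obtain ⟨h, h2⟩ := hpow k
  refine ⟨k, ?_⟩
  ext i j
  have h3 := congrArg Subtype.val (congrFun (congrFun (h2.trans hk) i) j)
  rw [D.coe_hatMat] at h3
  have h4 : D.hat (g i + g j) (D.L (((X * Y) ^ k) i j)) = D.hat (g i + g j) (D.L 0) := by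
    rw [map_zero, DegreeOps.hat, DegreeOps.hat, zero_mul]
    exact (smul_eq_zero_iff_eq _).mp h3
  exact selfOps_injective 𝒜 (D.hat_injective _ h4)

end GDet

/-! ### Graded commutation and the universal property of `S_A(N)` -/

section GComm

variable {n : ℕ} {E : Type*} [Ring E]

/-- The elements `P` and `Q` commute up to the sign `(-1)^⟨α, β⟩`. -/
def GComm (α β : Grp n) (P Q : E) : Prop := P * Q = ksign α β • (Q * P)

namespace GComm

variable {α α' β β' : Grp n} {P P' Q Q' : E}

theorem symm (h : GComm α β P Q) : GComm β α Q P := by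
  rw [GComm, h, smul_smul, ksign_comm, ksign_mul_self, one_smul]

theorem mul_left (h : GComm α β P Q) (h' : GComm α' β P' Q) : GComm (α + α') β (P * P') Q := by
  rw [GComm, mul_assoc, h', mul_smul_comm, ← mul_assoc, h, smul_mul_assoc, smul_smul, mul_assoc,
    ksign_add_left, mul_comm]

theorem mul_right (h : GComm α β P Q) (h' : GComm α β' P Q') : GComm α (β + β') P (Q * Q') :=
  (h.symm.mul_left h'.symm).symm

theorem sum_left {ι : Type*} (s : Finset ι) {f : ι → E} (h : ∀ i ∈ s, GComm α β (f i) Q) :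
    GComm α β (∑ i ∈ s, f i) Q := by
  rw [GComm, Finset.sum_mul, Finset.mul_sum, Finset.smul_sum]
  exact Finset.sum_congr rfl h

theorem sum_right {ι : Type*} (s : Finset ι) {f : ι → E} (h : ∀ i ∈ s, GComm α β P (f i)) :
    GComm α β P (∑ i ∈ s, f i) :=
  (sum_left s fun i hi => (h i hi).symm).symm

theorem zero_right : GComm α β P 0 := by simp [GComm]

theorem zero_left : GComm α β 0 Q := by simp [GComm]

end GComm

theorem grp_add_add_cancel_right (α β : Grp n) : α + β + β = α := by
  rw [add_assoc, grp_add_self, add_zero]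

end GComm

section Model

variable {K A : Type*} {n : ℕ} [Field K] [Ring A] [Algebra K A]
  {𝒜 : Grp n → Submodule K A}
  {N : Type*} [AddCommGroup N] [Module K N] [Module A N] {𝒩 : Grp n → Submodule K N}
  {V : Type*} {dv : V → Grp n}

variable (𝒜 𝒩 dv) in
/-- A homogeneous basis for which homogeneous elements have homogeneous coordinates. -/
structure AdaptedBasis where
  /-- The underlying basis. -/
  basis : Module.Basis V A N
  mem : ∀ v, basis v ∈ 𝒩 (dv v)
  repr_mem : ∀ {β : Grp n} {x : N}, x ∈ 𝒩 β → ∀ v, basis.repr x v ∈ 𝒜 (β + dv v)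

namespace GSym

theorem induction {P : GSym 𝒜 𝒩 → Prop} (alg : ∀ a, P (ofAlg 𝒜 𝒩 a)) (mod : ∀ x, P (ofMod 𝒜 𝒩 x))
    (mul : ∀ s t, P s → P t → P (s * t)) (add : ∀ s t, P s → P t → P (s + t)) (s : GSym 𝒜 𝒩) :
    P s := by
  obtain ⟨s, rfl⟩ := RingQuot.mkAlgHom_surjective K (SymRel 𝒜 𝒩) s
  induction s using FreeAlgebra.induction with
  | grade0 k =>
    rw [AlgHom.commutes]
    have h := ofAlg_algebraMap 𝒜 𝒩 k
    change P (algebraMap K (GSym 𝒜 𝒩) k)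
    rw [← h]
    exact alg _
  | grade1 x =>
    rcases x with a | x
    · exact alg a
    · exact mod x
  | mul s t hs ht =>
    rw [map_mul]
    exact mul _ _ hs ht
  | add s t hs ht =>
    rw [map_add]
    exact add _ _ hs ht

theorem gcomm_ofMod {α β : Grp n} {x y : N} (hx : x ∈ 𝒩 α) (hy : y ∈ 𝒩 β) :
    GComm α β (ofMod 𝒜 𝒩 x) (ofMod 𝒜 𝒩 y) := by
  have h : mk 𝒜 𝒩 _ = mk 𝒜 𝒩 _ := mk_rel (SymRel.comm hx hy)
  rw [map_mul, Units.smul_def, map_zsmul, map_mul, ← Units.smul_def] at h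
  exact h

theorem ofMod_add (x y : N) : ofMod 𝒜 𝒩 (x + y) = ofMod 𝒜 𝒩 x + ofMod 𝒜 𝒩 y := by
  have h : mk 𝒜 𝒩 _ = mk 𝒜 𝒩 _ := mk_rel (SymRel.add_mod x y)
  rw [map_add] at h
  exact h

variable (𝒜 𝒩) in
/-- The inclusion of `N` as an additive map. -/
def ofModHom : N →+ GSym 𝒜 𝒩 := AddMonoidHom.mk' (ofMod 𝒜 𝒩) ofMod_add

theorem ofMod_sum {ι : Type*} (s : Finset ι) (f : ι → N) :
    ofMod 𝒜 𝒩 (∑ i ∈ s, f i) = ∑ i ∈ s, ofMod 𝒜 𝒩 (f i) :=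
  map_sum (ofModHom 𝒜 𝒩) f s

variable [Fintype V] (b : AdaptedBasis 𝒜 𝒩 dv) {E : Type*} [Ring E] [Algebra K E]
  (L : A →ₐ[K] E) (X : V → E)

/-- The algebra homomorphism from `S_A(N)` with prescribed values on `A` and on a basis. -/
noncomputable def lift (hL : ∀ v {α : Grp n} {a : A}, a ∈ 𝒜 α → GComm (dv v) α (X v) (L a))
    (hX : ∀ v w, GComm (dv v) (dv w) (X v) (X w)) [IsGradedComm 𝒜] : GSym 𝒜 𝒩 →ₐ[K] E :=
  RingQuot.liftAlgHom K ⟨FreeAlgebra.lift K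
    (Sum.elim L fun x => ∑ v, L (b.basis.repr x v) * X v), by
    have hLL : ∀ {α β : Grp n} {a c : A}, a ∈ 𝒜 α → c ∈ 𝒜 β → GComm α β (L a) (L c) := by
      intro α β a c ha hc
      rw [GComm, ← map_mul, IsGradedComm.comm ha hc, Units.smul_def, map_zsmul, map_mul,
        ← Units.smul_def]
    -- A coordinate of `x` at `v` has degree `α + dv v`, so every summand of the image of `x` has
    -- total degree `α`; the adaptedness of the basis is used here.
    have hterm : ∀ {α β : Grp n} {x : N} {Q : E}, x ∈ 𝒩 α →
        (∀ v, GComm (dv v) β (X v) Q) → (∀ {γ : Grp n} {a : A}, a ∈ 𝒜 γ → GComm γ β (L a) Q) →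
        GComm α β (∑ v, L (b.basis.repr x v) * X v) Q := by
      intro α β x Q hx h1 h2
      refine GComm.sum_left _ fun v _ => ?_
      have h := (h2 (b.repr_mem hx v)).mul_left (h1 v)
      rwa [grp_add_add_cancel_right] at h
    have hmod : ∀ {α β : Grp n} {a : A} {x : N}, a ∈ 𝒜 α → x ∈ 𝒩 β →
        GComm β α (∑ v, L (b.basis.repr x v) * X v) (L a) := fun ha hx =>
      hterm hx (fun v => hL v ha) fun hc => hLL hc ha
    have hsmul : ∀ (a : A) (x : N), ∑ v, L (b.basis.repr (a • x) v) * X v =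
        L a * ∑ v, L (b.basis.repr x v) * X v := by
      intro a x
      rw [Finset.mul_sum]
      refine Finset.sum_congr rfl fun v _ => ?_
      rw [map_smul, Finsupp.smul_apply, smul_eq_mul, map_mul, mul_assoc]
    intro x y h
    induction h with
    | add_alg a b => simp
    | mul_alg a b => simp
    | scalar k => simp
    | add_mod x y => simp [add_mul, Finset.sum_add_distrib]
    | smul_left a x =>
      rw [map_mul, FreeAlgebra.lift_ι_apply, FreeAlgebra.lift_ι_apply, FreeAlgebra.lift_ι_apply]
      exact hsmul a x
    | @smul_right α β a x ha hx =>
      rw [map_mul, FreeAlgebra.lift_ι_apply, FreeAlgebra.lift_ι_apply, FreeAlgebra.lift_ι_apply]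
      have h1 : ksign α β • (a • x) = (((ksign α β : ℤˣ) : ℤ) : A) • a • x := by
        rw [Units.smul_def, Int.cast_smul_eq_zsmul]
      simp only [Sum.elim_inl, Sum.elim_inr]
      rw [(hmod ha hx), h1, hsmul, hsmul, map_intCast, Units.smul_def, ← zsmul_eq_mul, ksign_comm]
    | @comm α β x y hx hy =>
      rw [map_mul, Units.smul_def, map_zsmul, map_mul, FreeAlgebra.lift_ι_apply,
        FreeAlgebra.lift_ι_apply, ← Units.smul_def]
      exact hterm hx (fun v => (hterm hy (fun w => hX w v) fun ha => (hL v ha).symm).symm)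
        fun ha => (hmod ha hy).symm⟩

variable {b L X} (hL : ∀ v {α : Grp n} {a : A}, a ∈ 𝒜 α → GComm (dv v) α (X v) (L a))
    (hX : ∀ v w, GComm (dv v) (dv w) (X v) (X w)) [IsGradedComm 𝒜]

theorem lift_ofAlg (a : A) : lift b L X hL hX (ofAlg 𝒜 𝒩 a) = L a := by
  change RingQuot.liftAlgHom K _ (RingQuot.mkAlgHom K _ _) = _
  rw [RingQuot.liftAlgHom_mkAlgHom_apply, FreeAlgebra.lift_ι_apply]
  rfl

theorem lift_ofMod (x : N) :
    lift b L X hL hX (ofMod 𝒜 𝒩 x) = ∑ v, L (b.basis.repr x v) * X v := by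
  change RingQuot.liftAlgHom K _ (RingQuot.mkAlgHom K _ _) = _
  rw [RingQuot.liftAlgHom_mkAlgHom_apply, FreeAlgebra.lift_ι_apply]
  rfl

theorem lift_ofMod_basis (v : V) : lift b L X hL hX (ofMod 𝒜 𝒩 (b.basis v)) = X v := by
  classical
  rw [lift_ofMod, Finset.sum_eq_single v]
  · rw [Module.Basis.repr_self, Finsupp.single_eq_same, map_one, one_mul]
  · intro w _ hw
    rw [Module.Basis.repr_self, Finsupp.single_eq_of_ne hw, map_zero, zero_mul]
  · simp

end GSym

end Model

/-! ### The model of `S_A(N)`: operators on the free module on multisets of basis elements -/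

section Units

variable {K : Type*} [Field K]

variable (K) in
/-- A sign as an element of `K`. -/
def sgnK : ℤˣ →* K := (Int.castRingHom K).toMonoidHom.comp (Units.coeHom ℤ)

theorem sgnK_smul {M : Type*} [AddCommGroup M] [Module K M] (u : ℤˣ) (x : M) :
    sgnK K u • x = u • x := by
  rw [Units.smul_def, ← Int.cast_smul_eq_zsmul K]
  rfl

theorem sgnK_mul_self (u : ℤˣ) : sgnK K u * sgnK K u = 1 := by
  rw [← map_mul, Int.units_mul_self, map_one]

theorem sgnK_neg_one : sgnK K (-1) = -1 := by simp [sgnK]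

end Units

section Model

variable {K A : Type*} {n : ℕ} [Field K] [Ring A] [Algebra K A]
  (𝒜 : Grp n → Submodule K A) [GradedAlgebra 𝒜]
  {V : Type*}

/-- The operator `m ↦ s(m) f(m)` on the free module on multisets, of degree `γ`. -/
noncomputable def sop (γ : Grp n) (f : Multiset V → Multiset V) (s : Multiset V → K) :
    Module.End K (Multiset V →₀ A) :=
  Finsupp.lsum K fun m => Finsupp.lsingle (f m) ∘ₗ (s m • signLin 𝒜 γ)

theorem sop_single (γ : Grp n) (f : Multiset V → Multiset V) (s : Multiset V → K)
    (m : Multiset V) (c : A) :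
    sop 𝒜 γ f s (Finsupp.single m c) = Finsupp.single (f m) (s m • signAut 𝒜 γ c) := by
  simp [sop, signLin]

theorem sop_ext {P Q : Module.End K (Multiset V →₀ A)}
    (h : ∀ m c, P (Finsupp.single m c) = Q (Finsupp.single m c)) : P = Q :=
  Finsupp.lhom_ext h

variable (K A V) in
/-- The action of `A` on the model. -/
noncomputable def mL : A →ₐ[K] Module.End K (Multiset V →₀ A) := Algebra.lsmul K K (Multiset V →₀ A)

theorem mL_single (a : A) (m : Multiset V) (c : A) :
    mL K A V a (Finsupp.single m c) = Finsupp.single m (a * c) := by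
  simp [mL]

theorem sop_mul_mL (γ : Grp n) (f : Multiset V → Multiset V) (s : Multiset V → K) {α : Grp n}
    {a : A} (ha : a ∈ 𝒜 α) : GComm γ α (sop 𝒜 γ f s) (mL K A V a) := by
  refine sop_ext fun m c => ?_
  rw [Units.smul_def, LinearMap.smul_apply, ← Units.smul_def, Module.End.mul_apply,
    Module.End.mul_apply, mL_single, sop_single, sop_single, mL_single, map_mul,
    signAut_of_mem 𝒜 γ ha, Finsupp.smul_single, smul_mul_assoc, mul_smul_comm, smul_comm]

variable (dv : V → Grp n)

/-- The degree of a monomial. -/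
def mdeg (m : Multiset V) : Grp n := (m.map dv).sum

theorem mdeg_cons (v : V) (m : Multiset V) : mdeg dv (v ::ₘ m) = dv v + mdeg dv m := by
  simp [mdeg]

/-- The degree operators on the model. -/
noncomputable def degOp (γ : Grp n) : Module.End K (Multiset V →₀ A) :=
  sop 𝒜 γ id fun m => sgnK K (ksign γ (mdeg dv m))

theorem degOp_single (γ : Grp n) (m : Multiset V) (c : A) :
    degOp 𝒜 dv γ (Finsupp.single m c) =
      Finsupp.single m (ksign γ (mdeg dv m) • signAut 𝒜 γ c) := by
  rw [degOp, sop_single, sgnK_smul]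
  rfl

/-- The model as a module over a ring with degree operators. -/
noncomputable def modelOps : DegreeOps 𝒜 (Module.End K (Multiset V →₀ A)) where
  L := (mL K A V).toRingHom
  op := degOp 𝒜 dv
  op_zero := by
    refine sop_ext fun m c => ?_
    rw [degOp_single, ksign_zero_left, one_smul, signAut_zero, Module.End.one_apply]
  op_add α β := by
    refine sop_ext fun m c => ?_
    rw [Module.End.mul_apply, degOp_single, degOp_single, degOp_single, signAut_units_smul,
      smul_smul, ksign_add_left, signAut_add]
  op_mul α {β a} ha := sop_mul_mL 𝒜 α _ _ ha

theorem modelOps_L (a : A) : (modelOps (K := K) 𝒜 dv).L a = mL K A V a := rfl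

variable [Fintype V] [DecidableEq V]

/-- Half of the sign rule. -/
noncomputable def vs (v w : V) : ℤˣ :=
  if Fintype.equivFin V w < Fintype.equivFin V v then ksign (dv v) (dv w) else 1

theorem vs_swap {v w : V} (h : v ≠ w) : vs dv v w = ksign (dv v) (dv w) * vs dv w v := by
  rw [vs, vs]
  rcases lt_trichotomy (Fintype.equivFin V v) (Fintype.equivFin V w) with h' | h' | h'
  · rw [if_neg h'.not_gt, if_pos h', ksign_comm (dv w), ksign_mul_self]
  · exact absurd ((Fintype.equivFin V).injective h') h
  · rw [if_pos h', if_neg h'.not_gt, mul_one]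

/-- The sign with which `v` is multiplied into the monomial `m`. -/
noncomputable def chi (v : V) (m : Multiset V) : ℤˣ := (m.map (vs dv v)).prod

theorem chi_cons (v w : V) (m : Multiset V) : chi dv v (w ::ₘ m) = vs dv v w * chi dv v m := by
  simp [chi]

/-- The coefficient of multiplication by `v`. -/
noncomputable def mulCoeff (v : V) (m : Multiset V) : K :=
  if dv v ⬝ᵥ dv v = 1 ∧ v ∈ m then 0 else sgnK K (chi dv v m)

/-- Multiplication by the basis element `v`. -/
noncomputable def mX (v : V) : Module.End K (Multiset V →₀ A) :=
  sop 𝒜 (dv v) (fun m => v ::ₘ m) (mulCoeff dv v)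

theorem mX_single (v : V) (m : Multiset V) (c : A) : mX 𝒜 dv v (Finsupp.single m c) =
    Finsupp.single (v ::ₘ m) ((mulCoeff dv v m : K) • signAut 𝒜 (dv v) c) :=
  sop_single _ _ _ _ _ _

theorem mX_mL (v : V) {α : Grp n} {a : A} (ha : a ∈ 𝒜 α) :
    GComm (dv v) α (mX 𝒜 dv v) (mL K A V a) :=
  sop_mul_mL _ _ _ _ ha

/-- For distinct variables the auxiliary enumeration puts the whole sign of the exchange into one of
the two orders. For equal variables both sides vanish in the odd case, and the sign is trivial in
the even case. -/
theorem mulCoeff_swap (v w : V) (m : Multiset V) :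
    (mulCoeff dv v (w ::ₘ m) * mulCoeff dv w m : K) =
      sgnK K (ksign (dv v) (dv w)) * (mulCoeff dv w (v ::ₘ m) * mulCoeff dv v m) := by
  by_cases h : v = w
  · subst h
    by_cases hv : dv v ⬝ᵥ dv v = 1
    · simp [mulCoeff, hv]
    · have hv' : dv v ⬝ᵥ dv v = 0 := by
        generalize dv v ⬝ᵥ dv v = z at hv
        revert z
        decide
      rw [ksign_self_of_even hv', map_one, one_mul]
  · simp only [mulCoeff, Multiset.mem_cons, h, Ne.symm h, false_or, chi_cons]
    split_ifs
    · simp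
    · simp
    · simp
    · rw [vs_swap dv h, ← map_mul, ← map_mul, ← map_mul]
      congr 1
      simp only [mul_assoc, mul_comm (chi dv v m)]

theorem mX_mX (v w : V) : GComm (dv v) (dv w) (mX (K := K) 𝒜 dv v) (mX 𝒜 dv w) := by
  refine sop_ext fun m c => ?_
  rw [Units.smul_def, LinearMap.smul_apply, ← Units.smul_def, Module.End.mul_apply,
    Module.End.mul_apply, mX_single, mX_single, mX_single, mX_single, signAut_smul, signAut_smul,
    smul_smul, smul_smul, Finsupp.smul_single, ← sgnK_smul (K := K), smul_smul, mulCoeff_swap,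
    Multiset.cons_swap, ← signAut_add, ← signAut_add, add_comm (dv v)]

theorem mX_sq {v : V} (hv : dv v ⬝ᵥ dv v = 1) : mX (K := K) 𝒜 dv v * mX 𝒜 dv v = 0 := by
  refine sop_ext fun m c => ?_
  rw [Module.End.mul_apply, mX_single, mX_single]
  simp [mulCoeff, hv]

theorem hasDegree_mX (v : V) : (modelOps (K := K) 𝒜 dv).HasDegree (dv v) (mX 𝒜 dv v) := by
  intro γ
  refine sop_ext fun m c => ?_
  change (degOp 𝒜 dv γ * mX 𝒜 dv v) _ = _
  rw [Units.smul_def, LinearMap.smul_apply, ← Units.smul_def, Module.End.mul_apply, mX_single,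
    degOp_single]
  change _ = _ • (mX 𝒜 dv v * degOp 𝒜 dv γ) _
  rw [Module.End.mul_apply, degOp_single, mX_single, signAut_smul, signAut_units_smul,
    Finsupp.smul_single, mdeg_cons, ksign_add_right, ← signAut_add, ← signAut_add,
    add_comm (dv v) γ, ← smul_smul, smul_comm (mulCoeff dv v m : K)]

end Model

section Model

variable {K A : Type*} {n : ℕ} [Field K] [Ring A] [Algebra K A]
  {𝒜 : Grp n → Submodule K A} [GradedAlgebra 𝒜] [IsGradedComm 𝒜]
  {V : Type*} {dv : V → Grp n} [Fintype V] [DecidableEq V]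
  {N : Type*} [AddCommGroup N] [Module K N] [Module A N]
  {𝒩 : Grp n → Submodule K N} (b : AdaptedBasis 𝒜 𝒩 dv)

/-- The action of `S_A(N)` on its model. -/
noncomputable def act : GSym 𝒜 𝒩 →ₐ[K] Module.End K (Multiset V →₀ A) :=
  GSym.lift (E := Module.End K (Multiset V →₀ A)) b (mL K A V) (mX 𝒜 dv) (fun v _ _ ha => mX_mL 𝒜 dv v ha) (mX_mX 𝒜 dv)

theorem act_ofAlg (a : A) : act b (GSym.ofAlg 𝒜 𝒩 a) = mL K A V a := GSym.lift_ofAlg _ _ _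

theorem act_ofMod_basis (v : V) : act b (GSym.ofMod 𝒜 𝒩 (b.basis v)) = mX 𝒜 dv v :=
  GSym.lift_ofMod_basis _ _ _

/-- The sign of a list of basis elements, relative to the corresponding multiset. -/
noncomputable def lsign (dv : V → Grp n) : List V → ℤˣ
  | [] => 1
  | v :: l => chi dv v l * lsign dv l

/-- The normalized monomial of a list of basis elements. -/
noncomputable def lmon (l : List V) : GSym 𝒜 𝒩 :=
  lsign dv l • (l.map fun v => GSym.ofMod 𝒜 𝒩 (b.basis v)).prod

theorem lmon_cons (v : V) (l : List V) :
    lmon b (v :: l) = chi dv v l • (GSym.ofMod 𝒜 𝒩 (b.basis v) * lmon b l) := by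
  rw [lmon, lmon, lsign, List.map_cons, List.prod_cons, mul_smul_comm, smul_smul]

/-- The factor `lsign` collects the sign rule over the inversions of the list relative to a fixed
enumeration of `V`, which compensates any reordering of the product. -/
theorem lmon_perm {l l' : List V} (h : l.Perm l') : lmon b l = lmon b l' := by
  induction h with
  | nil => rfl
  | @cons v l l' h ih => rw [lmon_cons, lmon_cons, ih, Multiset.coe_eq_coe.mpr h]
  | swap v w l =>
    by_cases hvw : w = v
    · rw [hvw]
    rw [lmon_cons, lmon_cons, lmon_cons, lmon_cons, mul_smul_comm, mul_smul_comm, smul_smul,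
      smul_smul, ← mul_assoc, ← mul_assoc,
      GSym.gcomm_ofMod (b.mem w) (b.mem v), smul_mul_assoc, smul_smul]
    congr 1
    rw [← Multiset.cons_coe, ← Multiset.cons_coe, chi_cons, chi_cons, vs_swap dv hvw]
    have h : ∀ a b c d : ℤˣ, d * a * b * c * d = a * c * b := by
      intro a b c d
      rw [mul_assoc d, mul_assoc d, mul_comm d, mul_assoc, Int.units_mul_self, mul_one,
        mul_right_comm]
    exact h _ _ _ _
  | trans _ _ h1 h2 => rw [h1, h2]

/-- The normalized monomial of a multiset of basis elements. -/
noncomputable def mmon (m : Multiset V) : GSym 𝒜 𝒩 :=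
  Quotient.liftOn m (lmon b) fun _ _ h => lmon_perm b h

theorem mmon_cons (v : V) (m : Multiset V) :
    GSym.ofMod 𝒜 𝒩 (b.basis v) * mmon b m = chi dv v m • mmon b (v ::ₘ m) := by
  induction m using Quotient.inductionOn with
  | h l =>
    change _ = chi dv v l • lmon b (v :: l)
    rw [lmon_cons, smul_smul, Int.units_mul_self, one_smul]
    rfl

theorem ofMod_sq [CharZero K] {v : V} (hv : dv v ⬝ᵥ dv v = 1) :
    GSym.ofMod 𝒜 𝒩 (b.basis v) * GSym.ofMod 𝒜 𝒩 (b.basis v) = 0 := by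
  have h := GSym.gcomm_ofMod (𝒜 := 𝒜) (b.mem v) (b.mem v)
  rw [GComm, ksign_self_of_odd hv, Units.neg_smul, one_smul, eq_neg_iff_add_eq_zero, ← two_smul K,
    smul_eq_zero_iff_right two_ne_zero] at h
  exact h

/-- An odd variable squares to zero because two is invertible. The model thus has superfluous
multisets, those repeating an odd variable; the homotopy formula is later proved away from them, on
`reducedPart`. -/
theorem mmon_eq_zero [CharZero K] {v : V} (hv : dv v ⬝ᵥ dv v = 1) {m : Multiset V} (hm : v ∈ m) :
    mmon b (v ::ₘ m) = 0 := by
  obtain ⟨m', rfl⟩ := Multiset.exists_cons_of_mem hm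
  have h : GSym.ofMod 𝒜 𝒩 (b.basis v) * (GSym.ofMod 𝒜 𝒩 (b.basis v) * mmon b m') = 0 := by
    rw [← mul_assoc, ofMod_sq b hv, zero_mul]
  rw [mmon_cons, mul_smul_comm, mmon_cons, smul_smul, ← sgnK_smul (K := K)] at h
  have h2 := congrArg (fun x => sgnK K (chi dv v m' * chi dv v (v ::ₘ m')) • x) h
  simpa only [smul_smul, sgnK_mul_self, one_smul, smul_zero] using h2

theorem ofMod_mul_mmon [CharZero K] (v : V) (m : Multiset V) :
    GSym.ofMod 𝒜 𝒩 (b.basis v) * mmon b m = (mulCoeff dv v m : K) • mmon b (v ::ₘ m) := by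
  rw [mulCoeff, mmon_cons]
  split_ifs with h
  · rw [mmon_eq_zero b h.1 h.2, smul_zero, smul_zero]
  · rw [sgnK_smul]

/-- The `A`-linear map from the model to `S_A(N)`. -/
noncomputable def ofModel : (Multiset V →₀ A) →ₗ[A] GSym 𝒜 𝒩 :=
  Finsupp.lsum ℕ fun m => LinearMap.toSpanSingleton A _ (mmon b m)

theorem ofModel_single (m : Multiset V) (c : A) :
    ofModel b (Finsupp.single m c) = c • mmon b m := by
  simp [ofModel]

/-- The claim is stable under sums and products in `s`, so generators suffice, and for these the
coefficients of the model were chosen to match `ofMod_mul_mmon`. -/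
theorem ofModel_act [CharZero K] (s : GSym 𝒜 𝒩) :
    ∀ f, ofModel b (act b s f) = s * ofModel b f := by
  have hadd : ∀ s : GSym 𝒜 𝒩, (∀ m c, ofModel b (act b s (Finsupp.single m c)) =
      s * ofModel b (Finsupp.single m c)) → ∀ f, ofModel b (act b s f) = s * ofModel b f := by
    intro s hs f
    induction f using Finsupp.induction_linear with
    | zero => simp
    | add f g hf hg => rw [map_add, map_add, map_add, mul_add, hf, hg]
    | single m c => exact hs m c
  induction s using GSym.induction with
  | alg a =>
    refine hadd _ fun m c => ?_
    rw [act_ofAlg, mL_single, ofModel_single, ofModel_single, GSym.smul_eq, GSym.smul_eq, map_mul,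
      mul_assoc]
  | mod x =>
    have hx : GSym.ofMod 𝒜 𝒩 x =
        ∑ v, GSym.ofAlg 𝒜 𝒩 (b.basis.repr x v) * GSym.ofMod 𝒜 𝒩 (b.basis v) := by
      conv_lhs => rw [← b.basis.sum_repr x, GSym.ofMod_sum]
      simp only [GSym.ofMod_smul]
    refine hadd _ fun m c => ?_
    rw [hx, map_sum, Finset.sum_mul, LinearMap.sum_apply, map_sum]
    refine Finset.sum_congr rfl fun v _ => ?_
    rw [map_mul, act_ofAlg, act_ofMod_basis, Module.End.mul_apply, mX_single, mL_single,
      ofModel_single, ofModel_single, GSym.smul_eq, map_mul, GSym.smul_eq, mul_assoc, mul_assoc]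
    congr 1
    rw [← mul_assoc, GSym.ofMod_mul_ofAlg 𝒜 𝒩 (b.mem v), mul_assoc, ofMod_mul_mmon,
      ← GSym.smul_eq, ← GSym.smul_eq, smul_assoc]
    exact (mul_smul_comm _ _ _).symm
  | mul s t hs ht =>
    intro f
    rw [map_mul, Module.End.mul_apply, hs, ht, mul_assoc]
  | add s t hs ht =>
    intro f
    rw [map_add, LinearMap.add_apply, map_add, hs, ht, add_mul]

/-- The `A`-linear map from `S_A(N)` to its model. -/
noncomputable def toModel : GSym 𝒜 𝒩 →ₗ[A] (Multiset V →₀ A) where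
  toFun s := act b s (Finsupp.single 0 1)
  map_add' s t := by rw [map_add, LinearMap.add_apply]
  map_smul' a s := by
    rw [GSym.smul_eq, map_mul, act_ofAlg]
    rfl

theorem toModel_apply (s : GSym 𝒜 𝒩) : toModel b s = act b s (Finsupp.single 0 1) := rfl

/-- Acting on the empty monomial and mapping back multiplies `s` by one. Elements of `S_A(N)` are
therefore determined by their coordinates in the model. -/
theorem ofModel_toModel [CharZero K] (s : GSym 𝒜 𝒩) : ofModel b (toModel b s) = s := by
  rw [toModel_apply, ofModel_act, ofModel_single, one_smul]
  have h : mmon b 0 = 1 := by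
    change lmon b [] = 1
    simp [lmon, lsign]
  rw [h, mul_one]

theorem toModel_mul (s t : GSym 𝒜 𝒩) : toModel b (s * t) = act b s (toModel b t) := by
  rw [toModel_apply, map_mul]
  rfl

end Model

/-! ### The basis of `Π M ⊕ M^*` -/

section KoszulBasis

variable {K A : Type*} {n : ℕ} [Field K] [Ring A] [Algebra K A]
  {𝒜 : Grp n → Submodule K A} [GradedAlgebra 𝒜] [IsGradedComm 𝒜]
  {M : Type*} [AddCommGroup M] [Module K M] [Module A M] [IsScalarTower K A M]
  {ℳ : Grp n → Submodule K M} [DirectSum.Decomposition ℳ] [SetLike.GradedSMul 𝒜 ℳ]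
  {ι : Type*} [Fintype ι] [DecidableEq ι] {deg : ι → Grp n} (π : Grp n) (e : HomBasis A ℳ deg)

variable (𝒜) in
/-- The basis `Π e_i` of `Π M`. -/
noncomputable def shiftBasis : Module.Basis ι A (Shift 𝒜 π M) := Module.Basis.ofEquivFun
  { toFun := fun m i => signAut 𝒜 π (e.1.repr ((toShift 𝒜 π M).symm m) i)
    map_add' := fun x y => by
      funext i
      rw [map_add, map_add, Finsupp.add_apply, map_add]
      rfl
    map_smul' := fun a x => by
      funext i
      change signAut 𝒜 π (e.1.repr (signAut 𝒜 π a • (toShift 𝒜 π M).symm x) i) = _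
      rw [map_smul, Finsupp.smul_apply, smul_eq_mul, map_mul, signAut_signAut]
      rfl
    invFun := fun c => toShift 𝒜 π M (∑ i, signAut 𝒜 π (c i) • e.1 i)
    left_inv := fun m => by
      simp only [signAut_signAut, e.1.sum_repr]
      rfl
    right_inv := fun c => by
      funext i
      change signAut 𝒜 π (e.1.repr (∑ i, signAut 𝒜 π (c i) • e.1 i) i) = c i
      rw [congrFun (e.1.repr_sum_self fun i => signAut 𝒜 π (c i)) i, signAut_signAut] }

theorem shiftBasis_apply (i : ι) : shiftBasis 𝒜 π e i = toShift 𝒜 π M (e.1 i) := by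
  rw [shiftBasis, Module.Basis.coe_ofEquivFun]
  change toShift 𝒜 π M (∑ j, signAut 𝒜 π ((Pi.single i 1 : ι → A) j) • e.1 j) = _
  congr 1
  rw [Finset.sum_eq_single i]
  · simp
  · intro j _ hj
    rw [Pi.single_eq_of_ne hj, map_zero, zero_smul]
  · simp

theorem shiftBasis_repr (m : Shift 𝒜 π M) (i : ι) :
    (shiftBasis 𝒜 π e).repr m i = signAut 𝒜 π (e.1.repr ((toShift 𝒜 π M).symm m) i) := rfl

theorem dual_apply_smul (ℓ : Dual 𝒜 ℳ) {β : Grp n} {m : M} (hm : m ∈ ℳ β) (a : A) :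
    (ℓ : M →ₗ[K] A) (a • m) = (ℓ : M →ₗ[K] A) m * signAut 𝒜 β a := by
  induction a using DirectSum.Decomposition.inductionOn 𝒜 with
  | zero => simp
  | add a b ha hb => rw [add_smul, map_add, map_add, ha, hb, mul_add]
  | @homogeneous α a =>
    have h := ℓ.2 α β a m a.2 hm
    rw [signAut_of_mem 𝒜 β a.2, mul_smul_comm, ← h, Units.smul_def, Units.smul_def, map_zsmul,
      ← Units.smul_def, ← Units.smul_def, smul_smul, ksign_comm, ksign_mul_self, one_smul]

theorem dual_ext {ℓ ℓ' : Dual 𝒜 ℳ}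
    (h : ∀ i, (ℓ : M →ₗ[K] A) (e.1 i) = (ℓ' : M →ₗ[K] A) (e.1 i)) : ℓ = ℓ' := by
  apply Subtype.ext
  apply LinearMap.ext
  intro m
  rw [← e.1.sum_repr m, map_sum, map_sum]
  refine Finset.sum_congr rfl fun i _ => ?_
  rw [dual_apply_smul ℓ (e.2 i), dual_apply_smul ℓ' (e.2 i), h]

theorem sum_smul_dualBasis_apply (c : ι → A) (i : ι) :
    ((∑ j, c j • dualBasis 𝒜 e j : Dual 𝒜 ℳ) : M →ₗ[K] A) (e.1 i) = c i := by
  rw [Submodule.coe_sum, LinearMap.sum_apply, Finset.sum_eq_single i]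
  · rw [Submodule.coe_smul, LinearMap.smul_apply, dualBasis_apply_self, if_pos rfl, smul_eq_mul,
      mul_one]
  · intro j _ hj
    rw [Submodule.coe_smul, LinearMap.smul_apply, dualBasis_apply_self, if_neg hj, smul_zero]
  · simp

theorem sum_apply_smul_dualBasis (ℓ : Dual 𝒜 ℳ) :
    ∑ j, (ℓ : M →ₗ[K] A) (e.1 j) • dualBasis 𝒜 e j = ℓ :=
  dual_ext e fun i => sum_smul_dualBasis_apply e _ i

/-- The basis `ε^i` of `M^*`. -/
noncomputable def dBasis : Module.Basis ι A (Dual 𝒜 ℳ) := Module.Basis.ofEquivFun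
  { toFun := fun ℓ i => (ℓ : M →ₗ[K] A) (e.1 i)
    map_add' := fun _ _ => rfl
    map_smul' := fun _ _ => rfl
    invFun := fun c => ∑ j, c j • dualBasis 𝒜 e j
    left_inv := fun ℓ => sum_apply_smul_dualBasis e ℓ
    right_inv := fun c => funext fun i => sum_smul_dualBasis_apply e c i }

theorem dBasis_apply (i : ι) : dBasis (𝒜 := 𝒜) e i = dualBasis 𝒜 e i := by
  rw [dBasis, Module.Basis.coe_ofEquivFun]
  change ∑ j, (Pi.single i 1 : ι → A) j • dualBasis 𝒜 e j = _
  rw [Finset.sum_eq_single i]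
  · simp
  · intro j _ hj
    rw [Pi.single_eq_of_ne hj, zero_smul]
  · simp

theorem dBasis_repr (ℓ : Dual 𝒜 ℳ) (i : ι) :
    (dBasis e).repr ℓ i = (ℓ : M →ₗ[K] A) (e.1 i) := rfl

/-- The degrees of `Π e_i` and of `ε^i`. -/
def kdeg (deg : ι → Grp n) (π : Grp n) : ι ⊕ ι → Grp n
  | Sum.inl i => deg i + π
  | Sum.inr i => deg i

variable (𝒜) in
/-- The basis of `Π M ⊕ M^*` that consists of the `Π e_i` and the `ε^i`. -/
noncomputable def kBasis : AdaptedBasis (N := Shift 𝒜 π M × Dual 𝒜 ℳ) 𝒜 (koszulModGrading 𝒜 ℳ π) (kdeg deg π) where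
  basis := (shiftBasis 𝒜 π e).prod (dBasis e)
  mem v := by
    rcases v with i | i
    · rw [Module.Basis.prod_apply]
      refine ⟨⟨e.1 i, ?_, ?_⟩, ?_⟩
      · simp only [kdeg, SetLike.mem_coe, grp_add_add_cancel_right]
        exact e.2 i
      · simp [shiftBasis_apply]
      · simp
    · rw [Module.Basis.prod_apply]
      refine ⟨?_, ?_⟩
      · simp
      · simpa [dBasis_apply, kdeg] using dualBasis_mem 𝒜 e i
  repr_mem {β x} hx v := by
    obtain ⟨m, ℓ⟩ := x
    obtain ⟨⟨m', hm, hmm⟩, hℓ⟩ := hx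
    rcases v with i | i
    · rw [Module.Basis.prod_repr_inl, shiftBasis_repr]
      simp only at hmm
      rw [← hmm]
      have h := repr_mem 𝒜 e hm i
      rw [add_assoc, add_comm π] at h
      exact signAut_mem 𝒜 h
    · rw [Module.Basis.prod_repr_inr, dBasis_repr]
      have h := hℓ (deg i) (e.1 i) (e.2 i)
      rwa [add_comm] at h

theorem ofMod_kBasis_inl {p q : ℕ} {deg : Fin p ⊕ Fin q → Grp n} (e : HomBasis A ℳ deg)
    (i : Fin p ⊕ Fin q) :
    GSym.ofMod 𝒜 _ ((kBasis 𝒜 π e).basis (Sum.inl i)) = kShift 𝒜 ℳ π (e.1 i) := by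
  rw [kBasis, Module.Basis.prod_apply, kShift]
  simp [shiftBasis_apply]

theorem ofMod_kBasis_inr {p q : ℕ} {deg : Fin p ⊕ Fin q → Grp n} (e : HomBasis A ℳ deg)
    (i : Fin p ⊕ Fin q) :
    GSym.ofMod 𝒜 _ ((kBasis 𝒜 π e).basis (Sum.inr i)) = kDual 𝒜 π (dualBasis 𝒜 e i) := by
  rw [kBasis, Module.Basis.prod_apply, kDual]
  simp [dBasis_apply]

end KoszulBasis

/-! ### The contracting homotopy of the Koszul complex -/

section Homotopy

variable {K A : Type*} {n : ℕ} [Field K] [Ring A] [Algebra K A]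
  (𝒜 : Grp n → Submodule K A) [GradedAlgebra 𝒜]
  {ι : Type*} [Fintype ι] [DecidableEq ι] (deg : ι → Grp n) (π : Grp n)

/-- The odd one of the two variables with index `i`. -/
def od (i : ι) : ι ⊕ ι := if deg i ⬝ᵥ deg i = 0 then Sum.inl i else Sum.inr i

/-- The even one of the two variables with index `i`. -/
def ev (i : ι) : ι ⊕ ι := if deg i ⬝ᵥ deg i = 0 then Sum.inr i else Sum.inl i

theorem zmod_two_cases (z : ZMod 2) : z = 0 ∨ z = 1 := by
  revert z
  decide

variable {π}

theorem parity_inl (hπ : π ⬝ᵥ π = 1) (i : ι) :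
    kdeg deg π (Sum.inl i) ⬝ᵥ kdeg deg π (Sum.inl i) = 1 ↔ deg i ⬝ᵥ deg i = 0 := by
  rw [kdeg, dotProduct_add_self, hπ]
  rcases zmod_two_cases (deg i ⬝ᵥ deg i) with h | h <;> rw [h] <;> decide

theorem parity_inr (i : ι) :
    kdeg deg π (Sum.inr i) ⬝ᵥ kdeg deg π (Sum.inr i) = 1 ↔ ¬ deg i ⬝ᵥ deg i = 0 := by
  rw [kdeg]
  rcases zmod_two_cases (deg i ⬝ᵥ deg i) with h | h <;> rw [h] <;> decide

theorem od_odd (hπ : π ⬝ᵥ π = 1) (i : ι) :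
    kdeg deg π (od deg i) ⬝ᵥ kdeg deg π (od deg i) = 1 := by
  rw [od]
  split_ifs with h
  · exact (parity_inl deg hπ i).mpr h
  · exact (parity_inr deg i).mpr h

theorem od_injective : Function.Injective (od deg) := by
  intro i j h
  rw [od, od] at h
  split_ifs at h <;> simpa using h

theorem ev_injective : Function.Injective (ev deg) := by
  intro i j h
  rw [ev, ev] at h
  split_ifs at h <;> simpa using h

theorem ev_ne_od (i j : ι) : ev deg i ≠ od deg j := by
  intro h
  have hij : i = j := by
    rw [od, ev] at h
    split_ifs at h <;> simpa using h
  subst hij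
  rw [od, ev] at h
  split_ifs at h

theorem eq_od_or_eq_ev (v : ι ⊕ ι) : ∃ i, v = od deg i ∨ v = ev deg i := by
  rcases v with i | i <;> refine ⟨i, ?_⟩ <;> rw [od, ev] <;> split_ifs <;> simp

theorem pair_cons (i : ι) (m : Multiset (ι ⊕ ι)) :
    (Sum.inl i : ι ⊕ ι) ::ₘ Sum.inr i ::ₘ m = od deg i ::ₘ ev deg i ::ₘ m := by
  rw [od, ev]
  split_ifs
  · rfl
  · rw [Multiset.cons_swap]

theorem erase_pair (i : ι) (m : Multiset (ι ⊕ ι)) :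
    (((Sum.inl i : ι ⊕ ι) ::ₘ Sum.inr i ::ₘ m).erase (Sum.inr i)).erase (Sum.inl i) = m := by
  rw [Multiset.cons_swap, Multiset.erase_cons_head, Multiset.erase_cons_head]

variable (π)

/-- The sign of multiplication by a pair of variables with the same index. -/
noncomputable def pchi (i : ι) (m : Multiset (ι ⊕ ι)) : ℤˣ :=
  chi (kdeg deg π) (Sum.inl i) m * chi (kdeg deg π) (Sum.inr i) m

theorem pchi_cons (i : ι) (v : ι ⊕ ι) (m : Multiset (ι ⊕ ι)) :
    pchi deg π i (v ::ₘ m) =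
      vs (kdeg deg π) (Sum.inl i) v * vs (kdeg deg π) (Sum.inr i) v * pchi deg π i m := by
  rw [pchi, pchi, chi_cons, chi_cons, mul_mul_mul_comm]

variable {π} in
-- Passing one pair of variables across another costs four signs. The degrees within a pair add up
-- to `π`, so their product is `ksign π π = -1`. The factors from `m` and `m'` occur equally on both
-- sides.
theorem pchi_swap (hπ : π ⬝ᵥ π = 1) {i j : ι} (hij : i ≠ j) (m m' : Multiset (ι ⊕ ι)) :
    pchi deg π i (Sum.inl j ::ₘ Sum.inr j ::ₘ m) * pchi deg π j m' =
      -(pchi deg π j (Sum.inl i ::ₘ Sum.inr i ::ₘ m') * pchi deg π i m) := by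
  have hll : (Sum.inl i : ι ⊕ ι) ≠ Sum.inl j := fun h => hij (Sum.inl_injective h)
  have hrr : (Sum.inr i : ι ⊕ ι) ≠ Sum.inr j := fun h => hij (Sum.inr_injective h)
  simp only [pchi_cons]
  rw [vs_swap _ hll, vs_swap _ hrr, vs_swap _ (Sum.inl_ne_inr : (Sum.inl i : ι ⊕ ι) ≠ Sum.inr j),
    vs_swap _ (Sum.inr_ne_inl : (Sum.inr i : ι ⊕ ι) ≠ Sum.inl j)]
  have hk : ksign (kdeg deg π (Sum.inl i)) (kdeg deg π (Sum.inl j)) *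
      ksign (kdeg deg π (Sum.inl i)) (kdeg deg π (Sum.inr j)) *
      (ksign (kdeg deg π (Sum.inr i)) (kdeg deg π (Sum.inl j)) *
      ksign (kdeg deg π (Sum.inr i)) (kdeg deg π (Sum.inr j))) = -1 := by
    rw [← ksign_add_right, ← ksign_add_right, ← ksign_add_left]
    have h : ∀ i, kdeg deg π (Sum.inl i) + kdeg deg π (Sum.inr i) = π := fun i => by
      rw [kdeg, kdeg, add_comm, ← add_assoc, grp_add_self, zero_add]
    rw [add_comm (kdeg deg π (Sum.inl j)), add_comm (kdeg deg π (Sum.inr j)), h, h,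
      ksign_self_of_odd hπ]
  generalize ksign (kdeg deg π (Sum.inl i)) (kdeg deg π (Sum.inl j)) = k1 at *
  generalize ksign (kdeg deg π (Sum.inl i)) (kdeg deg π (Sum.inr j)) = k2 at *
  generalize ksign (kdeg deg π (Sum.inr i)) (kdeg deg π (Sum.inl j)) = k3 at *
  generalize ksign (kdeg deg π (Sum.inr i)) (kdeg deg π (Sum.inr j)) = k4 at *
  rw [← neg_one_mul, ← hk]
  ac_rfl

/-- The coefficient of the `i`-th summand of the differential. -/
noncomputable def dCoeff (i : ι) (m : Multiset (ι ⊕ ι)) : K :=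
  if od deg i ∈ m then 0
  else sgnK K (vs (kdeg deg π) (Sum.inl i) (Sum.inr i) * pchi deg π i m)

variable {π} in
-- Exactly one variable of the pair is odd, and the product vanishes precisely if that one already
-- occurs.
theorem dSummand_single (hπ : π ⬝ᵥ π = 1) (i : ι) (m : Multiset (ι ⊕ ι)) (c : A) :
    (mX 𝒜 (kdeg deg π) (Sum.inl i) * mX 𝒜 (kdeg deg π) (Sum.inr i)) (Finsupp.single m c) =
      Finsupp.single (Sum.inl i ::ₘ Sum.inr i ::ₘ m)
        ((dCoeff deg π i m : K) • signAut 𝒜 π c) := by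
  rw [Module.End.mul_apply, mX_single, mX_single, signAut_smul, ← signAut_add, smul_smul]
  congr 2
  · simp only [mulCoeff, dCoeff, parity_inl deg hπ, parity_inr, od, chi_cons, Multiset.mem_cons,
      reduceCtorEq, false_or]
    by_cases h : deg i ⬝ᵥ deg i = 0 <;> simp [h, pchi, mul_assoc]
  · congr 1
    rw [kdeg, kdeg, add_right_comm, grp_add_self, zero_add]

/-- The `i`-th summand of the homotopy. -/
noncomputable def hOp (i : ι) : Module.End K (Multiset (ι ⊕ ι) →₀ A) :=
  sop 𝒜 π (fun m => (m.erase (Sum.inr i)).erase (Sum.inl i)) fun m =>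
    if od deg i ∈ m then (m.count (ev deg i) : K) *
      sgnK K (vs (kdeg deg π) (Sum.inl i) (Sum.inr i) *
        pchi deg π i ((m.erase (Sum.inr i)).erase (Sum.inl i))) else 0

/-- Up to sign the operator differentiates in both variables of index `i`, so the exponent of the
even one appears as a factor; the pair raises that exponent by one. -/
theorem hOp_pair (i : ι) (m : Multiset (ι ⊕ ι)) (c : A) :
    hOp (K := K) 𝒜 deg π i (Finsupp.single (Sum.inl i ::ₘ Sum.inr i ::ₘ m) c) =
      Finsupp.single m ((((m.count (ev deg i) + 1 : ℕ) : K) *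
        sgnK K (vs (kdeg deg π) (Sum.inl i) (Sum.inr i) * pchi deg π i m)) • signAut 𝒜 π c) := by
  rw [hOp, sop_single, erase_pair, pair_cons deg, if_pos (Multiset.mem_cons_self _ _),
    Multiset.count_cons_of_ne (ev_ne_od deg i i), Multiset.count_cons_self]

theorem hOp_of_od_notMem {i : ι} {m : Multiset (ι ⊕ ι)} (h : od deg i ∉ m) (c : A) :
    hOp (K := K) 𝒜 deg π i (Finsupp.single m c) = 0 := by
  rw [hOp, sop_single, if_neg h, zero_smul, Finsupp.single_zero]

/-- Here `erase` does not remove the absent even variable, but the coefficient, its multiplicity, is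
zero. -/
theorem hOp_of_ev_notMem {i : ι} {m : Multiset (ι ⊕ ι)} (h : ev deg i ∉ m) (c : A) :
    hOp (K := K) 𝒜 deg π i (Finsupp.single m c) = 0 := by
  rw [hOp, sop_single, Multiset.count_eq_zero_of_notMem h, Nat.cast_zero, zero_mul, ite_self,
    zero_smul, Finsupp.single_zero]

theorem exists_pair {i : ι} {m : Multiset (ι ⊕ ι)} (h : od deg i ∈ m) (h' : ev deg i ∈ m) :
    ∃ m', m = Sum.inl i ::ₘ Sum.inr i ::ₘ m' := by
  obtain ⟨m', rfl⟩ := Multiset.exists_cons_of_mem h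
  have h2 := (Multiset.mem_cons.mp h').resolve_left (ev_ne_od deg i i)
  obtain ⟨m'', rfl⟩ := Multiset.exists_cons_of_mem h2
  exact ⟨m'', (pair_cons deg i m'').symm⟩

/-- The multisets in which odd variables have multiplicity at most one. -/
def Reduced (m : Multiset (ι ⊕ ι)) : Prop := ∀ i, m.count (od deg i) ≤ 1

/-- The `i`-th part of the weight. -/
def wt (i : ι) (m : Multiset (ι ⊕ ι)) : ℕ :=
  m.count (ev deg i) + if od deg i ∈ m then 0 else 1

variable {π}

/-- Let `k` be the exponent of the even variable. If the odd variable is present, only the first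
term contributes, with factor `k`; if it is absent, only the second does, with factor `k + 1`. The
sign occurs twice and disappears. -/
theorem homotopy_diag (hπ : π ⬝ᵥ π = 1) (i : ι) {m : Multiset (ι ⊕ ι)} (hm : Reduced deg m)
    (c : A) :
    (mX 𝒜 (kdeg deg π) (Sum.inl i) * mX 𝒜 (kdeg deg π) (Sum.inr i))
        (hOp (K := K) 𝒜 deg π i (Finsupp.single m c)) +
      hOp 𝒜 deg π i ((mX 𝒜 (kdeg deg π) (Sum.inl i) * mX 𝒜 (kdeg deg π) (Sum.inr i))
        (Finsupp.single m c)) = (wt deg i m : K) • Finsupp.single m c := by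
  by_cases ho : od deg i ∈ m
  · rw [dSummand_single 𝒜 deg hπ, dCoeff, if_pos ho, zero_smul, Finsupp.single_zero, map_zero,
      add_zero, wt, if_pos ho, add_zero]
    by_cases he : ev deg i ∈ m
    · obtain ⟨m', rfl⟩ := exists_pair deg ho he
      -- The odd variable has multiplicity one, so it is gone once the pair is removed and the pair
      -- can be multiplied back in.
      have ho' : od deg i ∉ m' := by
        have h := hm i
        rw [pair_cons deg, Multiset.count_cons_self] at h
        intro h2
        have h3 := Multiset.one_le_count_iff_mem.mpr (Multiset.mem_cons_of_mem (b := ev deg i) h2)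
        omega
      have hcount : Multiset.count (ev deg i) (Sum.inl i ::ₘ Sum.inr i ::ₘ m') =
          m'.count (ev deg i) + 1 := by
        rw [pair_cons deg, Multiset.count_cons_of_ne (ev_ne_od deg i i), Multiset.count_cons_self]
      rw [hOp_pair, dSummand_single 𝒜 deg hπ, dCoeff, if_neg ho', signAut_smul, signAut_signAut,
        smul_smul, Finsupp.smul_single, hcount, mul_left_comm, sgnK_mul_self, mul_one]
    · rw [hOp_of_ev_notMem 𝒜 deg π he, map_zero, Multiset.count_eq_zero_of_notMem he,
        Nat.cast_zero, zero_smul]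
  · rw [hOp_of_od_notMem 𝒜 deg π ho, map_zero, zero_add, dSummand_single 𝒜 deg hπ, dCoeff,
      if_neg ho, hOp_pair, signAut_smul, signAut_signAut, smul_smul, mul_assoc, sgnK_mul_self,
      mul_one, wt, if_neg ho, Finsupp.smul_single]

/-- A pair of index `i` does not change the multiplicities at index `j`, so the two terms differ
only by the sign in `pchi_swap`. -/
theorem homotopy_off_diag (hπ : π ⬝ᵥ π = 1) {i j : ι} (hij : i ≠ j) (m : Multiset (ι ⊕ ι))
    (c : A) :
    (mX 𝒜 (kdeg deg π) (Sum.inl i) * mX 𝒜 (kdeg deg π) (Sum.inr i))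
        (hOp (K := K) 𝒜 deg π j (Finsupp.single m c)) +
      hOp 𝒜 deg π j ((mX 𝒜 (kdeg deg π) (Sum.inl i) * mX 𝒜 (kdeg deg π) (Sum.inr i))
        (Finsupp.single m c)) = 0 := by
  have hoo : od deg i ≠ od deg j := fun h => hij (od_injective deg h)
  have hee : ev deg i ≠ ev deg j := fun h => hij (ev_injective deg h)
  by_cases ho : od deg j ∈ m
  · by_cases he : ev deg j ∈ m
    · obtain ⟨m', rfl⟩ := exists_pair deg ho he
      have hswap : (Sum.inl i : ι ⊕ ι) ::ₘ Sum.inr i ::ₘ Sum.inl j ::ₘ Sum.inr j ::ₘ m' =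
          Sum.inl j ::ₘ Sum.inr j ::ₘ Sum.inl i ::ₘ Sum.inr i ::ₘ m' := by
        rw [Multiset.cons_swap (Sum.inr i), Multiset.cons_swap (Sum.inl i),
          Multiset.cons_swap (Sum.inr i), Multiset.cons_swap (Sum.inl i)]
      rw [dSummand_single 𝒜 deg hπ, hswap, hOp_pair, hOp_pair, dSummand_single 𝒜 deg hπ,
        ← Finsupp.single_add, signAut_smul, signAut_smul, smul_smul, smul_smul, ← add_smul]
      have h1 : (od deg i ∈ (Sum.inl j ::ₘ Sum.inr j ::ₘ m' : Multiset (ι ⊕ ι))) ↔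
          od deg i ∈ m' := by
        rw [pair_cons deg, Multiset.mem_cons, Multiset.mem_cons]
        simp [hoo, (ev_ne_od deg j i).symm]
      have h2 : Multiset.count (ev deg j) (Sum.inl i ::ₘ Sum.inr i ::ₘ m') =
          Multiset.count (ev deg j) m' := by
        rw [pair_cons deg, Multiset.count_cons_of_ne (ev_ne_od deg j i),
          Multiset.count_cons_of_ne hee.symm]
      have h3 : (dCoeff deg π i m' * (((m'.count (ev deg j) + 1 : ℕ) : K) *
            sgnK K (vs (kdeg deg π) (Sum.inl j) (Sum.inr j) * pchi deg π j m'))) +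
          (((Multiset.count (ev deg j) (Sum.inl i ::ₘ Sum.inr i ::ₘ m') + 1 : ℕ) : K) *
            sgnK K (vs (kdeg deg π) (Sum.inl j) (Sum.inr j) *
              pchi deg π j (Sum.inl i ::ₘ Sum.inr i ::ₘ m'))) *
            dCoeff deg π i (Sum.inl j ::ₘ Sum.inr j ::ₘ m') = 0 := by
        rw [h2, dCoeff, dCoeff]
        simp only [h1]
        split_ifs
        · simp
        · have h4 := congrArg (sgnK K) (pchi_swap deg hπ hij m' m')
          rw [← neg_one_mul, map_mul, map_mul, map_mul, sgnK_neg_one] at h4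
          have h5 : sgnK K (pchi deg π j m') * sgnK K (pchi deg π j m') = 1 := sgnK_mul_self _
          have h7 : sgnK K (pchi deg π j (Sum.inl i ::ₘ Sum.inr i ::ₘ m')) *
            sgnK K (pchi deg π j (Sum.inl i ::ₘ Sum.inr i ::ₘ m')) = 1 := sgnK_mul_self _
          simp only [map_mul]
          generalize sgnK K (pchi deg π i m') = b at *
          generalize sgnK K (pchi deg π j m') = d at *
          generalize sgnK K (pchi deg π j (Sum.inl i ::ₘ Sum.inr i ::ₘ m')) = f at *
          generalize sgnK K (pchi deg π i (Sum.inl j ::ₘ Sum.inr j ::ₘ m')) = g at *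
          generalize sgnK K (vs (kdeg deg π) (Sum.inl i) (Sum.inr i)) = x
          generalize sgnK K (vs (kdeg deg π) (Sum.inl j) (Sum.inr j)) = y
          generalize ((Multiset.count (ev deg j) m' + 1 : ℕ) : K) = z
          -- This is `h4` multiplied by `f * d`, with the squares of `d` and `f` replaced by one.
          linear_combination x * y * z * (f * d * h4 - f * g * h5 - b * d * h7)
      rw [h3, zero_smul, Finsupp.single_zero]
    · have he' : ev deg j ∉ (Sum.inl i ::ₘ Sum.inr i ::ₘ m : Multiset (ι ⊕ ι)) := by
        rw [pair_cons deg, Multiset.mem_cons, Multiset.mem_cons]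
        simp [he, hee.symm, ev_ne_od deg j i]
      rw [hOp_of_ev_notMem 𝒜 deg π he, map_zero, dSummand_single 𝒜 deg hπ,
        hOp_of_ev_notMem 𝒜 deg π he', zero_add]
  · have ho' : od deg j ∉ (Sum.inl i ::ₘ Sum.inr i ::ₘ m : Multiset (ι ⊕ ι)) := by
      rw [pair_cons deg, Multiset.mem_cons, Multiset.mem_cons]
      simp [ho, hoo.symm, (ev_ne_od deg i j).symm]
    rw [hOp_of_od_notMem 𝒜 deg π ho, map_zero, dSummand_single 𝒜 deg hπ,
      hOp_of_od_notMem 𝒜 deg π ho', zero_add]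

end Homotopy

/-! ### Cohomology of the Koszul differential on the model -/

section Acyclicity

variable {K A : Type*} {n : ℕ} [Field K] [Ring A] [Algebra K A]
  (𝒜 : Grp n → Submodule K A) [GradedAlgebra 𝒜]
  {ι : Type*} [Fintype ι] [DecidableEq ι] (deg : ι → Grp n) (π : Grp n)

/-- The differential on the model. -/
noncomputable def dModel : Module.End K (Multiset (ι ⊕ ι) →₀ A) :=
  ∑ i, mX 𝒜 (kdeg deg π) (Sum.inl i) * mX 𝒜 (kdeg deg π) (Sum.inr i)

/-- The total weight. -/
def weight (m : Multiset (ι ⊕ ι)) : ℕ := ∑ i, wt deg i m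

/-- The monomial `ξ_1 ⋯ ξ_r`. -/
def topMon : Multiset (ι ⊕ ι) := Finset.univ.val.map (od deg)

theorem count_od_topMon (i : ι) : (topMon deg).count (od deg i) = 1 := by
  rw [topMon, Multiset.count_map_eq_count' _ _ (od_injective deg)]
  exact Multiset.count_univ i

theorem ev_notMem_topMon (i : ι) : ev deg i ∉ topMon deg := by
  rw [topMon, Multiset.mem_map]
  rintro ⟨j, _, h⟩
  exact ev_ne_od deg i j h.symm

theorem eq_topMon_of_weight_eq_zero {m : Multiset (ι ⊕ ι)} (hm : Reduced deg m)
    (h : weight deg m = 0) : m = topMon deg := by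
  rw [weight, Finset.sum_eq_zero_iff] at h
  ext v
  obtain ⟨i, rfl | rfl⟩ := eq_od_or_eq_ev deg v
  · have h1 := h i (Finset.mem_univ _)
    have h2 : od deg i ∈ m := by
      by_contra h3
      rw [wt, if_neg h3] at h1
      omega
    have h3 := Multiset.one_le_count_iff_mem.mpr h2
    rw [count_od_topMon]
    exact le_antisymm (hm i) h3
  · have h1 := h i (Finset.mem_univ _)
    rw [Multiset.count_eq_zero_of_notMem (ev_notMem_topMon deg i)]
    rw [wt] at h1
    omega

theorem weight_topMon : weight deg (topMon deg) = 0 := by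
  refine Finset.sum_eq_zero fun i _ => ?_
  rw [wt, Multiset.count_eq_zero_of_notMem (ev_notMem_topMon deg i),
    if_pos (Multiset.one_le_count_iff_mem.mp (count_od_topMon deg i).ge), add_zero]

/-- The new even variable raises the weight by one and the new odd variable lowers it by one. Hence
the differential is compatible with division by the weight. -/
theorem weight_pair {i : ι} {m : Multiset (ι ⊕ ι)} (h : od deg i ∉ m) :
    weight deg (Sum.inl i ::ₘ Sum.inr i ::ₘ m) = weight deg m := by
  refine Finset.sum_congr rfl fun j _ => ?_
  rw [pair_cons deg, wt, wt, Multiset.count_cons_of_ne (ev_ne_od deg j i)]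
  by_cases hij : j = i
  · subst hij
    rw [Multiset.count_cons_self, if_pos (Multiset.mem_cons_self _ _), if_neg h]
  · have h1 : ev deg j ≠ ev deg i := fun h => hij (ev_injective deg h)
    have h2 : od deg j ≠ od deg i := fun h => hij (od_injective deg h)
    rw [Multiset.count_cons_of_ne h1]
    congr 1
    simp [h2, (ev_ne_od deg i j).symm]

/-- The homotopy, normalized by the weight. -/
noncomputable def hModel : Module.End K (Multiset (ι ⊕ ι) →₀ A) :=
  (∑ i, hOp 𝒜 deg π i) * sop 𝒜 0 id fun m => ((weight deg m : K))⁻¹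

theorem hModel_single (m : Multiset (ι ⊕ ι)) (c : A) :
    hModel (K := K) 𝒜 deg π (Finsupp.single m c) =
      (weight deg m : K)⁻¹ • ∑ i, hOp 𝒜 deg π i (Finsupp.single m c) := by
  rw [hModel, Module.End.mul_apply, sop_single, signAut_zero, ← Finsupp.smul_single, map_smul,
    LinearMap.sum_apply]
  rfl

variable {π}

theorem homotopy_single [CharZero K] (hπ : π ⬝ᵥ π = 1) {m : Multiset (ι ⊕ ι)}
    (hm : Reduced deg m) (c : A) :
    dModel 𝒜 deg π (hModel (K := K) 𝒜 deg π (Finsupp.single m c)) +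
      hModel 𝒜 deg π (dModel 𝒜 deg π (Finsupp.single m c)) =
    Finsupp.single m c - Finsupp.single (topMon deg) (Finsupp.single m c (topMon deg)) := by
  have h1 : hModel (K := K) 𝒜 deg π (dModel 𝒜 deg π (Finsupp.single m c)) =
      (weight deg m : K)⁻¹ • ∑ i, ∑ j, hOp 𝒜 deg π j
        ((mX 𝒜 (kdeg deg π) (Sum.inl i) * mX 𝒜 (kdeg deg π) (Sum.inr i))
          (Finsupp.single m c)) := by
    rw [dModel, LinearMap.sum_apply, map_sum, Finset.smul_sum]
    refine Finset.sum_congr rfl fun i _ => ?_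
    rw [dSummand_single 𝒜 deg hπ]
    by_cases ho : od deg i ∈ m
    · rw [dCoeff, if_pos ho, zero_smul, Finsupp.single_zero, map_zero]
      simp
    · rw [hModel_single, weight_pair deg ho]
  have h2 : dModel 𝒜 deg π (hModel (K := K) 𝒜 deg π (Finsupp.single m c)) =
      (weight deg m : K)⁻¹ • ∑ i, ∑ j,
        (mX 𝒜 (kdeg deg π) (Sum.inl i) * mX 𝒜 (kdeg deg π) (Sum.inr i))
        (hOp 𝒜 deg π j (Finsupp.single m c)) := by
    rw [hModel_single, map_smul, dModel, LinearMap.sum_apply]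
    simp only [map_sum]
  have h3 : ∀ i, ∑ j, ((mX 𝒜 (kdeg deg π) (Sum.inl i) * mX 𝒜 (kdeg deg π) (Sum.inr i))
        (hOp 𝒜 deg π j (Finsupp.single m c)) + hOp 𝒜 deg π j
        ((mX 𝒜 (kdeg deg π) (Sum.inl i) * mX 𝒜 (kdeg deg π) (Sum.inr i))
          (Finsupp.single m c))) = (wt deg i m : K) • Finsupp.single m c := by
    intro i
    rw [Finset.sum_eq_single i]
    · exact homotopy_diag 𝒜 deg hπ i hm c
    · intro j _ hj
      exact homotopy_off_diag 𝒜 deg hπ (Ne.symm hj) m c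
    · simp
  rw [h1, h2, ← smul_add, ← Finset.sum_add_distrib]
  simp only [← Finset.sum_add_distrib]
  simp only [h3]
  rw [← Finset.sum_smul, ← Nat.cast_sum, smul_smul]
  change ((weight deg m : K)⁻¹ * (weight deg m : K)) • _ = _
  -- Weight zero means the top monomial, where the convention `0⁻¹ = 0` makes the left side vanish.
  -- Any other weight is invertible in characteristic zero.
  by_cases hw : weight deg m = 0
  · have htop := eq_topMon_of_weight_eq_zero deg hm hw
    rw [hw, Nat.cast_zero, mul_zero, zero_smul, htop, Finsupp.single_eq_same, sub_self]
  · have htop : topMon deg ≠ m := by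
      rintro rfl
      exact hw (weight_topMon deg)
    rw [inv_mul_cancel₀ (Nat.cast_ne_zero.mpr hw), one_smul, Finsupp.single_eq_of_ne htop,
      Finsupp.single_zero, sub_zero]

variable (K A) in
/-- The part of the model that is spanned by the nonzero monomials. -/
noncomputable def reducedPart : Submodule K (Multiset (ι ⊕ ι) →₀ A) :=
  Submodule.span K {f | ∃ m c, Reduced deg m ∧ f = Finsupp.single m c}

theorem homotopy [CharZero K] (hπ : π ⬝ᵥ π = 1) {f : Multiset (ι ⊕ ι) →₀ A}
    (hf : f ∈ reducedPart K A deg) :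
    dModel 𝒜 deg π (hModel (K := K) 𝒜 deg π f) + hModel 𝒜 deg π (dModel 𝒜 deg π f) =
      f - Finsupp.single (topMon deg) (f (topMon deg)) := by
  refine Submodule.span_induction (p := fun f _ =>
    dModel 𝒜 deg π (hModel (K := K) 𝒜 deg π f) + hModel 𝒜 deg π (dModel 𝒜 deg π f) =
      f - Finsupp.single (topMon deg) (f (topMon deg))) ?_ ?_ ?_ ?_ hf
  · rintro _ ⟨m, c, hm, rfl⟩
    exact homotopy_single 𝒜 deg hπ hm c
  · simp
  · intro f g _ _ hf hg
    simp only [map_add, Finsupp.add_apply, Finsupp.single_add]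
    rw [add_add_add_comm, hf, hg]
    abel
  · intro k f _ hf
    simp only [map_smul, Finsupp.smul_apply, ← Finsupp.smul_single]
    rw [← smul_add, hf, smul_sub]

theorem mX_mem_reducedPart (hπ : π ⬝ᵥ π = 1) (v : ι ⊕ ι) {f : Multiset (ι ⊕ ι) →₀ A}
    (hf : f ∈ reducedPart K A deg) :
    mX 𝒜 (kdeg deg π) v f ∈ reducedPart K A deg := by
  refine Submodule.span_induction (p := fun f _ => mX 𝒜 (kdeg deg π) v f ∈ reducedPart K A deg)
    ?_ ?_ ?_ ?_ hf
  · rintro _ ⟨m, c, hm, rfl⟩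
    rw [mX_single, mulCoeff]
    split_ifs with h
    · rw [zero_smul, Finsupp.single_zero]
      exact zero_mem _
    · refine Submodule.subset_span ⟨_, _, fun i => ?_, rfl⟩
      by_cases hv : od deg i = v
      · subst hv
        rw [Multiset.count_cons_self, Multiset.count_eq_zero_of_notMem fun h2 =>
          h ⟨od_odd deg hπ i, h2⟩]
      · rw [Multiset.count_cons_of_ne hv]
        exact hm i
  · rw [map_zero]
    exact zero_mem _
  · intro f g _ _ hf hg
    rw [map_add]
    exact add_mem hf hg
  · intro k f _ hf
    rw [map_smul]
    exact Submodule.smul_mem _ _ hf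

theorem mL_mem_reducedPart (a : A) {f : Multiset (ι ⊕ ι) →₀ A}
    (hf : f ∈ reducedPart K A deg) : mL K A (ι ⊕ ι) a f ∈ reducedPart K A deg := by
  refine Submodule.span_induction (p := fun f _ => mL K A (ι ⊕ ι) a f ∈ reducedPart K A deg)
    ?_ ?_ ?_ ?_ hf
  · rintro _ ⟨m, c, hm, rfl⟩
    rw [mL_single]
    exact Submodule.subset_span ⟨_, _, hm, rfl⟩
  · rw [map_zero]
    exact zero_mem _
  · intro f g _ _ hf hg
    rw [map_add]
    exact add_mem hf hg
  · intro k f _ hf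
    rw [map_smul]
    exact Submodule.smul_mem _ _ hf

/-- Every summand of the differential multiplies in an even variable, and the top monomial contains
none. The coefficient at `topMon` is therefore an invariant of cohomology classes. -/
theorem dModel_apply_topMon (hπ : π ⬝ᵥ π = 1) (f : Multiset (ι ⊕ ι) →₀ A) :
    dModel (K := K) 𝒜 deg π f (topMon deg) = 0 := by
  induction f using Finsupp.induction_linear with
  | zero => simp
  | add f g hf hg => rw [map_add, Finsupp.add_apply, hf, hg, add_zero]
  | single m c =>
    rw [dModel, LinearMap.sum_apply, Finsupp.finsetSum_apply]
    refine Finset.sum_eq_zero fun i _ => ?_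
    rw [dSummand_single 𝒜 deg hπ, Finsupp.single_eq_of_ne]
    intro h
    apply ev_notMem_topMon deg i
    rw [h, pair_cons deg]
    exact Multiset.mem_cons_of_mem (Multiset.mem_cons_self _ _)

section GSym

variable {𝒜} {deg}
variable [IsGradedComm 𝒜] {N : Type*} [AddCommGroup N] [Module K N] [Module A N]
  {𝒩 : Grp n → Submodule K N} (b : AdaptedBasis 𝒜 𝒩 (kdeg deg π))

theorem act_mem_reducedPart (hπ : π ⬝ᵥ π = 1) (s : GSym 𝒜 𝒩) :
    ∀ f ∈ reducedPart K A deg, act b s f ∈ reducedPart K A deg := by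
  induction s using GSym.induction with
  | alg a =>
    intro f hf
    rw [act_ofAlg]
    exact mL_mem_reducedPart deg a hf
  | mod x =>
    intro f hf
    rw [act, GSym.lift_ofMod, LinearMap.sum_apply]
    exact sum_mem fun v _ => mL_mem_reducedPart deg _ (mX_mem_reducedPart 𝒜 deg hπ v hf)
  | mul s t hs ht =>
    intro f hf
    rw [map_mul]
    exact hs _ (ht f hf)
  | add s t hs ht =>
    intro f hf
    rw [map_add]
    exact add_mem (hs f hf) (ht f hf)

theorem toModel_mem_reducedPart (hπ : π ⬝ᵥ π = 1) (s : GSym 𝒜 𝒩) :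
    toModel b s ∈ reducedPart K A deg :=
  act_mem_reducedPart b hπ s _ (Submodule.subset_span ⟨0, 1, fun i => by simp, rfl⟩)

/-- The differential `∑ Π e_i ε^i`, in terms of a basis. -/
noncomputable def dElt : GSym 𝒜 𝒩 :=
  ∑ i, GSym.ofMod 𝒜 𝒩 (b.basis (Sum.inl i)) * GSym.ofMod 𝒜 𝒩 (b.basis (Sum.inr i))

theorem act_dElt : act b (dElt b) = dModel 𝒜 deg π := by
  rw [dElt, map_sum, dModel]
  simp only [map_mul, act_ofMod_basis]

theorem toModel_dElt_mul_topMon (hπ : π ⬝ᵥ π = 1) (t : GSym 𝒜 𝒩) :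
    toModel b (dElt b * t) (topMon deg) = 0 := by
  rw [toModel_mul, act_dElt, dModel_apply_topMon 𝒜 deg hπ]

/-- The homotopy formula loses one of its terms on a cocycle; the rest is carried back to `S_A(N)`
by `ofModel`. -/
theorem exists_eq_of_cocycle [CharZero K] (hπ : π ⬝ᵥ π = 1) {s : GSym 𝒜 𝒩} (hs : dElt b * s = 0) :
    ∃ t, s = dElt b * t + toModel b s (topMon deg) • mmon b (topMon deg) := by
  have h := homotopy 𝒜 deg hπ (toModel_mem_reducedPart b hπ s)
  have h1 : dModel 𝒜 deg π (toModel b s) = 0 := by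
    rw [← act_dElt b, ← toModel_mul, hs, map_zero]
  rw [h1, map_zero, add_zero, ← act_dElt b] at h
  have h2 := congrArg (ofModel b) h
  rw [ofModel_act, map_sub, ofModel_toModel, ofModel_single, eq_sub_iff_add_eq] at h2
  exact ⟨_, h2.symm⟩

end GSym

end Acyclicity

/-! ### Change of homogeneous bases -/

section Transition

variable {K A : Type*} {n : ℕ} [Field K] [Ring A] [Algebra K A]
  {𝒜 : Grp n → Submodule K A} [GradedAlgebra 𝒜] [IsGradedComm 𝒜]
  {M : Type*} [AddCommGroup M] [Module K M] [Module A M] [IsScalarTower K A M]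
  {ℳ : Grp n → Submodule K M} [DirectSum.Decomposition ℳ] [SetLike.GradedSMul 𝒜 ℳ]
  {ι : Type*} [Fintype ι] [DecidableEq ι] {deg : ι → Grp n}

theorem dualBasis_apply (e : HomBasis A ℳ deg) (i : ι) (m : M) :
    (dualBasis 𝒜 e i : M →ₗ[K] A) m = signAut 𝒜 (deg i) (e.1.repr m i) := rfl

theorem sum_signAut_dualBasis (e : HomBasis A ℳ deg) (m : M) :
    ∑ i, signAut 𝒜 (deg i) ((dualBasis 𝒜 e i : M →ₗ[K] A) m) • e.1 i = m := by
  simp only [dualBasis_apply, signAut_signAut, e.1.sum_repr]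

theorem dualBasis_apply_mem (e : HomBasis A ℳ deg) (i : ι) {β : Grp n} {m : M} (hm : m ∈ ℳ β) :
    (dualBasis 𝒜 e i : M →ₗ[K] A) m ∈ 𝒜 (β + deg i) :=
  dualBasis_mem 𝒜 e i β m hm

theorem dualBasis_apply_eq_sum (e e' : HomBasis A ℳ deg) (i : ι) (m : M) :
    (dualBasis 𝒜 e i : M →ₗ[K] A) m = ∑ j, (dualBasis 𝒜 e i : M →ₗ[K] A) (e'.1 j) *
      (dualBasis 𝒜 e' j : M →ₗ[K] A) m := by
  conv_lhs => rw [← sum_signAut_dualBasis (𝒜 := 𝒜) e' m, map_sum]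
  refine Finset.sum_congr rfl fun j _ => ?_
  rw [dual_apply_smul _ (e'.2 j), signAut_signAut]

variable (𝒜) in
/-- The homogeneous basis `e'_i = ∑_j e_j T_(j i)`, as the image of `e` under a linear map. -/
noncomputable def matrixMap (e : HomBasis A ℳ deg) (T : Matrix ι ι A) : M →ₗ[A] M :=
  e.1.constr ℕ fun i => ∑ j, signAut 𝒜 (deg j) (T j i) • e.1 j

theorem matrixMap_apply (e : HomBasis A ℳ deg) (T : Matrix ι ι A) (i : ι) :
    matrixMap 𝒜 e T (e.1 i) = ∑ j, signAut 𝒜 (deg j) (T j i) • e.1 j :=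
  e.1.constr_basis ..

/-- Coordinates written on the right compose by the plain matrix product. Writing them on the left
introduces `signAut`, and the signs agree because all entries have the degrees prescribed by `deg`.
-/
theorem matrixMap_comp (e : HomBasis A ℳ deg) {S T : Matrix ι ι A} (hS : IsDegZero 𝒜 deg S)
    (hT : IsDegZero 𝒜 deg T) :
    matrixMap 𝒜 e S ∘ₗ matrixMap 𝒜 e T = matrixMap 𝒜 e (S * T) := by
  refine e.1.ext fun i => ?_
  rw [LinearMap.comp_apply, matrixMap_apply, matrixMap_apply, map_sum]
  simp only [map_smul, matrixMap_apply, Finset.smul_sum, smul_smul, Matrix.mul_apply, map_sum,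
    Finset.sum_smul]
  rw [Finset.sum_comm]
  refine Finset.sum_congr rfl fun k _ => Finset.sum_congr rfl fun j _ => ?_
  congr 1
  rw [map_mul, signAut_of_mem 𝒜 _ (hT j i), signAut_of_mem 𝒜 _ (hS k j),
    signAut_of_mem 𝒜 _ (hT j i), smul_mul_smul_comm, smul_mul_smul_comm,
    IsGradedComm.comm (hT j i) (hS k j), smul_smul]
  congr 1
  simp only [ksign_add_left, ksign_add_right]
  rw [ksign_comm (deg j) (deg k), ksign_comm (deg i) (deg k), ksign_comm (deg i) (deg j)]
  generalize ksign (deg j) (deg j) = a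
  generalize ksign (deg k) (deg j) = b
  generalize ksign (deg k) (deg i) = c
  generalize ksign (deg k) (deg k) = d
  generalize ksign (deg j) (deg i) = f
  rcases Int.units_eq_one_or a with rfl | rfl <;> rcases Int.units_eq_one_or b with rfl | rfl <;>
  rcases Int.units_eq_one_or c with rfl | rfl <;> rcases Int.units_eq_one_or d with rfl | rfl <;>
  rcases Int.units_eq_one_or f with rfl | rfl <;> rfl

theorem matrixMap_one (e : HomBasis A ℳ deg) : matrixMap 𝒜 e 1 = LinearMap.id := by
  refine e.1.ext fun i => ?_
  rw [matrixMap_apply, Finset.sum_eq_single i]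
  · simp
  · intro j _ hj
    rw [Matrix.one_apply_ne hj, map_zero, zero_smul]
  · simp

/-- The basis `e T`. -/
noncomputable def mulBasis (e : HomBasis A ℳ deg) (T : GL0 𝒜 deg) : HomBasis A ℳ deg :=
  ⟨e.1.map (LinearEquiv.ofLinearMap (matrixMap 𝒜 e T.1.val)
      (matrixMap 𝒜 e ((T.1⁻¹ : (Matrix ι ι A)ˣ) : Matrix ι ι A))
      (by rw [matrixMap_comp e T.2.1 T.2.2, Units.mul_inv, matrixMap_one])
      (by rw [matrixMap_comp e T.2.2 T.2.1, Units.inv_mul, matrixMap_one])), fun i => by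
    rw [Module.Basis.map_apply, LinearEquiv.coe_ofLinearMap, matrixMap_apply]
    refine sum_mem fun j _ => ?_
    have h := SetLike.GradedSMul.smul_mem (signAut_mem 𝒜 (γ := deg j) (T.2.1 j i)) (e.2 j)
    rw [vadd_eq_add, add_comm, ← add_assoc, grp_add_self, zero_add] at h
    exact h⟩

theorem mulBasis_apply (e : HomBasis A ℳ deg) (T : GL0 𝒜 deg) (i : ι) :
    (mulBasis e T).1 i = ∑ j, signAut 𝒜 (deg j) (T.1.val j i) • e.1 j := by
  rw [mulBasis, Module.Basis.map_apply, LinearEquiv.coe_ofLinearMap, matrixMap_apply]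

end Transition

section Transition

variable {K A : Type*} {n : ℕ} [Field K] [Ring A] [Algebra K A]
  {𝒜 : Grp n → Submodule K A} [GradedAlgebra 𝒜] [IsGradedComm 𝒜]
  {M : Type*} [AddCommGroup M] [Module K M] [Module A M] [IsScalarTower K A M]
  {ℳ : Grp n → Submodule K M} [DirectSum.Decomposition ℳ] [SetLike.GradedSMul 𝒜 ℳ]
  {p q : ℕ} {deg : Fin p ⊕ Fin q → Grp n}

theorem transition_apply (e e' : HomBasis A ℳ deg) (i j : Fin p ⊕ Fin q) :
    transition 𝒜 e e' i j = (dualBasis 𝒜 e i : M →ₗ[K] A) (e'.1 j) := rfl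

theorem transition_isDegZero (e e' : HomBasis A ℳ deg) : IsDegZero 𝒜 deg (transition 𝒜 e e') := by
  intro i j
  have h := dualBasis_apply_mem (𝒜 := 𝒜) e i (e'.2 j)
  rwa [add_comm] at h

theorem transition_mul (e e' e'' : HomBasis A ℳ deg) :
    transition 𝒜 e e' * transition 𝒜 e' e'' = transition 𝒜 e e'' := by
  ext i k
  rw [Matrix.mul_apply, transition_apply, dualBasis_apply_eq_sum e e']
  rfl

theorem transition_self (e : HomBasis A ℳ deg) : transition 𝒜 e e = 1 := by
  ext i j
  rw [transition_apply, dualBasis_apply_self, Matrix.one_apply]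

theorem transition_mulBasis (e : HomBasis A ℳ deg) (T : GL0 𝒜 deg) :
    transition 𝒜 e (mulBasis e T) = T.1.val := by
  ext i j
  rw [transition_apply, mulBasis_apply, dualBasis_apply,
    congrFun (e.1.repr_sum_self fun k => signAut 𝒜 (deg k) (T.1.val k j)) i, signAut_signAut]

variable (𝒜) in
/-- The transition matrix, as an element of `GL⁰`. -/
noncomputable def transGL (e e' : HomBasis A ℳ deg) : GL0 𝒜 deg :=
  ⟨⟨transition 𝒜 e e', transition 𝒜 e' e, by rw [transition_mul, transition_self],
    by rw [transition_mul, transition_self]⟩, transition_isDegZero e e', transition_isDegZero e' e⟩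

theorem transGL_mul (e e' e'' : HomBasis A ℳ deg) :
    transGL 𝒜 e e' * transGL 𝒜 e' e'' = transGL 𝒜 e e'' := by
  apply Subtype.ext
  apply Units.ext
  exact transition_mul e e' e''

theorem transGL_mulBasis (e : HomBasis A ℳ deg) (T : GL0 𝒜 deg) :
    transGL 𝒜 e (mulBasis e T) = T := by
  apply Subtype.ext
  apply Units.ext
  exact transition_mulBasis e T

variable (π : Grp n)

theorem kShift_add (m m' : M) : kShift 𝒜 ℳ π (m + m') = kShift 𝒜 ℳ π m + kShift 𝒜 ℳ π m' := by
  rw [kShift, kShift, kShift, ← GSym.ofMod_add, map_add, Prod.mk_add_mk, add_zero]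

theorem kShift_sum {ι : Type*} (s : Finset ι) (f : ι → M) :
    kShift 𝒜 ℳ π (∑ i ∈ s, f i) = ∑ i ∈ s, kShift 𝒜 ℳ π (f i) :=
  map_sum (AddMonoidHom.mk' (kShift 𝒜 ℳ π) (kShift_add π)) f s

theorem kDual_add (ℓ ℓ' : Dual 𝒜 ℳ) : kDual 𝒜 π (ℓ + ℓ') = kDual 𝒜 π ℓ + kDual 𝒜 π ℓ' := by
  rw [kDual, kDual, kDual, ← GSym.ofMod_add, Prod.mk_add_mk, add_zero]

theorem kDual_sum {ι : Type*} (s : Finset ι) (f : ι → Dual 𝒜 ℳ) :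
    kDual 𝒜 π (∑ i ∈ s, f i) = ∑ i ∈ s, kDual 𝒜 π (f i) :=
  map_sum (AddMonoidHom.mk' (kDual 𝒜 π) (kDual_add π)) f s

variable (𝒜 ℳ) in
/-- The structure map from `A` to the Koszul complex. -/
abbrev kAlg : A →+* Koszul 𝒜 ℳ π :=
  GSym.ofAlg (N := Shift 𝒜 π M × Dual 𝒜 ℳ) 𝒜 (koszulModGrading 𝒜 ℳ π)

theorem kDual_smul (a : A) (ℓ : Dual 𝒜 ℳ) :
    kDual 𝒜 π (a • ℓ) = kAlg 𝒜 ℳ π a * kDual 𝒜 π ℓ := by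
  rw [kDual, kDual, ← GSym.ofMod_smul, Prod.smul_mk, smul_zero]

theorem mem_koszulModGrading_shift {β : Grp n} {m : M} (hm : m ∈ ℳ β) :
    ((toShift 𝒜 π M m, 0) : Shift 𝒜 π M × Dual 𝒜 ℳ) ∈ koszulModGrading 𝒜 ℳ π (β + π) := by
  refine ⟨⟨m, ?_, rfl⟩, zero_mem _⟩
  rwa [grp_add_add_cancel_right]

theorem kShift_smul {β : Grp n} {m : M} (hm : m ∈ ℳ β) (a : A) :
    kShift 𝒜 ℳ π (signAut 𝒜 β a • m) = kShift 𝒜 ℳ π m * kAlg 𝒜 ℳ π a := by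
  have h := GSym.ofMod_mul_ofAlg (N := Shift 𝒜 π M × Dual 𝒜 ℳ) 𝒜 (koszulModGrading 𝒜 ℳ π)
    (mem_koszulModGrading_shift π hm) a
  rw [kShift, kShift, kAlg, h, ← GSym.ofMod_smul, Prod.smul_mk, smul_zero, smul_toShift,
    ← signAut_add, add_left_comm, grp_add_self, add_zero]

theorem kShift_basis (e e' : HomBasis A ℳ deg) (i : Fin p ⊕ Fin q) :
    kShift 𝒜 ℳ π (e'.1 i) =
      ∑ j, kShift 𝒜 ℳ π (e.1 j) * kAlg 𝒜 ℳ π (transition 𝒜 e e' j i) := by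
  conv_lhs => rw [← sum_signAut_dualBasis (𝒜 := 𝒜) e (e'.1 i), kShift_sum]
  exact Finset.sum_congr rfl fun j _ => kShift_smul π (e.2 j) _

theorem kDual_basis (e e' : HomBasis A ℳ deg) (i : Fin p ⊕ Fin q) :
    kDual 𝒜 π (dualBasis 𝒜 e' i) =
      ∑ j, kAlg 𝒜 ℳ π (transition 𝒜 e' e i j) * kDual 𝒜 π (dualBasis 𝒜 e j) := by
  conv_lhs => rw [← sum_apply_smul_dualBasis e (dualBasis 𝒜 e' i), kDual_sum]
  exact Finset.sum_congr rfl fun j _ => kDual_smul π _ _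

/-- The `Π e_i` change by the transition matrix on the right and the `ε^i` by its inverse on the
left, so the two matrices meet in the middle and cancel. -/
theorem kd_eq_kd (e e' : HomBasis A ℳ deg) : kd 𝒜 π e' = kd 𝒜 π e := by
  have h1 : kd 𝒜 π e' = ∑ j, ∑ k, kShift 𝒜 ℳ π (e.1 j) *
      kAlg 𝒜 ℳ π ((transition 𝒜 e e' * transition 𝒜 e' e) j k) *
      kDual 𝒜 π (dualBasis 𝒜 e k) := by
    rw [kd]
    simp only [kShift_basis π e e', kDual_basis π e e', Matrix.mul_apply,
      map_sum, map_mul, Finset.mul_sum, Finset.sum_mul]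
    rw [Finset.sum_comm]
    conv_rhs => rw [Finset.sum_comm]
    refine Finset.sum_congr rfl fun k _ => ?_
    rw [Finset.sum_comm]
    simp only [mul_assoc]
  rw [h1, transition_mul, transition_self, kd]
  refine Finset.sum_congr rfl fun j _ => ?_
  rw [Finset.sum_eq_single j]
  · rw [Matrix.one_apply_eq, map_one, mul_one]
  · intro k _ hk
    rw [Matrix.one_apply_ne hk.symm, map_zero, mul_zero, zero_mul]
  · simp

theorem kd_eq_dElt (e : HomBasis A ℳ deg) : kd 𝒜 π e = dElt (kBasis 𝒜 π e) := by
  rw [kd, dElt]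
  simp only [ofMod_kBasis_inl, ofMod_kBasis_inr]

end Transition

/-! ### The class of `ξ_1 ⋯ ξ_r` under a change of basis -/

section TopClass

variable {K A : Type*} {n : ℕ} [Field K] [Ring A] [Algebra K A]
  {𝒜 : Grp n → Submodule K A} [GradedAlgebra 𝒜] [IsGradedComm 𝒜]
  {M : Type*} [AddCommGroup M] [Module K M] [Module A M] [IsScalarTower K A M]
  {ℳ : Grp n → Submodule K M} [DirectSum.Decomposition ℳ] [SetLike.GradedSMul 𝒜 ℳ]
  {p q : ℕ} {deg : Fin p ⊕ Fin q → Grp n} (π : Grp n)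

variable (𝒜 deg) in
/-- The action of the odd variables. -/
noncomputable def oddX (v : (Fin p ⊕ Fin q) ⊕ (Fin p ⊕ Fin q)) :
    Module.End K (Multiset ((Fin p ⊕ Fin q) ⊕ (Fin p ⊕ Fin q)) →₀ A) :=
  if kdeg deg π v ⬝ᵥ kdeg deg π v = 1 then mX 𝒜 (kdeg deg π) v else 0

variable (𝒜) in
/-- The action of the complex on the model for which the even variables act by zero. -/
noncomputable def oddAct (e : HomBasis A ℳ deg) : Koszul 𝒜 ℳ π →ₐ[K]
    Module.End K (Multiset ((Fin p ⊕ Fin q) ⊕ (Fin p ⊕ Fin q)) →₀ A) :=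
  GSym.lift (E := Module.End K (Multiset ((Fin p ⊕ Fin q) ⊕ (Fin p ⊕ Fin q)) →₀ A))
    (kBasis 𝒜 π e) (mL K A _) (oddX 𝒜 deg π)
    (fun v α a ha => by
      rw [oddX]
      split_ifs
      · exact mX_mL 𝒜 (kdeg deg π) v ha
      · exact GComm.zero_left)
    (fun v w => by
      rw [oddX, oddX]
      split_ifs
      · exact mX_mX 𝒜 (kdeg deg π) v w
      · exact GComm.zero_right
      · exact GComm.zero_left
      · exact GComm.zero_left)

theorem oddAct_alg (e : HomBasis A ℳ deg) (a : A) :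
    oddAct 𝒜 π e (kAlg 𝒜 ℳ π a) = mL K A _ a := GSym.lift_ofAlg _ _ _

theorem oddAct_kShift (e : HomBasis A ℳ deg) (i : Fin p ⊕ Fin q) :
    oddAct 𝒜 π e (kShift 𝒜 ℳ π (e.1 i)) = oddX 𝒜 deg π (Sum.inl i) := by
  rw [← ofMod_kBasis_inl]
  exact GSym.lift_ofMod_basis _ _ _

theorem oddAct_kDual (e : HomBasis A ℳ deg) (i : Fin p ⊕ Fin q) :
    oddAct 𝒜 π e (kDual 𝒜 π (dualBasis 𝒜 e i)) = oddX 𝒜 deg π (Sum.inr i) := by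
  rw [← ofMod_kBasis_inr]
  exact GSym.lift_ofMod_basis _ _ _

variable {π} (hπ : π ⬝ᵥ π = 1)
  (heven : ∀ i : Fin p, deg (Sum.inl i) ⬝ᵥ deg (Sum.inl i) = 0)
  (hodd : ∀ j : Fin q, deg (Sum.inr j) ⬝ᵥ deg (Sum.inr j) = 1)

-- Each summand of `d` contains an even variable. Consequently `oddAct` kills coboundaries and can
-- be evaluated on cohomology classes.
include hπ in
theorem oddAct_kd (e : HomBasis A ℳ deg) : oddAct 𝒜 π e (kd 𝒜 π e) = 0 := by
  rw [kd, map_sum]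
  refine Finset.sum_eq_zero fun i _ => ?_
  rw [map_mul, oddAct_kShift, oddAct_kDual, oddX, oddX]
  simp only [parity_inl deg hπ, parity_inr]
  split_ifs <;> simp

include hπ heven in
theorem oddX_inl_inl (i : Fin p) :
    oddX (K := K) 𝒜 deg π (Sum.inl (Sum.inl i)) = mX 𝒜 (kdeg deg π) (Sum.inl (Sum.inl i)) :=
  if_pos ((parity_inl deg hπ _).mpr (heven i))

include hπ hodd in
theorem oddX_inl_inr (j : Fin q) : oddX (K := K) 𝒜 deg π (Sum.inl (Sum.inr j)) = 0 :=
  if_neg fun h => by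
    have h2 := (parity_inl deg hπ _).mp h
    rw [hodd j] at h2
    exact one_ne_zero h2

include heven in
theorem oddX_inr_inl (i : Fin p) : oddX (K := K) 𝒜 deg π (Sum.inr (Sum.inl i)) = 0 :=
  if_neg fun h => (parity_inr deg _).mp h (heven i)

include hodd in
theorem oddX_inr_inr (j : Fin q) :
    oddX (K := K) 𝒜 deg π (Sum.inr (Sum.inr j)) = mX 𝒜 (kdeg deg π) (Sum.inr (Sum.inr j)) :=
  if_pos (hodd j)

variable (K 𝒜) in
include hπ heven in
theorem oddFamily_inl : (modelOps (K := K) 𝒜 (kdeg deg π)).OddFamily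
    (fun i : Fin p => deg (Sum.inl i)) π
    (fun i => mX 𝒜 (kdeg deg π) (Sum.inl (Sum.inl i))) where
  parity i j := by rw [heven, heven]
  odd i := by rw [dotProduct_add_self, heven, hπ, zero_add]
  hasDegree i := hasDegree_mX 𝒜 (kdeg deg π) (Sum.inl (Sum.inl i))
  mul_L i _ _ ha := mX_mL 𝒜 (kdeg deg π) (Sum.inl (Sum.inl i)) ha
  comm i j := mX_mX 𝒜 (kdeg deg π) (Sum.inl (Sum.inl i)) (Sum.inl (Sum.inl j))
  sq i := mX_sq 𝒜 (kdeg deg π) ((parity_inl deg hπ _).mpr (heven i))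

variable (K 𝒜 π) in
include hodd in
theorem oddFamily_inr : (modelOps (K := K) 𝒜 (kdeg deg π)).OddFamily
    (fun j : Fin q => deg (Sum.inr j)) 0
    (fun j => mX 𝒜 (kdeg deg π) (Sum.inr (Sum.inr j))) where
  parity i j := by rw [hodd, hodd]
  odd i := by rw [add_zero, hodd]
  hasDegree i := by
    rw [add_zero]
    exact hasDegree_mX 𝒜 (kdeg deg π) (Sum.inr (Sum.inr i))
  mul_L i _ _ ha := by
    rw [add_zero]
    exact mX_mL 𝒜 (kdeg deg π) (Sum.inr (Sum.inr i)) ha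
  comm i j := by
    rw [add_zero, add_zero]
    exact mX_mX 𝒜 (kdeg deg π) (Sum.inr (Sum.inr i)) (Sum.inr (Sum.inr j))
  sq i := mX_sq 𝒜 (kdeg deg π) (hodd i)

variable (deg π) in
/-- The sign of the variables `ξ_j` with odd `e_j`. -/
def xiSign : ℤˣ := ∏ j : Fin q, -ksign (deg (Sum.inr j)) π

variable (π) in
theorem xiTop_eq (e : HomBasis A ℳ deg) : xiTop 𝒜 π e = xiSign deg π •
    ((List.ofFn fun i => kShift 𝒜 ℳ π (e.1 (Sum.inl i))).prod *
      (List.ofFn fun j => kDual 𝒜 π (dualBasis 𝒜 e (Sum.inr j))).prod) := by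
  rw [xiTop, ← mul_smul_comm, xiSign, ← DegreeOps.prod_units_smul]
  simp only [xivar, Units.neg_smul]

variable (deg) in
/-- The coefficient of `ξ_1 ⋯ ξ_r` in the product of the odd variables for the basis `e T`. -/
noncomputable def topCoeff (T : (Matrix (Fin p ⊕ Fin q) (Fin p ⊕ Fin q) A)ˣ) : A :=
  gdet (fun i => deg (Sum.inl i)) T.val.toBlocks₁₁ *
    gdet (fun j => deg (Sum.inr j)) (T⁻¹).val.toBlocks₂₂

theorem toBlocks₁₁_mem {T : Matrix (Fin p ⊕ Fin q) (Fin p ⊕ Fin q) A} (hT : IsDegZero 𝒜 deg T)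
    (i j : Fin p) : T.toBlocks₁₁ i j ∈ 𝒜 (deg (Sum.inl i) + deg (Sum.inl j)) := hT _ _

theorem toBlocks₂₂_mem {T : Matrix (Fin p ⊕ Fin q) (Fin p ⊕ Fin q) A} (hT : IsDegZero 𝒜 deg T)
    (i j : Fin q) : T.toBlocks₂₂ i j ∈ 𝒜 (deg (Sum.inr i) + deg (Sum.inr j)) := hT _ _

theorem topCoeff_mem (T : GL0 𝒜 deg) : topCoeff deg T.1 ∈ 𝒜 0 := by
  have h := SetLike.GradedMul.mul_mem (gdet_mem (toBlocks₁₁_mem T.2.1))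
    (gdet_mem (toBlocks₂₂_mem T.2.2))
  rwa [add_zero] at h

theorem commute_mL_oddX {a : A} (ha : a ∈ 𝒜 0) (v : (Fin p ⊕ Fin q) ⊕ (Fin p ⊕ Fin q)) :
    Commute (mX (K := K) 𝒜 (kdeg deg π) v) (mL K A _ a) := by
  have h := mX_mL (K := K) 𝒜 (kdeg deg π) v ha
  rw [GComm, ksign_zero_right, one_smul] at h
  exact h

theorem toBlocks₁₁_one : (1 : Matrix (Fin p ⊕ Fin q) (Fin p ⊕ Fin q) A).toBlocks₁₁ = 1 := by
  rw [← Matrix.fromBlocks_one, Matrix.toBlocks_fromBlocks₁₁]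

theorem toBlocks₂₂_one : (1 : Matrix (Fin p ⊕ Fin q) (Fin p ⊕ Fin q) A).toBlocks₂₂ = 1 := by
  rw [← Matrix.fromBlocks_one, Matrix.toBlocks_fromBlocks₂₂]

variable (𝒜) in
include heven hodd in
theorem topCoeff_transGL_self (e : HomBasis A ℳ deg) : topCoeff deg (transGL 𝒜 e e).1 = 1 := by
  change gdet _ (transition 𝒜 e e).toBlocks₁₁ * gdet _ (transition 𝒜 e e).toBlocks₂₂ = 1
  rw [transition_self, toBlocks₁₁_one, toBlocks₂₂_one,
    gdet_one (𝒜 := 𝒜) fun i j => by rw [heven, heven],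
    gdet_one (𝒜 := 𝒜) fun i j => by rw [hodd, hodd], one_mul]

-- When even variables act by zero, the `Π e'_i` with `e_i` even become combinations of the odd `Π
-- e_j` by the even block of the transition matrix, and the `ε'^i` with `e_i` odd become
-- combinations of the odd `ε^j` by the odd block of the inverse. The two rules for linear
-- substitution give one graded determinant each.
include hπ heven hodd in
theorem oddAct_xiTop (e e' : HomBasis A ℳ deg) :
    oddAct 𝒜 π e (xiTop 𝒜 π e') =
      mL K A _ (topCoeff deg (transGL 𝒜 e e').1) * oddAct 𝒜 π e (xiTop 𝒜 π e) := by
  have h1 : ∀ f : HomBasis A ℳ deg,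
      oddAct 𝒜 π e (List.ofFn fun i => kShift 𝒜 ℳ π (f.1 (Sum.inl i))).prod =
      (List.ofFn fun i => mX 𝒜 (kdeg deg π) (Sum.inl (Sum.inl i))).prod *
        mL K A _ (gdet (fun i => deg (Sum.inl i)) (transition 𝒜 e f).toBlocks₁₁) := by
    intro f
    have h := (oddFamily_inl K 𝒜 hπ heven).prod_sum_left (transition 𝒜 e f).toBlocks₁₁
      (toBlocks₁₁_mem (transition_isDegZero e f))
    rw [modelOps_L] at h
    rw [← h, map_list_prod, List.map_ofFn]
    congr 2
    funext i
    rw [Function.comp_apply, kShift_basis π e f, map_sum, Fintype.sum_sum_type]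
    simp only [map_mul, oddAct_kShift, oddX_inl_inl hπ heven, oddX_inl_inr hπ hodd, zero_mul,
      Finset.sum_const_zero, add_zero, oddAct_alg]
    rfl
  have h2 : ∀ f : HomBasis A ℳ deg,
      oddAct 𝒜 π e (List.ofFn fun j => kDual 𝒜 π (dualBasis 𝒜 f (Sum.inr j))).prod =
      (List.ofFn fun j => mX 𝒜 (kdeg deg π) (Sum.inr (Sum.inr j))).prod *
        mL K A _ (gdet (fun j => deg (Sum.inr j)) (transition 𝒜 f e).toBlocks₂₂) := by
    intro f
    have h := (oddFamily_inr K 𝒜 π hodd).prod_sum_right (transition 𝒜 f e).toBlocks₂₂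
      (toBlocks₂₂_mem (transition_isDegZero f e))
    rw [modelOps_L] at h
    rw [← h, map_list_prod, List.map_ofFn]
    congr 2
    funext i
    rw [Function.comp_apply, kDual_basis π e f, map_sum, Fintype.sum_sum_type]
    simp only [map_mul, oddAct_kDual, oddX_inr_inr hodd, oddX_inr_inl heven, mul_zero,
      Finset.sum_const_zero, zero_add, oddAct_alg]
    rfl
  have h3 : ∀ {m : ℕ} (f : Fin m → (Fin p ⊕ Fin q) ⊕ (Fin p ⊕ Fin q)) {a : A}, a ∈ 𝒜 0 →
      Commute (mL K A _ a) (List.ofFn fun i => mX (K := K) 𝒜 (kdeg deg π) (f i)).prod := by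
    intro m f a ha
    refine Commute.list_prod_right _ _ fun x hx => ?_
    obtain ⟨i, rfl⟩ := List.mem_ofFn.mp hx
    exact (commute_mL_oddX ha _).symm
  have h4 : ∀ f : HomBasis A ℳ deg, oddAct 𝒜 π e (xiTop 𝒜 π f) =
      mL K A _ (topCoeff deg (transGL 𝒜 e f).1) * (xiSign deg π •
        ((List.ofFn fun i => mX 𝒜 (kdeg deg π) (Sum.inl (Sum.inl i))).prod *
        (List.ofFn fun j => mX 𝒜 (kdeg deg π) (Sum.inr (Sum.inr j))).prod)) := by
    intro f
    have hg1 := gdet_mem (toBlocks₁₁_mem (transition_isDegZero (𝒜 := 𝒜) e f))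
    have hg2 := gdet_mem (toBlocks₂₂_mem (transition_isDegZero (𝒜 := 𝒜) f e))
    rw [xiTop_eq, Units.smul_def, map_zsmul, ← Units.smul_def, map_mul, h1, h2, topCoeff, map_mul,
      mul_smul_comm]
    congr 1
    rw [← (h3 _ hg1).eq, ← (h3 _ hg2).eq, mul_assoc]
    change _ = mL K A _ (gdet (fun i => deg (Sum.inl i)) (transition 𝒜 e f).toBlocks₁₁) *
      mL K A _ (gdet (fun j => deg (Sum.inr j)) (transition 𝒜 f e).toBlocks₂₂) * _
    rw [mul_assoc, ← mul_assoc _ (mL K A _ _), ← (h3 _ hg2).eq, mul_assoc]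
  rw [h4 e', h4 e, topCoeff_transGL_self 𝒜 heven hodd, map_one, one_mul]

end TopClass

/-! ### Coordinates of monomials without repeated factors -/

section Monomials

variable {K A : Type*} {n : ℕ} [Field K] [Ring A] [Algebra K A]
  {𝒜 : Grp n → Submodule K A} [GradedAlgebra 𝒜] [IsGradedComm 𝒜]
  {V : Type*} {dv : V → Grp n} [Fintype V] [DecidableEq V]
  {N : Type*} [AddCommGroup N] [Module K N] [Module A N]
  {𝒩 : Grp n → Submodule K N} (b : AdaptedBasis 𝒜 𝒩 dv)

theorem toModel_units_smul (u : ℤˣ) (s : GSym 𝒜 𝒩) : toModel b (u • s) = u • toModel b s := by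
  rw [Units.smul_def, map_zsmul, ← Units.smul_def]

theorem toModel_ofMod_mul (v : V) (s : GSym 𝒜 𝒩) :
    toModel b (GSym.ofMod 𝒜 𝒩 (b.basis v) * s) = mX 𝒜 dv v (toModel b s) := by
  rw [toModel_mul, act_ofMod_basis]

theorem toModel_one : toModel b (1 : GSym 𝒜 𝒩) = Finsupp.single 0 1 := by
  rw [toModel_apply, map_one]
  rfl

theorem toModel_lmon_of_nodup {l : List V} (hl : l.Nodup) :
    toModel b (lmon b l) = Finsupp.single (l : Multiset V) 1 := by
  induction l with
  | nil =>
    have h : lmon b ([] : List V) = 1 := by simp [lmon, lsign]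
    rw [h, toModel_one]
    rfl
  | cons v l ih =>
    rw [List.nodup_cons] at hl
    rw [lmon_cons, toModel_units_smul, toModel_ofMod_mul, ih hl.2, mX_single, mulCoeff,
      if_neg fun h => hl.1 (Multiset.mem_coe.mp h.2), map_one, sgnK_smul, Finsupp.smul_single, smul_smul,
      Int.units_mul_self, one_smul]
    rfl

theorem toModel_mmon_of_nodup {m : Multiset V} (hm : m.Nodup) :
    toModel b (mmon b m) = Finsupp.single m 1 := by
  induction m using Quotient.inductionOn with
  | h l => exact toModel_lmon_of_nodup b hm

theorem prod_eq_lsign_smul_mmon (l : List V) :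
    (l.map fun v => GSym.ofMod 𝒜 𝒩 (b.basis v)).prod = lsign dv l • mmon b (l : Multiset V) := by
  change _ = lsign dv l • lmon b l
  rw [lmon, smul_smul, Int.units_mul_self, one_smul]

theorem toModel_injective [CharZero K] : Function.Injective (toModel b) :=
  Function.LeftInverse.injective (ofModel_toModel b)

end Monomials

/-! ### The class of the top monomial as a free generator of the cohomology -/

section TopClass

variable {K A : Type*} {n : ℕ} [Field K] [Ring A] [Algebra K A]
  {𝒜 : Grp n → Submodule K A} [GradedAlgebra 𝒜] [IsGradedComm 𝒜]
  {M : Type*} [AddCommGroup M] [Module K M] [Module A M] [IsScalarTower K A M]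
  {ℳ : Grp n → Submodule K M} [DirectSum.Decomposition ℳ] [SetLike.GradedSMul 𝒜 ℳ]
  {p q : ℕ} {deg : Fin p ⊕ Fin q → Grp n} {π : Grp n}

theorem topMon_nodup {ι : Type*} [Fintype ι] [DecidableEq ι] (deg : ι → Grp n) :
    (topMon deg).Nodup :=
  Multiset.Nodup.map (od_injective deg) Finset.univ.nodup

variable (p q) in
/-- The list of the odd variables. -/
def topList : List ((Fin p ⊕ Fin q) ⊕ (Fin p ⊕ Fin q)) :=
  (List.ofFn fun i => Sum.inl (Sum.inl i)) ++ List.ofFn fun j => Sum.inr (Sum.inr j)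

variable (hπ : π ⬝ᵥ π = 1)
  (heven : ∀ i : Fin p, deg (Sum.inl i) ⬝ᵥ deg (Sum.inl i) = 0)
  (hodd : ∀ j : Fin q, deg (Sum.inr j) ⬝ᵥ deg (Sum.inr j) = 1)

include heven in
theorem od_inl (i : Fin p) : od deg (Sum.inl i) = Sum.inl (Sum.inl i) := if_pos (heven i)

include hodd in
theorem od_inr (j : Fin q) : od deg (Sum.inr j) = Sum.inr (Sum.inr j) :=
  if_neg (by rw [hodd j]; exact one_ne_zero)

include heven hodd in
theorem coe_topList : (topList p q : Multiset ((Fin p ⊕ Fin q) ⊕ (Fin p ⊕ Fin q))) =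
    topMon deg := by
  have hnd : (topList p q).Nodup := by
    refine List.Nodup.append ?_ ?_ ?_
    · exact List.nodup_ofFn.mpr fun i j h => Sum.inl_injective (Sum.inl_injective h)
    · exact List.nodup_ofFn.mpr fun i j h => Sum.inr_injective (Sum.inr_injective h)
    · intro v hv hw
      obtain ⟨i, rfl⟩ := List.mem_ofFn.mp hv
      obtain ⟨j, hj⟩ := List.mem_ofFn.mp hw
      exact Sum.inr_ne_inl hj
  refine (Multiset.Nodup.ext (Multiset.coe_nodup.mpr hnd) (topMon_nodup deg)).mpr fun v => ?_
  rw [Multiset.mem_coe, topList, List.mem_append, List.mem_ofFn, List.mem_ofFn, topMon,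
    Multiset.mem_map, Sum.exists]
  simp [od_inl heven, od_inr hodd]

variable (deg π) in
/-- The sign of `ξ_1 ⋯ ξ_r` as a normalized monomial. -/
noncomputable def topSign : ℤˣ := xiSign deg π * lsign (kdeg deg π) (topList p q)

include heven hodd in
theorem xiTop_eq_mmon (e : HomBasis A ℳ deg) :
    xiTop 𝒜 π e = topSign deg π • mmon (kBasis 𝒜 π e) (topMon deg) := by
  rw [xiTop_eq, topSign, ← smul_smul, ← coe_topList heven hodd, ← prod_eq_lsign_smul_mmon, topList,
    List.map_append, List.prod_append, List.map_ofFn, List.map_ofFn]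
  simp only [← ofMod_kBasis_inl, ← ofMod_kBasis_inr]
  rfl

include heven hodd in
theorem mmon_eq_xiTop (e : HomBasis A ℳ deg) :
    mmon (kBasis 𝒜 π e) (topMon deg) = topSign deg π • xiTop 𝒜 π e := by
  rw [xiTop_eq_mmon heven hodd, smul_smul, Int.units_mul_self, one_smul]

include heven hodd in
theorem toModel_xiTop (e : HomBasis A ℳ deg) :
    toModel (kBasis 𝒜 π e) (xiTop 𝒜 π e) = Finsupp.single (topMon deg) (topSign deg π • 1) := by
  rw [xiTop_eq_mmon heven hodd, toModel_units_smul, toModel_mmon_of_nodup _ (topMon_nodup deg),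
    Finsupp.smul_single]

-- All odd variables already occur, so every summand of `d` repeats one of them.
include hπ heven hodd in
theorem kd_mul_xiTop [CharZero K] (e₀ e : HomBasis A ℳ deg) : kd 𝒜 π e₀ * xiTop 𝒜 π e = 0 := by
  rw [kd_eq_kd π e e₀, kd_eq_dElt]
  apply toModel_injective (kBasis 𝒜 π e)
  rw [toModel_mul, act_dElt, toModel_xiTop heven hodd, map_zero, dModel, LinearMap.sum_apply]
  refine Finset.sum_eq_zero fun i _ => ?_
  rw [dSummand_single 𝒜 deg hπ, dCoeff, if_pos, zero_smul, Finsupp.single_zero]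
  exact Multiset.one_le_count_iff_mem.mp (count_od_topMon deg i).ge

theorem units_smul_smul_comm {S : Type*} [AddCommGroup S] [Module A S] (u : ℤˣ) (a : A) (s : S) :
    a • u • s = (u • a) • s := by
  rcases Int.units_eq_one_or u with rfl | rfl
  · rw [one_smul, one_smul]
  · rw [Units.neg_smul, one_smul, Units.neg_smul, one_smul, smul_neg, neg_smul]

include hπ heven hodd in
theorem exists_sub_smul_xiTop_mem [CharZero K] (e₀ e : HomBasis A ℳ deg) {s : Koszul 𝒜 ℳ π}
    (hs : s ∈ cocycles 𝒜 π e₀) : ∃ a : A, s - a • xiTop 𝒜 π e ∈ coboundaries 𝒜 π e₀ := by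
  have hs' : dElt (kBasis 𝒜 π e) * s = 0 := by
    rw [← kd_eq_dElt, ← kd_eq_kd π e e₀]
    exact hs
  obtain ⟨t, ht⟩ := exists_eq_of_cocycle (kBasis 𝒜 π e) hπ hs'
  refine ⟨topSign deg π • toModel (kBasis 𝒜 π e) s (topMon deg), t, ?_⟩
  rw [kd_eq_kd π e e₀, kd_eq_dElt, sub_eq_iff_eq_add, ← units_smul_smul_comm,
    ← mmon_eq_xiTop heven hodd]
  exact ht

-- The coefficient at `topMon` vanishes on coboundaries, and on this element it is `a` up to sign.
include hπ heven hodd in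
theorem eq_zero_of_smul_xiTop_mem (e₀ e : HomBasis A ℳ deg) {a : A}
    (ha : a • xiTop 𝒜 π e ∈ coboundaries 𝒜 π e₀) : a = 0 := by
  obtain ⟨t, ht⟩ := ha
  rw [kd_eq_kd π e e₀, kd_eq_dElt] at ht
  have h := toModel_dElt_mul_topMon (kBasis 𝒜 π e) hπ t
  rw [← ht, map_smul, toModel_xiTop heven hodd, Finsupp.smul_single, Finsupp.single_eq_same,
    smul_eq_mul, mul_smul_comm, mul_one] at h
  exact (smul_eq_zero_iff_eq _).mp h

include hπ heven hodd in
theorem oddAct_xiTop_self (e : HomBasis A ℳ deg) :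
    oddAct 𝒜 π e (xiTop 𝒜 π e) = act (kBasis 𝒜 π e) (xiTop 𝒜 π e) := by
  rw [xiTop_eq, Units.smul_def, map_zsmul, map_zsmul, map_mul, map_mul, map_list_prod,
    map_list_prod, map_list_prod, map_list_prod, List.map_ofFn, List.map_ofFn, List.map_ofFn,
    List.map_ofFn]
  have h1 : (oddAct 𝒜 π e ∘ fun i => kShift 𝒜 ℳ π (e.1 (Sum.inl i))) =
      (act (kBasis 𝒜 π e) ∘ fun i => kShift 𝒜 ℳ π (e.1 (Sum.inl i))) := by
    funext i
    rw [Function.comp_apply, Function.comp_apply, oddAct_kShift, oddX_inl_inl hπ heven,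
      ← ofMod_kBasis_inl, act_ofMod_basis]
  have h2 : (oddAct 𝒜 π e ∘ fun j => kDual 𝒜 π (dualBasis 𝒜 e (Sum.inr j))) =
      (act (kBasis 𝒜 π e) ∘ fun j => kDual 𝒜 π (dualBasis 𝒜 e (Sum.inr j))) := by
    funext j
    rw [Function.comp_apply, Function.comp_apply, oddAct_kDual, oddX_inr_inr hodd,
      ← ofMod_kBasis_inr, act_ofMod_basis]
  rw [h1, h2]

-- The new top product is a cocycle, hence congruent to some multiple of the old one. Applying
-- `oddAct` to the empty monomial removes the coboundary and identifies the multiple.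
include hπ heven hodd in
theorem xiTop_sub_mem [CharZero K] (e₀ e e' : HomBasis A ℳ deg) :
    xiTop 𝒜 π e' - topCoeff deg (transGL 𝒜 e e').1 • xiTop 𝒜 π e ∈ coboundaries 𝒜 π e₀ := by
  obtain ⟨a, t, ht⟩ := exists_sub_smul_xiTop_mem hπ heven hodd e₀ e
    (kd_mul_xiTop (𝒜 := 𝒜) hπ heven hodd e₀ e')
  suffices h : a = topCoeff deg (transGL 𝒜 e e').1 by
    rw [← h]
    exact ⟨t, ht⟩
  rw [sub_eq_iff_eq_add] at ht
  have h := congrArg (fun s => oddAct 𝒜 π e s (Finsupp.single 0 1)) ht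
  rw [map_add, map_mul, kd_eq_kd π e e₀, oddAct_kd hπ, zero_mul, zero_add, GSym.smul_eq, map_mul,
    oddAct_alg, oddAct_xiTop hπ heven hodd, oddAct_xiTop_self hπ heven hodd, Module.End.mul_apply,
    Module.End.mul_apply, ← toModel_apply, toModel_xiTop heven hodd, mL_single, mL_single] at h
  have h2 := Finsupp.single_injective _ h
  rw [mul_smul_comm, mul_smul_comm, mul_one, mul_one] at h2
  exact (MulAction.injective (topSign deg π) h2).symm

-- The top class of the basis `e₀ S T` can be compared with that of `e₀` directly or through `e₀ S`.
-- Both coefficients agree because the class of `e₀` is a free generator.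
include hπ heven hodd in
theorem topCoeff_mul [CharZero K] (e₀ : HomBasis A ℳ deg) (S T : GL0 𝒜 deg) :
    topCoeff deg (S * T).1 = topCoeff deg S.1 * topCoeff deg T.1 := by
  have h1 := xiTop_sub_mem (𝒜 := 𝒜) hπ heven hodd e₀ e₀ (mulBasis e₀ S)
  have h2 := xiTop_sub_mem (𝒜 := 𝒜) hπ heven hodd e₀ (mulBasis e₀ S)
    (mulBasis (mulBasis e₀ S) T)
  have h3 := xiTop_sub_mem (𝒜 := 𝒜) hπ heven hodd e₀ e₀ (mulBasis (mulBasis e₀ S) T)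
  rw [← transGL_mul e₀ (mulBasis e₀ S), transGL_mulBasis, transGL_mulBasis] at h3
  rw [transGL_mulBasis] at h1 h2
  have h4 := sub_mem (add_mem h2 (Submodule.smul_mem _ (topCoeff deg T.1) h1)) h3
  have h5 : (topCoeff deg (S * T).1 - topCoeff deg T.1 * topCoeff deg S.1) • xiTop 𝒜 π e₀ ∈
      coboundaries 𝒜 π e₀ := by
    convert h4 using 1
    rw [sub_smul, smul_sub, smul_smul]
    abel
  have h6 := sub_eq_zero.mp (eq_zero_of_smul_xiTop_mem hπ heven hodd e₀ e₀ h5)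
  have h7 := IsGradedComm.comm (topCoeff_mem T) (topCoeff_mem S)
  rw [ksign_zero_right, one_smul] at h7
  rw [h6, h7]

end TopClass

/-! ### The graded Berezinian is a homomorphism -/

section Inverse

variable {K A : Type*} {n : ℕ} [Field K] [Ring A] [Algebra K A]
  {𝒜 : Grp n → Submodule K A} [GradedAlgebra 𝒜]

theorem pow_matrix_mem {ι : Type*} [Fintype ι] [DecidableEq ι] {g : ι → Grp n} {X : Matrix ι ι A}
    (hX : ∀ i j, X i j ∈ 𝒜 (g i + g j)) (k : ℕ) (i j : ι) : (X ^ k) i j ∈ 𝒜 (g i + g j) := by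
  induction k generalizing i j with
  | zero =>
    rw [pow_zero]
    exact one_matrix_mem g i j
  | succ k ih =>
    rw [pow_succ]
    exact mul_matrix_mem ih hX i j

theorem exists_inverse_one_sub {ι : Type*} [Fintype ι] [DecidableEq ι] {g : ι → Grp n}
    {X : Matrix ι ι A} (hX : ∀ i j, X i j ∈ 𝒜 (g i + g j)) (hn : IsNilpotent X) :
    ∃ Y : Matrix ι ι A, (∀ i j, Y i j ∈ 𝒜 (g i + g j)) ∧ (1 - X) * Y = 1 ∧ Y * (1 - X) = 1 := by
  obtain ⟨k, hk⟩ := hn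
  refine ⟨∑ l ∈ Finset.range k, X ^ l, fun i j => ?_, ?_, ?_⟩
  · rw [Matrix.sum_apply]
    exact sum_mem fun l _ => pow_matrix_mem hX l i j
  · rw [mul_neg_geom_sum, hk, sub_zero]
  · rw [geom_sum_mul_neg, hk, sub_zero]

theorem inverse_eq_of_mul_eq_one {R : Type*} [Ring R] {x y : R} (h : x * y = 1) (h' : y * x = 1) :
    Ring.inverse x = y :=
  Ring.inverse_unit ⟨x, y, h, h'⟩

end Inverse

section Gber

variable {K A : Type*} {n : ℕ} [Field K] [CharZero K] [Ring A] [Algebra K A]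
  {𝒜 : Grp n → Submodule K A} [GradedAlgebra 𝒜] [IsGradedComm 𝒜]
  {p q : ℕ} {deg : Fin p ⊕ Fin q → Grp n}
  (heven : ∀ i : Fin p, deg (Sum.inl i) ⬝ᵥ deg (Sum.inl i) = 0)
  (hodd : ∀ j : Fin q, deg (Sum.inr j) ⬝ᵥ deg (Sum.inr j) = 1)

theorem isDegZero_fromBlocks {a : Matrix (Fin p) (Fin p) A} {b : Matrix (Fin p) (Fin q) A}
    {c : Matrix (Fin q) (Fin p) A} {d : Matrix (Fin q) (Fin q) A}
    (ha : ∀ i j, a i j ∈ 𝒜 (deg (Sum.inl i) + deg (Sum.inl j)))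
    (hb : ∀ i j, b i j ∈ 𝒜 (deg (Sum.inl i) + deg (Sum.inr j)))
    (hc : ∀ i j, c i j ∈ 𝒜 (deg (Sum.inr i) + deg (Sum.inl j)))
    (hd : ∀ i j, d i j ∈ 𝒜 (deg (Sum.inr i) + deg (Sum.inr j))) :
    IsDegZero 𝒜 deg (Matrix.fromBlocks a b c d) := by
  rintro (i | i) (j | j)
  · exact ha i j
  · exact hb i j
  · exact hc i j
  · exact hd i j

theorem fromBlocks_relations {R ι ι' : Type*} [Ring R] [Fintype ι] [Fintype ι'] [DecidableEq ι]
    [DecidableEq ι'] {S T : Matrix (ι ⊕ ι') (ι ⊕ ι') R} (h : S * T = 1) :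
    S.toBlocks₁₁ * T.toBlocks₁₁ + S.toBlocks₁₂ * T.toBlocks₂₁ = 1 ∧
    S.toBlocks₁₁ * T.toBlocks₁₂ + S.toBlocks₁₂ * T.toBlocks₂₂ = 0 ∧
    S.toBlocks₂₁ * T.toBlocks₁₁ + S.toBlocks₂₂ * T.toBlocks₂₁ = 0 ∧
    S.toBlocks₂₁ * T.toBlocks₁₂ + S.toBlocks₂₂ * T.toBlocks₂₂ = 1 := by
  rw [← Matrix.fromBlocks_toBlocks S, ← Matrix.fromBlocks_toBlocks T, Matrix.fromBlocks_multiply,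
    ← Matrix.fromBlocks_one, Matrix.fromBlocks_inj] at h
  exact h

/-- Block elimination: the Schur complement is inverted by the even block of the inverse matrix.
With its mirror image `mul_schur_eq_one` it makes the block-diagonal factor of the decomposition
invertible. -/
theorem schur_mul_eq_one {R ι ι' : Type*} [Ring R] [Fintype ι] [Fintype ι'] [DecidableEq ι]
    [DecidableEq ι'] {S T : Matrix (ι ⊕ ι') (ι ⊕ ι') R} (h : S * T = 1) {D : Matrix ι' ι' R}
    (hD : D * S.toBlocks₂₂ = 1) :
    (S.toBlocks₁₁ - S.toBlocks₁₂ * D * S.toBlocks₂₁) * T.toBlocks₁₁ = 1 := by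
  obtain ⟨h1, -, h3, -⟩ := fromBlocks_relations h
  have h4 : S.toBlocks₁₂ * (D * (S.toBlocks₂₁ * T.toBlocks₁₁ + S.toBlocks₂₂ * T.toBlocks₂₁)) =
      0 := by
    rw [h3, Matrix.mul_zero, Matrix.mul_zero]
  rw [Matrix.mul_add, ← Matrix.mul_assoc D S.toBlocks₂₂, hD, Matrix.one_mul, Matrix.mul_add,
    add_comm] at h4
  rw [Matrix.sub_mul, Matrix.mul_assoc, Matrix.mul_assoc, ← h1, eq_neg_of_add_eq_zero_left h4,
    sub_eq_add_neg]

theorem mul_schur_eq_one {R ι ι' : Type*} [Ring R] [Fintype ι] [Fintype ι'] [DecidableEq ι]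
    [DecidableEq ι'] {S T : Matrix (ι ⊕ ι') (ι ⊕ ι') R} (h : S * T = 1) {D : Matrix ι' ι' R}
    (hD : T.toBlocks₂₂ * D = 1) :
    S.toBlocks₁₁ * (T.toBlocks₁₁ - T.toBlocks₁₂ * D * T.toBlocks₂₁) = 1 := by
  obtain ⟨h1, h2, -, -⟩ := fromBlocks_relations h
  have h4 : (S.toBlocks₁₁ * T.toBlocks₁₂ + S.toBlocks₁₂ * T.toBlocks₂₂) * D * T.toBlocks₂₁ =
      0 := by
    rw [h2, Matrix.zero_mul, Matrix.zero_mul]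
  rw [Matrix.add_mul, Matrix.mul_assoc S.toBlocks₁₂, hD, Matrix.mul_one, Matrix.add_mul,
    add_comm] at h4
  rw [Matrix.mul_sub, ← Matrix.mul_assoc, ← Matrix.mul_assoc, ← h1, eq_neg_of_add_eq_zero_left h4,
    sub_eq_add_neg]

-- For `S = T⁻¹` one has `T₁₁ S₁₁ = 1 - T₁₀ S₀₁`, and the product of odd blocks is nilpotent. A
-- geometric series yields a right inverse of `T₁₁`; the same argument for `S T = 1` yields a left
-- inverse.
include heven hodd in
theorem exists_inverse_toBlocks₂₂ (T : GL0 𝒜 deg) : ∃ D : Matrix (Fin q) (Fin q) A,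
    (∀ i j, D i j ∈ 𝒜 (deg (Sum.inr i) + deg (Sum.inr j))) ∧
      T.1.val.toBlocks₂₂ * D = 1 ∧ D * T.1.val.toBlocks₂₂ = 1 := by
  have h1 := (fromBlocks_relations T.1.mul_inv).2.2.2
  have h2 := (fromBlocks_relations T.1.inv_mul).2.2.2
  have hp : ∀ i j, deg (Sum.inr i) ⬝ᵥ deg (Sum.inr i) = deg (Sum.inr j) ⬝ᵥ deg (Sum.inr j) :=
    fun i j => by rw [hodd, hodd]
  have hp' : ∀ (i : Fin q) (j : Fin p), (deg (Sum.inr i) + deg (Sum.inl j)) ⬝ᵥ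
      (deg (Sum.inr i) + deg (Sum.inl j)) = 1 := fun i j => by
    rw [dotProduct_add_self, hodd, heven, add_zero]
  have hnil : ∀ {S R : Matrix (Fin p ⊕ Fin q) (Fin p ⊕ Fin q) A}, IsDegZero 𝒜 deg S →
      IsDegZero 𝒜 deg R → IsNilpotent (S.toBlocks₂₁ * R.toBlocks₁₂) ∧
        ∀ i j, (S.toBlocks₂₁ * R.toBlocks₁₂) i j ∈ 𝒜 (deg (Sum.inr i) + deg (Sum.inr j)) := by
    intro S R hS hR
    have hX : ∀ i j, S.toBlocks₂₁ i j ∈ 𝒜 (deg (Sum.inr i) + deg (Sum.inl j)) := fun i j => hS _ _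
    have hY : ∀ i j, R.toBlocks₁₂ i j ∈ 𝒜 (deg (Sum.inl i) + deg (Sum.inr j)) := fun i j => hR _ _
    exact ⟨isNilpotent_mul_of_odd (g := fun j => deg (Sum.inr j)) (g' := fun j => deg (Sum.inl j))
      hp hp' hX hY, mul_matrix_mem (g := fun j => deg (Sum.inr j))
      (g' := fun j => deg (Sum.inl j)) (g'' := fun j => deg (Sum.inr j)) hX hY⟩
  obtain ⟨hn1, hm1⟩ := hnil T.2.1 T.2.2
  obtain ⟨hn2, hm2⟩ := hnil T.2.2 T.2.1
  obtain ⟨P, hP, hP1, -⟩ := exists_inverse_one_sub (g := fun j => deg (Sum.inr j)) hm1 hn1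
  obtain ⟨Q, hQ, -, hQ2⟩ := exists_inverse_one_sub (g := fun j => deg (Sum.inr j)) hm2 hn2
  rw [← h1, add_sub_cancel_left, mul_assoc, h1] at hP1
  rw [← h2, add_sub_cancel_left, ← mul_assoc, h2] at hQ2
  refine ⟨(T.1⁻¹).val.toBlocks₂₂ * P, mul_matrix_mem (g := fun j => deg (Sum.inr j))
    (g' := fun j => deg (Sum.inr j)) (g'' := fun j => deg (Sum.inr j))
    (toBlocks₂₂_mem T.2.2) hP, hP1, ?_⟩
  rw [← left_inv_eq_right_inv hQ2 hP1]
  exact hQ2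

variable {π : Grp n} (hπ : π ⬝ᵥ π = 1)
  {M : Type*} [AddCommGroup M] [Module K M] [Module A M] [IsScalarTower K A M]
  {ℳ : Grp n → Submodule K M} [DirectSum.Decomposition ℳ] [SetLike.GradedSMul 𝒜 ℳ]

include heven hodd in
theorem topCoeff_one : topCoeff deg (1 : GL0 𝒜 deg).1 = 1 := by
  change gdet _ (1 : Matrix (Fin p ⊕ Fin q) (Fin p ⊕ Fin q) A).toBlocks₁₁ *
    gdet _ (1⁻¹ : (Matrix (Fin p ⊕ Fin q) (Fin p ⊕ Fin q) A)ˣ).val.toBlocks₂₂ = 1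
  rw [inv_one, Units.val_one, toBlocks₁₁_one, toBlocks₂₂_one,
    gdet_one (𝒜 := 𝒜) fun i j => by rw [heven, heven],
    gdet_one (𝒜 := 𝒜) fun i j => by rw [hodd, hodd], one_mul]

/-- The element of `GL⁰` with given blocks, and given blocks of the inverse. -/
def blockGL {a a' : Matrix (Fin p) (Fin p) A} {b b' : Matrix (Fin p) (Fin q) A}
    {c c' : Matrix (Fin q) (Fin p) A} {d d' : Matrix (Fin q) (Fin q) A}
    (h : Matrix.fromBlocks a b c d * Matrix.fromBlocks a' b' c' d' = 1)
    (h' : Matrix.fromBlocks a' b' c' d' * Matrix.fromBlocks a b c d = 1)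
    (hd : IsDegZero 𝒜 deg (Matrix.fromBlocks a b c d))
    (hd' : IsDegZero 𝒜 deg (Matrix.fromBlocks a' b' c' d')) : GL0 𝒜 deg :=
  ⟨⟨_, _, h, h'⟩, hd, hd'⟩

theorem topCoeff_blockGL {a a' : Matrix (Fin p) (Fin p) A} {b b' : Matrix (Fin p) (Fin q) A}
    {c c' : Matrix (Fin q) (Fin p) A} {d d' : Matrix (Fin q) (Fin q) A}
    (h : Matrix.fromBlocks a b c d * Matrix.fromBlocks a' b' c' d' = 1)
    (h' : Matrix.fromBlocks a' b' c' d' * Matrix.fromBlocks a b c d = 1)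
    (hd : IsDegZero 𝒜 deg (Matrix.fromBlocks a b c d))
    (hd' : IsDegZero 𝒜 deg (Matrix.fromBlocks a' b' c' d')) :
    topCoeff deg (blockGL h h' hd hd').1 =
      gdet (fun i => deg (Sum.inl i)) a * gdet (fun j => deg (Sum.inr j)) d' := by
  rfl

-- By multiplicativity `topCoeff` can be evaluated on a triangular decomposition. On the
-- unitriangular factors the blocks it sees are identities, and on the block-diagonal factor it is
-- the defining formula of `gber`.
include heven hodd hπ in
theorem gber_eq_topCoeff (e₀ : HomBasis A ℳ deg) (T : GL0 𝒜 deg) :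
    gber deg T.1.val = topCoeff deg T.1 := by
  obtain ⟨D, hD, hD1, hD2⟩ := exists_inverse_toBlocks₂₂ heven hodd T
  have hg1 : ∀ i j, deg (Sum.inl i) ⬝ᵥ deg (Sum.inl i) = deg (Sum.inl j) ⬝ᵥ deg (Sum.inl j) :=
    fun i j => by rw [heven, heven]
  have hg2 : ∀ i j, deg (Sum.inr i) ⬝ᵥ deg (Sum.inr i) = deg (Sum.inr j) ⬝ᵥ deg (Sum.inr j) :=
    fun i j => by rw [hodd, hodd]
  have hS1 := schur_mul_eq_one T.1.mul_inv hD2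
  have hS2 := mul_schur_eq_one T.1.inv_mul hD1
  have hb : ∀ i j, T.1.val.toBlocks₁₂ i j ∈ 𝒜 (deg (Sum.inl i) + deg (Sum.inr j)) :=
    fun i j => T.2.1 _ _
  have hc : ∀ i j, T.1.val.toBlocks₂₁ i j ∈ 𝒜 (deg (Sum.inr i) + deg (Sum.inl j)) :=
    fun i j => T.2.1 _ _
  have hbD := mul_matrix_mem (𝒜 := 𝒜) (g := fun i => deg (Sum.inl i))
    (g' := fun j => deg (Sum.inr j)) (g'' := fun j => deg (Sum.inr j)) hb hD
  have hDc := mul_matrix_mem (𝒜 := 𝒜) (g := fun j => deg (Sum.inr j))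
    (g' := fun j => deg (Sum.inr j)) (g'' := fun i => deg (Sum.inl i)) hD hc
  have hbDc := mul_matrix_mem (𝒜 := 𝒜) (g := fun i => deg (Sum.inl i))
    (g' := fun j => deg (Sum.inr j)) (g'' := fun i => deg (Sum.inl i)) hbD hc
  have hS : ∀ i j, (T.1.val.toBlocks₁₁ - T.1.val.toBlocks₁₂ * D * T.1.val.toBlocks₂₁) i j ∈
    𝒜 (deg (Sum.inl i) + deg (Sum.inl j)) := fun i j =>
    sub_mem (toBlocks₁₁_mem T.2.1 i j) (hbDc i j)
  have hone1 := one_matrix_mem (𝒜 := 𝒜) fun i => deg (Sum.inl i)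
  have hone2 := one_matrix_mem (𝒜 := 𝒜) fun j => deg (Sum.inr j)
  have hneg1 : ∀ i j, (-(T.1.val.toBlocks₁₂ * D)) i j ∈ 𝒜 (deg (Sum.inl i) + deg (Sum.inr j)) :=
    fun i j => neg_mem (hbD i j)
  have hneg2 : ∀ i j, (-(D * T.1.val.toBlocks₂₁)) i j ∈ 𝒜 (deg (Sum.inr i) + deg (Sum.inl j)) :=
    fun i j => neg_mem (hDc i j)
  rw [gber, inverse_eq_of_mul_eq_one hD1 hD2]
  let U : GL0 𝒜 deg := blockGL (a := 1) (b := T.1.val.toBlocks₁₂ * D) (c := 0) (d := 1) (a' := 1)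
    (b' := -(T.1.val.toBlocks₁₂ * D)) (c' := 0) (d' := 1)
    (by simp [Matrix.fromBlocks_multiply]) (by simp [Matrix.fromBlocks_multiply])
    (isDegZero_fromBlocks hone1 hbD (fun i j => zero_mem _) hone2)
    (isDegZero_fromBlocks hone1 hneg1 (fun i j => zero_mem _) hone2)
  let L : GL0 𝒜 deg := blockGL (a := 1) (b := 0) (c := D * T.1.val.toBlocks₂₁) (d := 1) (a' := 1)
    (b' := 0) (c' := -(D * T.1.val.toBlocks₂₁)) (d' := 1)
    (by simp [Matrix.fromBlocks_multiply]) (by simp [Matrix.fromBlocks_multiply])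
    (isDegZero_fromBlocks hone1 (fun i j => zero_mem _) hDc hone2)
    (isDegZero_fromBlocks hone1 (fun i j => zero_mem _) hneg2 hone2)
  let R : GL0 𝒜 deg := blockGL
    (a := T.1.val.toBlocks₁₁ - T.1.val.toBlocks₁₂ * D * T.1.val.toBlocks₂₁) (b := 0) (c := 0)
    (d := T.1.val.toBlocks₂₂) (a' := (T.1⁻¹).val.toBlocks₁₁) (b' := 0) (c' := 0) (d' := D)
    (by simp [Matrix.fromBlocks_multiply, hS1, hD1])
    (by simp [Matrix.fromBlocks_multiply, hS2, hD2])
    (isDegZero_fromBlocks hS (fun i j => zero_mem _) (fun i j => zero_mem _)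
      (toBlocks₂₂_mem T.2.1))
    (isDegZero_fromBlocks (toBlocks₁₁_mem T.2.2) (fun i j => zero_mem _) (fun i j => zero_mem _)
      hD)
  -- Block elimination with pivot `T₁₁`; the middle factor carries the Schur complement.
  have hT : T = U * R * L := by
    apply Subtype.ext
    apply Units.ext
    change T.1.val = Matrix.fromBlocks _ _ _ _ * Matrix.fromBlocks _ _ _ _ *
      Matrix.fromBlocks _ _ _ _
    rw [Matrix.fromBlocks_multiply, Matrix.fromBlocks_multiply]
    conv_lhs => rw [← Matrix.fromBlocks_toBlocks T.1.val]
    rw [Matrix.fromBlocks_inj]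
    refine ⟨?_, ?_, ?_, ?_⟩
    · simp only [Matrix.one_mul, Matrix.mul_zero, Matrix.mul_one, zero_add, add_zero]
      rw [Matrix.mul_assoc _ D T.1.val.toBlocks₂₂, hD2, Matrix.mul_one, Matrix.mul_assoc,
        sub_add_cancel]
    · simp [Matrix.mul_assoc, hD2]
    · simp [← Matrix.mul_assoc, hD1]
    · simp
  conv_rhs => rw [hT]
  rw [topCoeff_mul hπ heven hodd e₀, topCoeff_mul hπ heven hodd e₀, topCoeff_blockGL,
    topCoeff_blockGL, topCoeff_blockGL, gdet_one (𝒜 := 𝒜) hg1, gdet_one (𝒜 := 𝒜) hg2, one_mul,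
    one_mul, mul_one, inverse_eq_of_mul_eq_one]
  · rw [← gdet_mul hg2 (toBlocks₂₂_mem T.2.1) hD, hD1, gdet_one (𝒜 := 𝒜) hg2]
  · rw [← gdet_mul hg2 hD (toBlocks₂₂_mem T.2.1), hD2, gdet_one (𝒜 := 𝒜) hg2]

end Gber

/-! ### Values on block-diagonal and on unitriangular matrices -/

section GberHom

variable {K A : Type*} {n : ℕ} [Field K] [CharZero K] [Ring A] [Algebra K A]
  {𝒜 : Grp n → Submodule K A} [GradedAlgebra 𝒜] [IsGradedComm 𝒜]
  {p q : ℕ} {deg : Fin p ⊕ Fin q → Grp n}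
  (heven : ∀ i : Fin p, deg (Sum.inl i) ⬝ᵥ deg (Sum.inl i) = 0)
  (hodd : ∀ j : Fin q, deg (Sum.inr j) ⬝ᵥ deg (Sum.inr j) = 1)
  {π : Grp n} (hπ : π ⬝ᵥ π = 1)
  {M : Type*} [AddCommGroup M] [Module K M] [Module A M] [IsScalarTower K A M]
  {ℳ : Grp n → Submodule K M} [DirectSum.Decomposition ℳ] [SetLike.GradedSMul 𝒜 ℳ]

include heven hodd hπ in
theorem exists_gberHom (e₀ : HomBasis A ℳ deg) : ∃ g : GL0 𝒜 deg →* (𝒜 0)ˣ,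
    ∀ T, (((g T : (𝒜 0)ˣ) : 𝒜 0) : A) = topCoeff deg T.1 :=
  ⟨MonoidHom.toHomUnits
    { toFun := fun T => (⟨topCoeff deg T.1, topCoeff_mem T⟩ : 𝒜 0)
      map_one' := Subtype.ext (topCoeff_one heven hodd)
      map_mul' := fun S T => Subtype.ext (topCoeff_mul hπ heven hodd e₀ S T) }, fun _ => rfl⟩

theorem det_gblock_of_forall_ne {m : ℕ} {g : Fin m → Grp n} {X : Matrix (Fin m) (Fin m) A}
    (hX : ∀ i j, X i j ∈ 𝒜 (g i + g j)) {γ : Grp n} (h : ∀ i, g i ≠ γ) :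
    (gblock hX γ).det = 1 := by
  have : IsEmpty {i // g i = γ} := ⟨fun i => h i.1 i.2⟩
  exact Matrix.det_isEmpty

include hodd in
theorem det_gblock_toBlocks₁₁ {T : Matrix (Fin p ⊕ Fin q) (Fin p ⊕ Fin q) A}
    (hT : IsDegZero 𝒜 deg T) {γ : Grp n} (hγ : γ ⬝ᵥ γ = 0) :
    (gblock (g := fun i => deg (Sum.inl i)) (toBlocks₁₁_mem hT) γ).det = (diagBlock hT γ).det := by
  let φ : {i : Fin p // deg (Sum.inl i) = γ} → {i // deg i = γ} := fun i => ⟨Sum.inl i.1, i.2⟩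
  have hφ : Function.Bijective φ := by
    refine ⟨fun i j h => Subtype.ext (Sum.inl_injective (congrArg Subtype.val h)), ?_⟩
    rintro ⟨i | j, h⟩
    · exact ⟨⟨i, h⟩, rfl⟩
    · have h2 := hodd j
      rw [h, hγ] at h2
      exact absurd h2 zero_ne_one
  exact Matrix.det_submatrix_equiv_self (Equiv.ofBijective φ hφ) (diagBlock hT γ)

include heven in
theorem det_gblock_toBlocks₂₂ {T : Matrix (Fin p ⊕ Fin q) (Fin p ⊕ Fin q) A}
    (hT : IsDegZero 𝒜 deg T) {γ : Grp n} (hγ : γ ⬝ᵥ γ = 1) :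
    (gblock (g := fun j => deg (Sum.inr j)) (toBlocks₂₂_mem hT) γ).det = (diagBlock hT γ).det := by
  let φ : {j : Fin q // deg (Sum.inr j) = γ} → {i // deg i = γ} := fun j => ⟨Sum.inr j.1, j.2⟩
  have hφ : Function.Bijective φ := by
    refine ⟨fun i j h => Subtype.ext (Sum.inr_injective (congrArg Subtype.val h)), ?_⟩
    rintro ⟨i | j, h⟩
    · have h2 := heven i
      rw [h, hγ] at h2
      exact absurd h2 one_ne_zero
    · exact ⟨⟨j, h⟩, rfl⟩
  exact Matrix.det_submatrix_equiv_self (Equiv.ofBijective φ hφ) (diagBlock hT γ)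

-- The off-diagonal blocks vanish by parity, so the odd block of the inverse is the inverse of the
-- odd block, and its graded determinant is the inverse of a product of determinants over `A⁰`.
include heven hodd in
theorem topCoeff_of_blockDiagonal (T : GL0 𝒜 deg)
    (hT : ∀ i j, deg i ≠ deg j → T.1.val i j = 0) : topCoeff deg T.1 =
      (((∏ γ : Grp n with γ ⬝ᵥ γ = 0, (diagBlock T.2.1 γ).det) *
        ∏ γ : Grp n with γ ⬝ᵥ γ = 1, Ring.inverse (diagBlock T.2.1 γ).det : 𝒜 0) : A) := by
  have hg1 : ∀ i j, deg (Sum.inl i) ⬝ᵥ deg (Sum.inl i) = deg (Sum.inl j) ⬝ᵥ deg (Sum.inl j) :=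
    fun i j => by rw [heven, heven]
  have hg2 : ∀ i j, deg (Sum.inr i) ⬝ᵥ deg (Sum.inr i) = deg (Sum.inr j) ⬝ᵥ deg (Sum.inr j) :=
    fun i j => by rw [hodd, hodd]
  have hne : ∀ i j, deg (Sum.inl i) ≠ deg (Sum.inr j) := by
    intro i j h
    have h2 := heven i
    rw [h, hodd] at h2
    exact one_ne_zero h2
  have h1 : (∏ γ : Grp n, (gblock (g := fun i => deg (Sum.inl i))
      (toBlocks₁₁_mem T.2.1) γ).det) =
      ∏ γ : Grp n with γ ⬝ᵥ γ = 0, (diagBlock T.2.1 γ).det := by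
    rw [Finset.prod_filter]
    refine Finset.prod_congr rfl fun γ _ => ?_
    split_ifs with h
    · exact det_gblock_toBlocks₁₁ hodd T.2.1 h
    · exact det_gblock_of_forall_ne _ fun i hi => h (by rw [← hi, heven])
  have h2 : (∏ γ : Grp n, (gblock (g := fun j => deg (Sum.inr j))
      (toBlocks₂₂_mem T.2.1) γ).det) =
      ∏ γ : Grp n with γ ⬝ᵥ γ = 1, (diagBlock T.2.1 γ).det := by
    rw [Finset.prod_filter]
    refine Finset.prod_congr rfl fun γ _ => ?_
    split_ifs with h
    · exact det_gblock_toBlocks₂₂ heven T.2.1 h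
    · exact det_gblock_of_forall_ne _ fun i hi => h (by rw [← hi, hodd])
  have h3 := gdet_of_blockDiagonal hg1 (toBlocks₁₁_mem T.2.1) fun i j h => hT _ _ h
  have h4 := gdet_of_blockDiagonal hg2 (toBlocks₂₂_mem T.2.1) fun i j h => hT _ _ h
  rw [h1] at h3
  rw [h2] at h4
  have hb : T.1.val.toBlocks₁₂ = 0 := Matrix.ext fun i j => hT _ _ (hne i j)
  have hc : T.1.val.toBlocks₂₁ = 0 := Matrix.ext fun i j => hT _ _ (hne j i).symm
  have h5 : T.1.val.toBlocks₂₂ * (T.1⁻¹).val.toBlocks₂₂ = 1 := by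
    have h := (fromBlocks_relations T.1.mul_inv).2.2.2
    rwa [hc, Matrix.zero_mul, zero_add] at h
  have h6 := gdet_mul hg2 (toBlocks₂₂_mem T.2.1) (toBlocks₂₂_mem T.2.2)
  rw [h5, gdet_one (𝒜 := 𝒜) hg2, h4] at h6
  have h7 : (∏ γ : Grp n with γ ⬝ᵥ γ = 1, (diagBlock T.2.1 γ).det) *
      ⟨_, gdet_mem (toBlocks₂₂_mem T.2.2)⟩ = 1 := Subtype.ext h6.symm
  have h8 : (∏ γ : Grp n with γ ⬝ᵥ γ = 1, Ring.inverse (diagBlock T.2.1 γ).det) =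
      ⟨_, gdet_mem (toBlocks₂₂_mem T.2.2)⟩ := by
    have h := map_prod (MonoidWithZero.inverse : 𝒜 0 →*₀ 𝒜 0)
      (fun γ => (diagBlock T.2.1 γ).det) {γ : Grp n | γ ⬝ᵥ γ = 1}
    refine h.symm.trans ?_
    exact inverse_eq_of_mul_eq_one h7 ((mul_comm _ _).trans h7)
  rw [h8, topCoeff, h3]
  rfl

/-- In column `j` of `S * T = 1`, the terms with `f l ≤ f j` and `l ≠ j` vanish because of `T`, and
those with `f l > f j` because of the induction hypothesis on `S`. The induction runs downwards on
`f j`, so it is phrased with `B - f j` for an upper bound `B`. -/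
theorem inverse_unitriangular {R ι : Type*} [Ring R] [Fintype ι] [DecidableEq ι] (f : ι → ℕ)
    {S T : Matrix ι ι R} (h : S * T = 1) (hT : ∀ i j, f i ≤ f j → T i j = if i = j then 1 else 0)
    (i j : ι) (hij : f i ≤ f j) : S i j = if i = j then 1 else 0 := by
  obtain ⟨B, hB⟩ : ∃ B, ∀ i, f i ≤ B := ⟨∑ i, f i, fun i =>
    Finset.single_le_sum (f := f) (fun _ _ => Nat.zero_le _) (Finset.mem_univ i)⟩
  induction hk : B - f j using Nat.strong_induction_on generalizing j with
  | _ k ih =>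
    have h1 := congrFun (congrFun h i) j
    rw [Matrix.mul_apply, Finset.sum_eq_single j, hT j j le_rfl, if_pos rfl, mul_one,
      Matrix.one_apply] at h1
    · exact h1
    · intro l _ hl
      by_cases hlj : f l ≤ f j
      · rw [hT l j hlj, if_neg hl, mul_zero]
      · have h2 := hB l
        rw [ih (B - f l) (by omega) l (by omega) rfl, if_neg (by rintro rfl; exact hlj hij),
          zero_mul]
    · simp

-- Since `topCoeff` involves a block of the inverse, unitriangularity has to be known for the
-- inverse as well.
include heven hodd in
theorem topCoeff_of_unitriangular {f : Grp n → ℕ} (hf : Function.Injective f) (T : GL0 𝒜 deg)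
    (h1 : ∀ i j, deg i = deg j → T.1.val i j = if i = j then 1 else 0)
    (h0 : ∀ i j, f (deg i) < f (deg j) → T.1.val i j = 0) : topCoeff deg T.1 = 1 := by
  have hT : ∀ i j, f (deg i) ≤ f (deg j) → T.1.val i j = if i = j then 1 else 0 := by
    intro i j h
    rcases h.lt_or_eq with h | h
    · rw [h0 i j h, if_neg (by rintro rfl; exact lt_irrefl _ h)]
    · exact h1 i j (hf h)
  have hT' := inverse_unitriangular (fun i => f (deg i)) T.1.inv_mul hT
  rw [topCoeff, gdet_eq_one_of_unitriangular (fun i j => by rw [heven, heven])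
    (toBlocks₁₁_mem T.2.1) f hf, gdet_eq_one_of_unitriangular (fun i j => by rw [hodd, hodd])
    (toBlocks₂₂_mem T.2.2) f hf, one_mul]
  · intro i j h
    change (T.1⁻¹).val (Sum.inr i) (Sum.inr j) = _
    rw [hT' _ _ (congrArg f h).le]
    simp
  · intro i j h
    change (T.1⁻¹).val (Sum.inr i) (Sum.inr j) = _
    rw [hT' _ _ h.le, if_neg]
    rintro h2
    rw [Sum.inr_injective h2] at h
    exact lt_irrefl _ h
  · intro i j h
    change T.1.val (Sum.inl i) (Sum.inl j) = _
    rw [hT _ _ (congrArg f h).le]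
    simp
  · intro i j h
    exact h0 _ _ h

end GberHom

/-! ### The complex -/

section Complex

variable {K A : Type*} {n : ℕ} [Field K] [Ring A] [Algebra K A]
  {𝒜 : Grp n → Submodule K A} [GradedAlgebra 𝒜] [IsGradedComm 𝒜]
  {M : Type*} [AddCommGroup M] [Module K M] [Module A M] [IsScalarTower K A M]
  {ℳ : Grp n → Submodule K M} [DirectSum.Decomposition ℳ] [SetLike.GradedSMul 𝒜 ℳ]
  {p q : ℕ} {deg : Fin p ⊕ Fin q → Grp n} {π : Grp n}

theorem gcomm_dElt {ι : Type*} [Fintype ι] {deg : ι → Grp n}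
    {N : Type*} [AddCommGroup N] [Module K N] [Module A N]
    {𝒩 : Grp n → Submodule K N} (b : AdaptedBasis 𝒜 𝒩 (kdeg deg π)) :
    GComm π π (dElt b) (dElt b) := by
  have hd : ∀ i : ι, kdeg deg π (Sum.inl i) + kdeg deg π (Sum.inr i) = π := fun i => by
    rw [kdeg, kdeg, add_right_comm, grp_add_self, zero_add]
  refine GComm.sum_left _ fun i _ => GComm.sum_right _ fun j _ => ?_
  have h := ((GSym.gcomm_ofMod (𝒜 := 𝒜) (b.mem (Sum.inl i)) (b.mem (Sum.inl j))).mul_left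
    (GSym.gcomm_ofMod (𝒜 := 𝒜) (b.mem (Sum.inr i)) (b.mem (Sum.inl j)))).mul_right
    ((GSym.gcomm_ofMod (𝒜 := 𝒜) (b.mem (Sum.inl i)) (b.mem (Sum.inr j))).mul_left
    (GSym.gcomm_ofMod (𝒜 := 𝒜) (b.mem (Sum.inr i)) (b.mem (Sum.inr j))))
  rwa [hd, hd] at h

/-- As `d` has the odd degree `π`, graded commutativity makes its square equal to its own negative,
and two is invertible. -/
theorem kd_mul_kd [CharZero K] (hπ : π ⬝ᵥ π = 1) (e : HomBasis A ℳ deg) :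
    kd 𝒜 π e * kd 𝒜 π e = 0 := by
  have h := gcomm_dElt (kBasis 𝒜 π e)
  rw [GComm, ksign_self_of_odd hπ, Units.neg_smul, one_smul, eq_neg_iff_add_eq_zero, ← two_smul K,
    smul_eq_zero_iff_right two_ne_zero, ← kd_eq_dElt] at h
  exact h

/-- The number of odd variables. -/
def oddWeight : (Fin p ⊕ Fin q) ⊕ (Fin p ⊕ Fin q) → ℕ
  | Sum.inl (Sum.inl _) => 1
  | Sum.inl (Sum.inr _) => 0
  | Sum.inr (Sum.inl _) => 0
  | Sum.inr (Sum.inr _) => 1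

/-- The basis element that corresponds to one of the variables `x_i`, `ξ_i`. -/
def varIndex : (Fin p ⊕ Fin q) ⊕ (Fin p ⊕ Fin q) → (Fin p ⊕ Fin q) ⊕ (Fin p ⊕ Fin q)
  | Sum.inl (Sum.inl i) => Sum.inr (Sum.inl i)
  | Sum.inl (Sum.inr j) => Sum.inl (Sum.inr j)
  | Sum.inr (Sum.inl i) => Sum.inl (Sum.inl i)
  | Sum.inr (Sum.inr j) => Sum.inr (Sum.inr j)

theorem varIndex_surjective : Function.Surjective (varIndex (p := p) (q := q)) := by
  rintro ((i | j) | (i | j))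
  · exact ⟨Sum.inr (Sum.inl i), rfl⟩
  · exact ⟨Sum.inl (Sum.inr j), rfl⟩
  · exact ⟨Sum.inl (Sum.inl i), rfl⟩
  · exact ⟨Sum.inr (Sum.inr j), rfl⟩

theorem oddWeight_varIndex (w : (Fin p ⊕ Fin q) ⊕ (Fin p ⊕ Fin q)) :
    oddWeight (varIndex w) = if w.isRight then 1 else 0 := by
  rcases w with (i | j) | (i | j) <;> rfl

theorem exists_var_eq (e : HomBasis A ℳ deg) (w : (Fin p ⊕ Fin q) ⊕ (Fin p ⊕ Fin q)) :
    ∃ u : ℤˣ, Sum.elim (xvar 𝒜 π e) (xivar 𝒜 π e) w =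
      u • GSym.ofMod 𝒜 _ ((kBasis 𝒜 π e).basis (varIndex w)) := by
  rcases w with (i | j) | (i | j)
  · exact ⟨1, by rw [one_smul, varIndex, ofMod_kBasis_inr]; rfl⟩
  · exact ⟨1, by rw [one_smul, varIndex, ofMod_kBasis_inl]; rfl⟩
  · exact ⟨1, by rw [one_smul, varIndex, ofMod_kBasis_inl]; rfl⟩
  · exact ⟨-ksign (deg (Sum.inr j)) π, by
      rw [varIndex, ofMod_kBasis_inr, Units.neg_smul]; rfl⟩

theorem units_smul_mem_level (e : HomBasis A ℳ deg) {k : ℕ} {s : Koszul 𝒜 ℳ π} (u : ℤˣ)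
    (hs : s ∈ level 𝒜 π e k) : u • s ∈ level 𝒜 π e k := by
  rw [Units.smul_def]
  exact zsmul_mem hs _

theorem ofMod_mul_mem_level (e : HomBasis A ℳ deg) (v : (Fin p ⊕ Fin q) ⊕ (Fin p ⊕ Fin q)) {k : ℕ}
    {s : Koszul 𝒜 ℳ π} (hs : s ∈ level 𝒜 π e k) :
    GSym.ofMod 𝒜 _ ((kBasis 𝒜 π e).basis v) * s ∈ level 𝒜 π e (oddWeight v + k) := by
  refine Submodule.span_induction (p := fun s _ =>
    GSym.ofMod 𝒜 _ ((kBasis 𝒜 π e).basis v) * s ∈ level 𝒜 π e (oddWeight v + k)) ?_ ?_ ?_ ?_ hs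
  · rintro _ ⟨l, hl, rfl⟩
    obtain ⟨w, rfl⟩ := varIndex_surjective v
    obtain ⟨u, hu⟩ := exists_var_eq (𝒜 := 𝒜) (π := π) e w
    have h : GSym.ofMod 𝒜 _ ((kBasis 𝒜 π e).basis (varIndex w)) *
        (l.map (Sum.elim (xvar 𝒜 π e) (xivar 𝒜 π e))).prod =
        u • ((w :: l).map (Sum.elim (xvar 𝒜 π e) (xivar 𝒜 π e))).prod := by
      rw [List.map_cons, List.prod_cons, hu, smul_mul_assoc, smul_smul, Int.units_mul_self,
        one_smul]
    rw [h]
    refine units_smul_mem_level e u (Submodule.subset_span ⟨w :: l, ?_, rfl⟩)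
    rw [List.countP_cons, hl, oddWeight_varIndex, add_comm]
  · rw [mul_zero]
    exact zero_mem _
  · intro s t _ _ hs ht
    rw [mul_add]
    exact add_mem hs ht
  · intro a s _ hs
    rw [GSym.smul_eq, ← mul_assoc, GSym.ofMod_mul_ofAlg 𝒜 _ ((kBasis 𝒜 π e).mem v), mul_assoc,
      ← GSym.smul_eq]
    exact Submodule.smul_mem _ _ hs

theorem kd_mul_mem_level (e₀ e : HomBasis A ℳ deg) {k : ℕ} {s : Koszul 𝒜 ℳ π}
    (hs : s ∈ level 𝒜 π e k) : kd 𝒜 π e₀ * s ∈ level 𝒜 π e (k + 1) := by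
  rw [kd_eq_kd π e e₀, kd_eq_dElt, dElt, Finset.sum_mul]
  refine sum_mem fun i _ => ?_
  rw [mul_assoc]
  have h := ofMod_mul_mem_level e (Sum.inl i) (ofMod_mul_mem_level e (Sum.inr i) hs)
  rcases i with i | j
  · simpa only [oddWeight, zero_add, add_comm 1] using h
  · simpa only [oddWeight, zero_add, add_comm 1] using h

/-- The number of odd variables in a monomial. -/
def oddCount (m : Multiset ((Fin p ⊕ Fin q) ⊕ (Fin p ⊕ Fin q))) : ℕ := (m.map oddWeight).sum

theorem oddCount_cons (v : (Fin p ⊕ Fin q) ⊕ (Fin p ⊕ Fin q))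
    (m : Multiset ((Fin p ⊕ Fin q) ⊕ (Fin p ⊕ Fin q))) :
    oddCount (v ::ₘ m) = oddWeight v + oddCount m := by
  rw [oddCount, Multiset.map_cons, Multiset.sum_cons, oddCount]

theorem lmon_mem_level (e : HomBasis A ℳ deg)
    (l : List ((Fin p ⊕ Fin q) ⊕ (Fin p ⊕ Fin q))) :
    lmon (kBasis 𝒜 π e) l ∈ level 𝒜 π e (oddCount (Multiset.ofList l)) := by
  induction l with
  | nil => exact Submodule.subset_span ⟨[], rfl, by simp [lmon, lsign]⟩
  | cons v l ih =>
    rw [lmon_cons, ← Multiset.cons_coe, oddCount_cons]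
    exact units_smul_mem_level e _ (ofMod_mul_mem_level e v ih)

theorem mmon_mem_level (e : HomBasis A ℳ deg)
    (m : Multiset ((Fin p ⊕ Fin q) ⊕ (Fin p ⊕ Fin q))) :
    mmon (kBasis 𝒜 π e) m ∈ level 𝒜 π e (oddCount m) := by
  induction m using Quotient.inductionOn with
  | h l => exact lmon_mem_level e l

/-- A product of variables has at most one monomial in its coordinates, and `varIndex` matches the
variables `ξ_i` with the odd basis elements, so the level is visible in the support. -/
theorem toModel_mem_supported (e : HomBasis A ℳ deg) {k : ℕ} {s : Koszul 𝒜 ℳ π}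
    (hs : s ∈ level 𝒜 π e k) :
    toModel (kBasis 𝒜 π e) s ∈ Finsupp.supported A A {m | oddCount m = k} := by
  have h : level 𝒜 π e k ≤ (Finsupp.supported A A {m | oddCount m = k}).comap
      (toModel (kBasis 𝒜 π e)) := by
    refine Submodule.span_le.mpr ?_
    rintro _ ⟨l, hl, rfl⟩
    have h2 : ∃ m a, oddCount m = l.countP Sum.isRight ∧ toModel (kBasis 𝒜 π e)
        (l.map (Sum.elim (xvar 𝒜 π e) (xivar 𝒜 π e))).prod = Finsupp.single m a := by
      clear hl
      induction l with
      | nil => exact ⟨0, 1, rfl, toModel_one _⟩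
      | cons w l ih =>
        obtain ⟨m, a, hm, h⟩ := ih
        obtain ⟨u, hu⟩ := exists_var_eq (𝒜 := 𝒜) (π := π) e w
        refine ⟨varIndex w ::ₘ m, u • ((mulCoeff (kdeg deg π) (varIndex w) m : K) •
          signAut 𝒜 (kdeg deg π (varIndex w)) a), ?_, ?_⟩
        swap
        · rw [List.map_cons, List.prod_cons, hu, smul_mul_assoc, toModel_units_smul,
            toModel_ofMod_mul, h, mX_single, Finsupp.smul_single]
        · rw [oddCount, Multiset.map_cons, Multiset.sum_cons, List.countP_cons,
            oddWeight_varIndex, add_comm]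
          exact congrArg (· + _) hm
    obtain ⟨m, a, hm, h⟩ := h2
    rw [SetLike.mem_coe, Submodule.mem_comap, h]
    exact Finsupp.single_mem_supported A a (hm.trans hl)
  exact h hs

/-- Independence comes from disjoint supports in the model and injectivity of `toModel`; every
element is a combination of normalized monomials, each of which lies in one level. -/
theorem level_isInternal [CharZero K] (e : HomBasis A ℳ deg) :
    DirectSum.IsInternal (level 𝒜 π e) := by
  rw [DirectSum.isInternal_submodule_iff_iSupIndep_and_iSup_eq_top]
  constructor
  · intro k
    have h2 : ⨆ j, ⨆ (_ : j ≠ k), level 𝒜 π e j ≤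
        (Finsupp.supported A A {m | oddCount m ≠ k}).comap (toModel (kBasis 𝒜 π e)) :=
      iSup₂_le fun j hj s hs => Finsupp.supported_mono (fun m (hm : oddCount m = j) => hm.trans_ne hj)
        (toModel_mem_supported e hs)
    rw [Submodule.disjoint_def]
    intro s hs hs'
    have h3 := toModel_mem_supported e hs
    have h4 : _ ∈ Finsupp.supported A A {m | oddCount m ≠ k} := h2 hs'
    apply toModel_injective (kBasis 𝒜 π e)
    rw [map_zero]
    have h5 : Disjoint {m : Multiset ((Fin p ⊕ Fin q) ⊕ (Fin p ⊕ Fin q)) | oddCount m = k}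
      {m | oddCount m ≠ k} := Set.disjoint_left.mpr fun m h h' => h' h
    exact Submodule.disjoint_def.mp (Finsupp.disjoint_supported_supported h5) _ h3 h4
  · rw [eq_top_iff]
    intro s _
    rw [← ofModel_toModel (kBasis 𝒜 π e) s]
    induction toModel (kBasis 𝒜 π e) s using Finsupp.induction_linear with
    | zero =>
      rw [map_zero]
      exact zero_mem _
    | add f g hf hg =>
      rw [map_add]
      exact add_mem hf hg
    | single m c =>
      rw [ofModel_single]
      exact Submodule.smul_mem _ _ (Submodule.mem_iSup_of_mem _ (mmon_mem_level e m))

end Complex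

/-! ### The graded Berezinian module -/

section Internal

variable {K A : Type*} {n : ℕ} [Field K] [Ring A] [Algebra K A]
  (𝒜 : Grp n → Submodule K A) [GradedAlgebra 𝒜]

theorem isInternal_of_eq_map {H : Type*} [AddCommGroup H] [Module K H] (φ : A ≃ₗ[K] H) (δ : Grp n)
    {ℋ : Grp n → Submodule K H} (h : ∀ γ, ℋ γ = (𝒜 (γ + δ)).map φ.toLinearMap) :
    DirectSum.IsInternal ℋ := by
  have h0 := DirectSum.Decomposition.isInternal 𝒜
  rw [DirectSum.isInternal_submodule_iff_iSupIndep_and_iSup_eq_top] at h0 ⊢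
  have hℋ : ℋ = (Submodule.orderIsoMapComap φ ∘ 𝒜) ∘ Equiv.addRight δ := funext h
  constructor
  · rw [hℋ]
    exact (h0.1.map_orderIso (Submodule.orderIsoMapComap φ)).comp (Equiv.addRight δ).injective
  · have h2 : ⨆ γ, ℋ γ = ⨆ γ, (Submodule.orderIsoMapComap φ ∘ 𝒜) γ := by
      rw [hℋ]
      exact Equiv.iSup_comp (Equiv.addRight δ)
    rw [h2]
    change ⨆ γ, Submodule.orderIsoMapComap φ (𝒜 γ) = ⊤
    rw [← OrderIso.map_iSup, h0.2, OrderIso.map_top]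

end Internal

section GBer

variable {K A : Type*} {n : ℕ} [Field K] [CharZero K] [Ring A] [Algebra K A]
  {𝒜 : Grp n → Submodule K A} [GradedAlgebra 𝒜] [IsGradedComm 𝒜]
  {p q : ℕ} {deg : Fin p ⊕ Fin q → Grp n}
  (heven : ∀ i : Fin p, deg (Sum.inl i) ⬝ᵥ deg (Sum.inl i) = 0)
  (hodd : ∀ j : Fin q, deg (Sum.inr j) ⬝ᵥ deg (Sum.inr j) = 1)
  {π : Grp n} (hπ : π ⬝ᵥ π = 1)
  {M : Type*} [AddCommGroup M] [Module K M] [Module A M] [IsScalarTower K A M]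
  {ℳ : Grp n → Submodule K M} [DirectSum.Decomposition ℳ] [SetLike.GradedSMul 𝒜 ℳ]

include hπ heven hodd in
theorem gber_transition (e e' : HomBasis A ℳ deg) :
    gber deg (transition 𝒜 e e') = topCoeff deg (transGL 𝒜 e e').1 :=
  gber_eq_topCoeff heven hodd hπ e (transGL 𝒜 e e')

include hπ heven hodd in
theorem gber_transition_mem (e e' : HomBasis A ℳ deg) : gber deg (transition 𝒜 e e') ∈ 𝒜 0 := by
  rw [gber_transition heven hodd hπ]
  exact topCoeff_mem _

theorem bsym_eq (e e' : HomBasis A ℳ deg) :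
    bsym 𝒜 e' = gber deg (transition 𝒜 e e') • bsym 𝒜 e := by
  rw [bsym, bsym, ← Submodule.Quotient.mk_smul, Finsupp.smul_single, smul_eq_mul, mul_one,
    Submodule.Quotient.eq]
  exact Submodule.subset_span ⟨e, e', rfl⟩

theorem mk_single (e : HomBasis A ℳ deg) (a : A) :
    (Submodule.Quotient.mk (Finsupp.single e a) : GBer 𝒜 ℳ deg) = a • bsym 𝒜 e := by
  rw [bsym, ← Submodule.Quotient.mk_smul, Finsupp.smul_single, smul_eq_mul, mul_one]

variable (𝒜) in
/-- The coordinate with respect to `B(e)`, on the free module on the symbols. -/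
noncomputable def coordLift (e : HomBasis A ℳ deg) : (HomBasis A ℳ deg →₀ A) →ₗ[A] A :=
  Finsupp.lsum ℕ fun e' => LinearMap.toSpanSingleton A A (gber deg (transition 𝒜 e e'))

theorem coordLift_single (e e' : HomBasis A ℳ deg) (a : A) :
    coordLift 𝒜 e (Finsupp.single e' a) = a * gber deg (transition 𝒜 e e') := by
  simp [coordLift]

-- The coordinate respects the relation between `e'` and `e''` because `gber` is multiplicative
-- along `e`, `e'`, `e''`. This is what prevents the module from collapsing.
include hπ heven hodd in
theorem gberRel_le_ker (e : HomBasis A ℳ deg) :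
    gberRel 𝒜 ℳ deg ≤ LinearMap.ker (coordLift 𝒜 e) := by
  refine Submodule.span_le.mpr ?_
  rintro _ ⟨e', e'', rfl⟩
  rw [SetLike.mem_coe, LinearMap.mem_ker, map_sub, coordLift_single, coordLift_single, one_mul,
    gber_transition heven hodd hπ, gber_transition heven hodd hπ, gber_transition heven hodd hπ,
    ← transGL_mul e e' e'', topCoeff_mul hπ heven hodd e]
  have h := IsGradedComm.comm (topCoeff_mem (transGL 𝒜 e e')) (topCoeff_mem (transGL 𝒜 e' e''))
  rw [ksign_zero_right, one_smul] at h
  rw [h, sub_self]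

include hπ heven hodd in
theorem bijective_smul_bsym (e : HomBasis A ℳ deg) :
    Function.Bijective fun a : A => a • bsym 𝒜 e := by
  constructor
  · intro a b h
    have h2 := congrArg ((gberRel 𝒜 ℳ deg).liftQ _ (gberRel_le_ker heven hodd hπ e)) h
    simp only [map_smul, bsym, ← Submodule.mkQ_apply] at h2
    rw [Submodule.mkQ_apply, Submodule.liftQ_apply, coordLift_single, one_mul,
      gber_transition heven hodd hπ, topCoeff_transGL_self 𝒜 heven hodd] at h2
    simpa using h2
  · intro x
    obtain ⟨f, rfl⟩ := Submodule.Quotient.mk_surjective _ x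
    induction f using Finsupp.induction_linear with
    | zero => exact ⟨0, zero_smul _ _⟩
    | add f g hf hg =>
      obtain ⟨a, ha⟩ := hf
      obtain ⟨b, hb⟩ := hg
      refine ⟨a + b, ?_⟩
      simp only at ha hb ⊢
      rw [add_smul, ha, hb, Submodule.Quotient.mk_add]
    | single e' a =>
      refine ⟨a * gber deg (transition 𝒜 e e'), ?_⟩
      simp only
      rw [mk_single, bsym_eq e e', smul_smul]

/-- The isomorphism `a ↦ a B(e)`. -/
noncomputable def gberEquiv (e : HomBasis A ℳ deg) : A ≃ₗ[K] GBer 𝒜 ℳ deg :=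
  LinearEquiv.ofBijective ((LinearMap.toSpanSingleton A (GBer 𝒜 ℳ deg) (bsym 𝒜 e)).restrictScalars K)
    (bijective_smul_bsym heven hodd hπ e)

theorem gberEquiv_apply (e : HomBasis A ℳ deg) (a : A) :
    gberEquiv (K := K) heven hodd hπ e a = a • bsym 𝒜 e := rfl

theorem gberGrading_eq (e : HomBasis A ℳ deg) (γ : Grp n) :
    gberGrading 𝒜 ℳ deg γ =
      (𝒜 (γ + ∑ i, deg i)).map (gberEquiv (𝒜 := 𝒜) heven hodd hπ e).toLinearMap := by
  apply le_antisymm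
  · refine Submodule.span_le.mpr ?_
    rintro _ ⟨e', α, a, ha, rfl, rfl⟩
    refine ⟨a * gber deg (transition 𝒜 e e'), ?_, ?_⟩
    · have h := SetLike.GradedMul.mul_mem ha (gber_transition_mem (𝒜 := 𝒜) heven hodd hπ e e')
      rw [add_zero] at h
      rwa [grp_add_add_cancel_right]
    · change (a * gber deg (transition 𝒜 e e')) • bsym 𝒜 e = _
      rw [bsym_eq e e', smul_smul]
  · rintro _ ⟨a, ha, rfl⟩
    exact Submodule.subset_span ⟨e, _, a, ha, grp_add_add_cancel_right _ _, rfl⟩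

include heven hodd hπ in
theorem gberGrading_isInternal (e : HomBasis A ℳ deg) :
    DirectSum.IsInternal (gberGrading 𝒜 ℳ deg) :=
  isInternal_of_eq_map 𝒜 (gberEquiv heven hodd hπ e) _ (gberGrading_eq heven hodd hπ e)

end GBer

/-! ### The grading of the cohomology -/

section HomogeneousPart

variable {K A : Type*} {n : ℕ} [Field K] [Ring A] [Algebra K A]
  {𝒜 : Grp n → Submodule K A} [GradedAlgebra 𝒜] [IsGradedComm 𝒜]
  {V : Type*} {dv : V → Grp n} [Fintype V] [DecidableEq V]
  {N : Type*} [AddCommGroup N] [Module K N] [Module A N]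
  {𝒩 : Grp n → Submodule K N} (b : AdaptedBasis 𝒜 𝒩 dv)

variable (𝒜 dv) in
/-- The homogeneous elements of degree `β` of the model. -/
def homPart (β : Grp n) : Submodule K (Multiset V →₀ A) where
  carrier := {f | ∀ m, f m ∈ 𝒜 (β + mdeg dv m)}
  zero_mem' _ := zero_mem _
  add_mem' hf hg m := add_mem (hf m) (hg m)
  smul_mem' k _ hf m := Submodule.smul_mem _ k (hf m)

theorem single_mem_homPart {β : Grp n} {m : Multiset V} {a : A} (ha : a ∈ 𝒜 (β + mdeg dv m)) :
    Finsupp.single m a ∈ homPart 𝒜 dv β := by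
  intro m'
  by_cases h : m' = m
  · subst h
    rwa [Finsupp.single_eq_same]
  · rw [Finsupp.single_eq_of_ne h]
    exact zero_mem _

theorem mX_mem_homPart (v : V) {β : Grp n} {f : Multiset V →₀ A} (hf : f ∈ homPart 𝒜 dv β) :
    mX (K := K) 𝒜 dv v f ∈ homPart 𝒜 dv (dv v + β) := by
  rw [← f.sum_single, map_finsuppSum]
  refine sum_mem fun m _ => ?_
  simp only
  rw [mX_single]
  refine single_mem_homPart (Submodule.smul_mem _ _ (signAut_mem 𝒜 ?_))
  rw [mdeg_cons, add_add_add_comm, grp_add_self, zero_add]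
  exact hf m

theorem mL_mem_homPart {α β : Grp n} {a : A} (ha : a ∈ 𝒜 α) {f : Multiset V →₀ A}
    (hf : f ∈ homPart 𝒜 dv β) : mL K A V a f ∈ homPart 𝒜 dv (α + β) := by
  intro m
  rw [add_assoc]
  exact SetLike.GradedMul.mul_mem ha (hf m)

theorem act_mem_homPart {α : Grp n} {s : GSym 𝒜 𝒩} (hs : GSym.IsMonomial 𝒜 𝒩 α s) {β : Grp n}
    {f : Multiset V →₀ A} (hf : f ∈ homPart 𝒜 dv β) : act b s f ∈ homPart 𝒜 dv (α + β) := by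
  induction hs generalizing β f with
  | alg ha =>
    rw [act_ofAlg]
    exact mL_mem_homPart ha hf
  | mod hx =>
    rw [act, GSym.lift_ofMod, LinearMap.sum_apply]
    refine sum_mem fun v _ => ?_
    have h := mL_mem_homPart (K := K) (b.repr_mem hx v) (mX_mem_homPart v hf)
    rwa [← add_assoc, grp_add_add_cancel_right] at h
  | mul _ _ ih1 ih2 =>
    rw [map_mul, add_assoc]
    exact ih1 (ih2 hf)

/-- Homogeneous elements have homogeneous coordinates. Applied at `topMon`, this gives the degree of
the coefficient of a homogeneous cocycle. -/
theorem toModel_mem_homPart {γ : Grp n} {s : GSym 𝒜 𝒩} (hs : s ∈ GSym.grading 𝒜 𝒩 γ) :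
    toModel b s ∈ homPart 𝒜 dv γ := by
  have h1 : (Finsupp.single 0 1 : Multiset V →₀ A) ∈ homPart 𝒜 dv 0 :=
    single_mem_homPart (by simpa [mdeg] using SetLike.GradedOne.one_mem)
  rw [toModel_apply]
  refine Submodule.span_induction (p := fun s _ => act b s (Finsupp.single 0 1) ∈
    homPart 𝒜 dv γ) ?_ ?_ ?_ ?_ hs
  · intro s hs
    have h := act_mem_homPart b hs h1
    rwa [add_zero] at h
  · rw [map_zero]
    exact zero_mem _
  · intro s t _ _ hs ht
    rw [map_add]
    exact add_mem hs ht
  · intro k s _ hs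
    rw [map_smul]
    exact Submodule.smul_mem _ _ hs

theorem isMonomial_prod (l : List V) : GSym.IsMonomial 𝒜 𝒩 (mdeg dv (l : Multiset V))
    (l.map fun v => GSym.ofMod 𝒜 𝒩 (b.basis v)).prod := by
  induction l with
  | nil =>
    have h := GSym.IsMonomial.alg (𝒩 := 𝒩) (SetLike.GradedOne.one_mem (A := 𝒜))
    rwa [map_one] at h
  | cons v l ih =>
    rw [← Multiset.cons_coe, mdeg_cons, List.map_cons, List.prod_cons]
    exact GSym.IsMonomial.mul (GSym.IsMonomial.mod (b.mem v)) ih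

theorem smul_mmon_mem_grading {β : Grp n} {a : A} (ha : a ∈ 𝒜 β) (m : Multiset V) :
    a • mmon b m ∈ GSym.grading 𝒜 𝒩 (β + mdeg dv m) := by
  induction m using Quotient.inductionOn with
  | h l =>
    change a • lmon b l ∈ _
    rw [lmon, GSym.smul_eq, mul_smul_comm]
    exact units_smul_mem
      (Submodule.subset_span (GSym.IsMonomial.mul (GSym.IsMonomial.alg ha) (isMonomial_prod b l)))

end HomogeneousPart

/-! ### Freeness and grading of the cohomology -/

section Cohomology

variable {K A : Type*} {n : ℕ} [Field K] [CharZero K] [Ring A] [Algebra K A]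
  {𝒜 : Grp n → Submodule K A} [GradedAlgebra 𝒜] [IsGradedComm 𝒜]
  {p q : ℕ} {deg : Fin p ⊕ Fin q → Grp n}
  (heven : ∀ i : Fin p, deg (Sum.inl i) ⬝ᵥ deg (Sum.inl i) = 0)
  (hodd : ∀ j : Fin q, deg (Sum.inr j) ⬝ᵥ deg (Sum.inr j) = 1)
  {π : Grp n} (hπ : π ⬝ᵥ π = 1)
  {M : Type*} [AddCommGroup M] [Module K M] [Module A M] [IsScalarTower K A M]
  {ℳ : Grp n → Submodule K M} [DirectSum.Decomposition ℳ] [SetLike.GradedSMul 𝒜 ℳ]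

-- Each of the `p` even basis elements contributes a `Π e_i`, shifted by `π`, and each odd one
-- contributes an unshifted `ε^i`. This is where the degree `p • π` of the isomorphism comes from.
include heven hodd in
theorem mdeg_topMon : mdeg (kdeg deg π) (topMon deg) = ∑ i, deg i + p • π := by
  rw [mdeg, topMon, Multiset.map_map]
  change ∑ i, kdeg deg π (od deg i) = _
  rw [Fintype.sum_sum_type, Fintype.sum_sum_type]
  simp only [od_inl heven, od_inr hodd, kdeg]
  rw [Finset.sum_add_distrib, Finset.sum_const, Finset.card_univ, Fintype.card_fin,
    add_right_comm]

variable (𝒜) in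
/-- The class of `ξ_1 ⋯ ξ_r`. -/
noncomputable def xiClass (e₀ e : HomBasis A ℳ deg) : Cohomology 𝒜 π e₀ :=
  Submodule.Quotient.mk ⟨xiTop 𝒜 π e, kd_mul_xiTop hπ heven hodd e₀ e⟩

theorem xiClass_eq (e₀ e e' : HomBasis A ℳ deg) : xiClass 𝒜 heven hodd hπ e₀ e' =
    topCoeff deg (transGL 𝒜 e e').1 • xiClass 𝒜 heven hodd hπ e₀ e := by
  rw [xiClass, xiClass, ← Submodule.Quotient.mk_smul, Submodule.Quotient.eq]
  exact xiTop_sub_mem hπ heven hodd e₀ e e'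

theorem bijective_smul_xiClass (e₀ e : HomBasis A ℳ deg) :
    Function.Bijective fun a : A => a • xiClass 𝒜 heven hodd hπ e₀ e := by
  constructor
  · intro a b h
    simp only at h
    rw [xiClass, ← Submodule.Quotient.mk_smul, ← Submodule.Quotient.mk_smul,
      Submodule.Quotient.eq, ← sub_smul] at h
    exact sub_eq_zero.mp (eq_zero_of_smul_xiTop_mem hπ heven hodd e₀ e h)
  · intro x
    obtain ⟨s, rfl⟩ := Submodule.Quotient.mk_surjective _ x
    obtain ⟨a, ha⟩ := exists_sub_smul_xiTop_mem hπ heven hodd e₀ e s.2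
    refine ⟨a, ?_⟩
    simp only
    rw [xiClass, ← Submodule.Quotient.mk_smul]
    rw [eq_comm, Submodule.Quotient.eq]
    exact ha

/-- The isomorphism `a ↦ a [ξ_1 ⋯ ξ_r]`. -/
noncomputable def cohomologyEquiv (e₀ : HomBasis A ℳ deg) : A ≃ₗ[K] Cohomology 𝒜 π e₀ :=
  LinearEquiv.ofBijective ((LinearMap.toSpanSingleton A (Cohomology 𝒜 π e₀)
    (xiClass 𝒜 heven hodd hπ e₀ e₀)).restrictScalars K)
    (bijective_smul_xiClass heven hodd hπ e₀ e₀)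

/-- A homogeneous cocycle is congruent to a multiple of the top product whose coefficient, read off
at `topMon`, is homogeneous; conversely such multiples are homogeneous cocycles. The grading is thus
that of `A`, shifted. -/
theorem cohomologyGrading_eq (e₀ : HomBasis A ℳ deg) (γ : Grp n) :
    cohomologyGrading 𝒜 π e₀ γ = (𝒜 (γ + (∑ i, deg i + p • π))).map
      (cohomologyEquiv (𝒜 := 𝒜) heven hodd hπ e₀).toLinearMap := by
  apply le_antisymm
  · rintro _ ⟨s, hs, rfl⟩
    obtain ⟨t, ht⟩ := exists_eq_of_cocycle (kBasis 𝒜 π e₀) hπ (s := s.1)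
      (by rw [← kd_eq_dElt]; exact s.2)
    refine ⟨topSign deg π • toModel (kBasis 𝒜 π e₀) s.1 (topMon deg), ?_, ?_⟩
    · rw [← mdeg_topMon heven hodd]
      exact units_smul_mem (toModel_mem_homPart (kBasis 𝒜 π e₀) hs (topMon deg))
    · change (topSign deg π • toModel (kBasis 𝒜 π e₀) s.1 (topMon deg)) •
        xiClass 𝒜 heven hodd hπ e₀ e₀ = Submodule.Quotient.mk s
      rw [xiClass, ← Submodule.Quotient.mk_smul, eq_comm, Submodule.Quotient.eq]
      refine ⟨t, ?_⟩
      change s.1 - _ • xiTop 𝒜 π e₀ = _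
      rw [← units_smul_smul_comm, ← mmon_eq_xiTop heven hodd, sub_eq_iff_eq_add, kd_eq_dElt]
      exact ht
  · rintro _ ⟨a, ha, rfl⟩
    refine ⟨a • ⟨xiTop 𝒜 π e₀, kd_mul_xiTop hπ heven hodd e₀ e₀⟩, ?_, rfl⟩
    change a • xiTop 𝒜 π e₀ ∈ GSym.grading 𝒜 _ γ
    rw [xiTop_eq_mmon heven hodd, units_smul_smul_comm]
    have h := smul_mmon_mem_grading (kBasis 𝒜 π e₀) (units_smul_mem (u := topSign deg π) ha)
      (topMon deg)
    rwa [mdeg_topMon heven hodd, grp_add_add_cancel_right] at h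

include heven hodd hπ in
theorem cohomologyGrading_isInternal (e₀ : HomBasis A ℳ deg) :
    DirectSum.IsInternal (cohomologyGrading 𝒜 π e₀) :=
  isInternal_of_eq_map 𝒜 (cohomologyEquiv heven hodd hπ e₀) _
    (cohomologyGrading_eq heven hodd hπ e₀)

end Cohomology

/-! ### The isomorphism between the graded Berezinian module and the cohomology -/

section SignEquiv

variable {K A : Type*} {n : ℕ} [Field K] [Ring A] [Algebra K A]
  (𝒜 : Grp n → Submodule K A) [GradedAlgebra 𝒜]

/-- The automorphism `signAut` as a linear equivalence. -/
def signEquiv (γ : Grp n) : A ≃ₗ[K] A :=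
  { signLin 𝒜 γ with
    invFun := signAut 𝒜 γ
    left_inv := signAut_signAut 𝒜 γ
    right_inv := signAut_signAut 𝒜 γ }

theorem map_signEquiv (γ α : Grp n) : (𝒜 α).map (signEquiv 𝒜 γ).toLinearMap = 𝒜 α := by
  apply le_antisymm
  · rintro _ ⟨a, ha, rfl⟩
    exact signAut_mem 𝒜 ha
  · intro a ha
    exact ⟨signAut 𝒜 γ a, signAut_mem 𝒜 ha, signAut_signAut 𝒜 γ a⟩

end SignEquiv

section Main

variable {K A : Type*} {n : ℕ} [Field K] [CharZero K] [Ring A] [Algebra K A]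
  {𝒜 : Grp n → Submodule K A} [GradedAlgebra 𝒜] [IsGradedComm 𝒜]
  {p q : ℕ} {deg : Fin p ⊕ Fin q → Grp n}
  (heven : ∀ i : Fin p, deg (Sum.inl i) ⬝ᵥ deg (Sum.inl i) = 0)
  (hodd : ∀ j : Fin q, deg (Sum.inr j) ⬝ᵥ deg (Sum.inr j) = 1)
  {π : Grp n} (hπ : π ⬝ᵥ π = 1)
  {M : Type*} [AddCommGroup M] [Module K M] [Module A M] [IsScalarTower K A M]
  {ℳ : Grp n → Submodule K M} [DirectSum.Decomposition ℳ] [SetLike.GradedSMul 𝒜 ℳ]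

/-- The isomorphism `B(e) ↦ [ξ_1 ⋯ ξ_r]`. -/
noncomputable def chiEquiv (e₀ : HomBasis A ℳ deg) : GBer 𝒜 ℳ deg ≃ₗ[K] Cohomology 𝒜 π e₀ :=
  (gberEquiv heven hodd hπ e₀).symm.trans
    ((signEquiv 𝒜 (p • π)).trans (cohomologyEquiv heven hodd hπ e₀))

theorem chiEquiv_smul_bsym (e₀ : HomBasis A ℳ deg) (a : A) :
    chiEquiv (K := K) heven hodd hπ e₀ (a • bsym 𝒜 e₀) =
      signAut 𝒜 (p • π) a • xiClass 𝒜 heven hodd hπ e₀ e₀ := by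
  rw [chiEquiv, LinearEquiv.trans_apply, LinearEquiv.trans_apply,
    ← gberEquiv_apply (K := K) heven hodd hπ e₀ a, LinearEquiv.symm_apply_apply]
  rfl

theorem chiEquiv_smul (e₀ : HomBasis A ℳ deg) {α : Grp n} {a : A} (ha : a ∈ 𝒜 α)
    (x : GBer 𝒜 ℳ deg) : chiEquiv (K := K) heven hodd hπ e₀ (a • x) =
      ksign (p • π) α • (a • chiEquiv (K := K) heven hodd hπ e₀ x) := by
  obtain ⟨c, rfl⟩ := (bijective_smul_bsym heven hodd hπ e₀).2 x
  simp only
  rw [smul_smul, chiEquiv_smul_bsym, chiEquiv_smul_bsym, map_mul, signAut_of_mem 𝒜 _ ha, ← smul_smul,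
    ← units_smul_smul_comm, smul_comm]

/-- The map is built from `e₀` alone, but `B(e)` and the top class change by the same factor under a
change of basis. That factor has degree zero, so the sign automorphism does not affect it. -/
theorem chiEquiv_bsym (e₀ e : HomBasis A ℳ deg) :
    chiEquiv (K := K) heven hodd hπ e₀ (bsym 𝒜 e) = xiClass 𝒜 heven hodd hπ e₀ e := by
  rw [bsym_eq e₀ e, chiEquiv_smul_bsym, signAut_of_mem 𝒜 _ (gber_transition_mem heven hodd hπ e₀ e),
    ksign_zero_right, one_smul, xiClass_eq heven hodd hπ e₀ e₀ e, gber_transition heven hodd hπ]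

theorem map_chiEquiv (e₀ : HomBasis A ℳ deg) (γ : Grp n) :
    (gberGrading 𝒜 ℳ deg γ).map (chiEquiv (K := K) heven hodd hπ e₀).toLinearMap =
      cohomologyGrading 𝒜 π e₀ (γ + p • π) := by
  have h : γ + p • π + (∑ i, deg i + p • π) = γ + ∑ i, deg i := by
    rw [add_add_add_comm, grp_add_self, add_zero]
  have h2 : (chiEquiv (K := K) heven hodd hπ e₀).toLinearMap ∘ₗ
      (gberEquiv (𝒜 := 𝒜) heven hodd hπ e₀).toLinearMap =
      (cohomologyEquiv (𝒜 := 𝒜) heven hodd hπ e₀).toLinearMap ∘ₗ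
        (signEquiv 𝒜 (p • π)).toLinearMap :=
    LinearMap.ext fun a => chiEquiv_smul_bsym heven hodd hπ e₀ a
  rw [gberGrading_eq heven hodd hπ e₀, cohomologyGrading_eq heven hodd hπ e₀, h,
    ← Submodule.map_comp, h2, Submodule.map_comp, map_signEquiv]

/-- Every element is a multiple of `B(e₀)`, and the rule for homogeneous scalars extends to all
scalars by additivity. -/
theorem eq_chiEquiv (e₀ : HomBasis A ℳ deg) {χ : GBer 𝒜 ℳ deg ≃ₗ[K] Cohomology 𝒜 π e₀}
    (h : ∀ (α : Grp n) (a : A) (x : GBer 𝒜 ℳ deg), a ∈ 𝒜 α →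
      χ (a • x) = ksign (p • π) α • (a • χ x))
    (h' : χ (bsym 𝒜 e₀) = xiClass 𝒜 heven hodd hπ e₀ e₀) :
    χ = chiEquiv heven hodd hπ e₀ := by
  ext x
  obtain ⟨c, rfl⟩ := (bijective_smul_bsym heven hodd hπ e₀).2 x
  simp only
  induction c using DirectSum.Decomposition.inductionOn 𝒜 with
  | zero => rw [zero_smul, map_zero, map_zero]
  | add a b ha hb => rw [add_smul, map_add, map_add, ha, hb]
  | @homogeneous α a =>
    rw [h α a _ a.2, h', chiEquiv_smul heven hodd hπ e₀ a.2, chiEquiv_bsym]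

end Main

end GradedBerezinian

/-! ### The main theorem -/

theorem mainTheorem1 {K : Type*} [Field K] [CharZero K] {n : ℕ}
    {A : Type*} [Ring A] [Algebra K A] (𝒜 : GradedBerezinian.Grp n → Submodule K A)
    [GradedAlgebra 𝒜] [GradedBerezinian.IsGradedComm 𝒜]
    {M : Type*} [AddCommGroup M] [Module K M] [Module A M] [IsScalarTower K A M]
    (ℳ : GradedBerezinian.Grp n → Submodule K M) [DirectSum.Decomposition ℳ]
    [SetLike.GradedSMul 𝒜 ℳ]
    (π : GradedBerezinian.Grp n) (hπ : π ⬝ᵥ π = 1)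
    {p q : ℕ} (deg : Fin p ⊕ Fin q → GradedBerezinian.Grp n)
    (heven : ∀ i : Fin p, deg (Sum.inl i) ⬝ᵥ deg (Sum.inl i) = 0)
    (hodd : ∀ j : Fin q, deg (Sum.inr j) ⬝ᵥ deg (Sum.inr j) = 1)
    (e₀ : GradedBerezinian.HomBasis A ℳ deg) :
    -- the graded Berezinian is a group homomorphism with the two characteristic properties
    (∃ g : GradedBerezinian.GL0 𝒜 deg →* (𝒜 0)ˣ,
      (∀ T : GradedBerezinian.GL0 𝒜 deg,
        (((g T : (𝒜 0)ˣ) : 𝒜 0) : A) = GradedBerezinian.gber deg T.1.val) ∧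
      (∀ T : GradedBerezinian.GL0 𝒜 deg, (∀ i j, deg i ≠ deg j → T.1.val i j = 0) →
        ((g T : (𝒜 0)ˣ) : 𝒜 0) =
          (∏ γ : GradedBerezinian.Grp n with γ ⬝ᵥ γ = 0,
            (GradedBerezinian.diagBlock T.2.1 γ).det) *
          ∏ γ : GradedBerezinian.Grp n with γ ⬝ᵥ γ = 1,
            Ring.inverse (GradedBerezinian.diagBlock T.2.1 γ).det) ∧
      (∀ f : GradedBerezinian.Grp n → ℕ, Function.Injective f →
        ∀ T : GradedBerezinian.GL0 𝒜 deg,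
          (∀ i j, deg i = deg j → T.1.val i j = if i = j then 1 else 0) →
          (∀ i j, f (deg i) < f (deg j) → T.1.val i j = 0) → g T = 1)) ∧
    -- the graded Berezinian module is a graded module, free on any one of the symbols `B(e)`
    (∀ e : GradedBerezinian.HomBasis A ℳ deg,
      Function.Bijective fun a : A => a • GradedBerezinian.bsym 𝒜 e) ∧
    DirectSum.IsInternal (GradedBerezinian.gberGrading 𝒜 ℳ deg) ∧
    -- `d` does not depend on the basis, and it is the differential of a cochain complex
    (∀ e : GradedBerezinian.HomBasis A ℳ deg,
      GradedBerezinian.kd 𝒜 π e = GradedBerezinian.kd 𝒜 π e₀) ∧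
    GradedBerezinian.kd 𝒜 π e₀ * GradedBerezinian.kd 𝒜 π e₀ = 0 ∧
    (∀ e : GradedBerezinian.HomBasis A ℳ deg,
      DirectSum.IsInternal (GradedBerezinian.level 𝒜 π e) ∧
      ∀ k, ∀ s ∈ GradedBerezinian.level 𝒜 π e k,
        GradedBerezinian.kd 𝒜 π e₀ * s ∈ GradedBerezinian.level 𝒜 π e (k + 1)) ∧
    DirectSum.IsInternal (GradedBerezinian.cohomologyGrading 𝒜 π e₀) ∧
    -- `B(e) ↦ [ξ_1 ⋯ ξ_r]` defines an isomorphism of graded modules of degree `p π`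
    ∃! χ : GradedBerezinian.GBer 𝒜 ℳ deg ≃ₗ[K] GradedBerezinian.Cohomology 𝒜 π e₀,
      (∀ (α : GradedBerezinian.Grp n) (a : A) (x : GradedBerezinian.GBer 𝒜 ℳ deg), a ∈ 𝒜 α →
        χ (a • x) = GradedBerezinian.ksign (p • π) α • (a • χ x)) ∧
      (∀ γ : GradedBerezinian.Grp n,
        (GradedBerezinian.gberGrading 𝒜 ℳ deg γ).map χ.toLinearMap =
          GradedBerezinian.cohomologyGrading 𝒜 π e₀ (γ + p • π)) ∧
      (∀ e : GradedBerezinian.HomBasis A ℳ deg,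
        ∃ h : GradedBerezinian.xiTop 𝒜 π e ∈ GradedBerezinian.cocycles 𝒜 π e₀,
          χ (GradedBerezinian.bsym 𝒜 e) =
            Submodule.Quotient.mk ⟨GradedBerezinian.xiTop 𝒜 π e, h⟩) := by
  refine ⟨?_, GradedBerezinian.bijective_smul_bsym heven hodd hπ,
    GradedBerezinian.gberGrading_isInternal heven hodd hπ e₀,
    fun e => GradedBerezinian.kd_eq_kd π e₀ e, GradedBerezinian.kd_mul_kd hπ e₀,
    fun e => ⟨GradedBerezinian.level_isInternal e,
      fun k s hs => GradedBerezinian.kd_mul_mem_level e₀ e hs⟩,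
    GradedBerezinian.cohomologyGrading_isInternal heven hodd hπ e₀,
    GradedBerezinian.chiEquiv heven hodd hπ e₀, ⟨?_, ?_, ?_⟩, ?_⟩
  · obtain ⟨g, hg⟩ := GradedBerezinian.exists_gberHom (𝒜 := 𝒜) heven hodd hπ e₀
    refine ⟨g, fun T => ?_, fun T hT => ?_, fun f hf T h1 h0 => ?_⟩
    · rw [hg, GradedBerezinian.gber_eq_topCoeff heven hodd hπ e₀]
    · exact Subtype.ext
        ((hg T).trans (GradedBerezinian.topCoeff_of_blockDiagonal heven hodd T hT))
    · exact Units.ext (Subtype.ext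
        ((hg T).trans (GradedBerezinian.topCoeff_of_unitriangular heven hodd hf T h1 h0)))
  · exact fun α a x ha => GradedBerezinian.chiEquiv_smul heven hodd hπ e₀ ha x
  · exact GradedBerezinian.map_chiEquiv heven hodd hπ e₀
  · exact fun e => ⟨_, GradedBerezinian.chiEquiv_bsym heven hodd hπ e₀ e⟩
  · rintro χ ⟨h1, -, h3⟩
    exact GradedBerezinian.eq_chiEquiv heven hodd hπ e₀ h1 (h3 e₀).2
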